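/- Let $G$ be a simply connected (real, finite-dimensional) Lie group with Lie algebra $\mathfrak g$. **Spaces.** Let $EG_p=G^{p+1}$ and $BG_p=G^p$. On $\bigoplus_{p,q}\Omega^q(EG_p)$ use the total differential $\partial+(-1)^p d$, where $\partial=\sum_i(-1)^i\bar\varepsilon_i^*$ and $\bar\varepsilon_i$ omits the entry $g_i$, and the cup product $\omega\cup\omega'=(-1)^{qp'}\mathrm{pr}^*\omega\wedge\mathrm{pr}'^*\omega'$ for $\omega\in\Omega^q(EG_p)$, $\omega'\in\Omega^{q'}(EG_{p'})$, where $\mathrm{pr}(g_0,\dots,g_{p+p'})=(g_0,\dots,g_p)$ and $\mathrm{pr}'(g_0,\dots,g_{p+p'})=(g_p,\dots,g_{p+p'})$. The group $G^{p+1}$ acts on $BG_p$ by $\zeta(g_0,\dots,g_p)(x_1,\dots,x_p)=(g_0x_1g_1^{-1},\dots,g_{p-1}x_pg_p^{-1})$; let $\Omega^\bullet(BG_\bullet)^{G_{\bullet+1}}$ be the space $\bigoplus_{p,q}\Omega^q(BG_p)^{G^{p+1}}$ of invariant forms. For $1\le i\le p$ let $\gamma_i$ be the action of the factor $g_i$,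 and for $x\in\mathfrak g$ let $x^{i,\sharp}$ be the vector field on $BG_p$ generated by it (so that at $(e,\dots,e)$ its $i$-th entry is $-x$, its $(i+1)$-st entry, if $i<p$, is $x$, and the others are $0$). **Weil algebras.** Let $W\mathfrak g=\Lambda\mathfrak g^*\otimes S\mathfrak g^*$, $W^{p,q}\mathfrak g=\Lambda^{p-q}\mathfrak g^*\otimes S^q\mathfrak g^*$, and regard $S\mathfrak g^*$ as $1\otimes S\mathfrak g^*\subset W\mathfrak g$. Write $t(\xi)\in\Lambda^1\mathfrak g^*$ (odd) and $w(\xi)\in S^1\mathfrak g^*$ (even) for the generators given by $\xi\in\mathfrak g^*$. If $e_a$ is a basis of $\mathfrak g$ with dual basis $e^a$, $t^a=t(e^a)$, $w^a=w(e^a)$ and $[e_b,e_c]=f^a_{bc}e_a$, the differential of $W\mathfrak g$ satisfies $dt^a=w^a-\tfrac12f^a_{bc}t^bt^c$. Thus $W\mathfrak g$ is the graded commutative algebra on the $t(\xi)$ and $dt(\xi)$. The noncommutative Weil algebra $\widetilde W\mathfrak g$ is the free algebra on these generators (linear in $\xi$), and $\mathrm{sym}\colon W\mathfrak g\to\widetilde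 W\mathfrak g$ is graded symmetrisation in the generators $t(\xi),dt(\xi)$. **The Alekseev–Meinrenken map.** Let $\theta\colon\mathfrak g^*\to\Omega^1(EG_0)$, $\theta(\xi)=\langle\xi,\theta_{MC}\rangle$, with $\theta_{MC}$ the left-invariant Maurer–Cartan form of $G=EG_0$. Let $\widetilde c^{\,\theta}\colon\widetilde W\mathfrak g\to\Omega^\bullet(EG_\bullet)$ be the algebra homomorphism that sends $t(\xi)$ to $\theta(\xi)$ and $dt(\xi)$ to $(\partial+d)\theta(\xi)$. Let $\iota\colon BG_p\to EG_p$, $\iota(g_1,\dots,g_p)=(e,g_1^{-1},(g_1g_2)^{-1},\dots,(g_1\cdots g_p)^{-1})$. Put $\mathsf{AM}^\theta=\iota^*\circ\widetilde c^{\,\theta}\circ\mathrm{sym}$, restricted to $S\mathfrak g^*$. **The Van Est map.** For $\omega\in\Omega^q(BG_p)$ with $q\le p$, $\mathsf{VE}(\omega)\in W^{p,q}\mathfrak g$ is determined by $$i_\Lambda(x_p)\cdots i_\Lambda(x_{q+1})\,i_S(x_q)\cdots i_S(x_1)\,\mathsf{VE}(\omega)=\sum_{\sigma\in\mathfrak S_p}\varepsilon(\sigma)\Big(i_{x^{1,\sharp}_{\sigma(1)}}\cdots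 i_{x^{q,\sharp}_{\sigma(q)}}L_{x^{q+1,\sharp}_{\sigma(q+1)}}\cdots L_{x^{p,\sharp}_{\sigma(p)}}\omega\Big)(e,\dots,e)$$ for all $x_1,\dots,x_p\in\mathfrak g$. Here $i_\Lambda(x)$, $i_S(x)$ are the contractions of the two factors of $W\mathfrak g$ (the derivations extending $\xi\mapsto\xi(x)$), and $\varepsilon(\sigma)$ is the sign of the number of pairs $q+1\le i<j\le p$ with $\sigma(i)>\sigma(j)$. For $q>p$, $\mathsf{VE}(\omega)=0$. **Theorem.** $\mathsf{AM}^\theta$ maps $(S^\bullet\mathfrak g^*)^G$ into $\Omega^\bullet(BG_\bullet)^{G_{\bullet+1}}$. The formula above gives a well-defined map $\mathsf{VE}$ on $\Omega^\bullet(BG_\bullet)^{G_{\bullet+1}}$, with values in $(S^\bullet\mathfrak g^*)^G$. Moreover $$\mathsf{VE}\circ\mathsf{AM}^\theta=\mathrm{id}\quad\text{on }(S^\bullet\mathfrak g^*)^G .$$ Concretely, for every basis $e_a$ of $\mathfrak g$ and all $a_1,\dots,a_p$, $\mathsf{VE}(\mathsf{AM}^\theta(w^{a_1}\cdots w^{a_p}))=w^{a_1}\cdots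 w^{a_p}$. -/

import Mathlib

open scoped TensorProduct DirectSum Manifold ContDiff

noncomputable section

namespace SuperSym

variable (A B : Type*) [AddCommGroup A] [Module ℝ A] [AddCommGroup B] [Module ℝ B]

/-- The projection of the super vector space `A ⊕ B` (`A` odd, `B` even) onto its odd part
(`true`) or its even part (`false`). -/
def parityProj : Bool → (A × B) →ₗ[ℝ] (A × B)
  | true => LinearMap.inl ℝ A B ∘ₗ LinearMap.fst ℝ A B
  | false => LinearMap.inr ℝ A B ∘ₗ LinearMap.snd ℝ A B

/-- The Koszul sign of the rearrangement `v₁ ⋯ vₙ ↦ v_{σ(1)} ⋯ v_{σ(n)}` of letters whose parities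
are `ε` (`true` is odd): `-1` for each inverted pair of odd letters. -/
def koszulSign {n : ℕ} (σ : Equiv.Perm (Fin n)) (ε : Fin n → Bool) : ℝ :=
  ∏ p ∈ Finset.univ.filter (fun p : Fin n × Fin n => p.1 < p.2),
    if σ p.2 < σ p.1 ∧ ε (σ p.1) = true ∧ ε (σ p.2) = true then -1 else 1

/-- The multilinear map `(v₁, …, vₙ) ↦ (1/n!) ∑_σ ± v_{σ(1)} ⊗ ⋯ ⊗ v_{σ(n)}` with Koszul signs;
each letter is decomposed into its homogeneous parts. -/
def symMulti (n : ℕ) : MultilinearMap ℝ (fun _ : Fin n => A × B) (TensorAlgebra ℝ (A × B)) :=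
  (n.factorial : ℝ)⁻¹ • ∑ σ : Equiv.Perm (Fin n), ∑ ε : Fin n → Bool,
    koszulSign σ ε •
      (MultilinearMap.domDomCongr σ (TensorAlgebra.tprod ℝ (A × B) n)).compLinearMap
        (fun i => parityProj A B (ε i))

/-- Graded symmetrisation, as a linear operator on the tensor algebra of `A ⊕ B`. -/
def symOp : TensorAlgebra ℝ (A × B) →ₗ[ℝ] TensorAlgebra ℝ (A × B) :=
  (DirectSum.toModule ℝ ℕ (TensorAlgebra ℝ (A × B))
    (fun n => PiTensorProduct.lift (symMulti A B n))) ∘ₗ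
    (TensorAlgebra.toDirectSum (R := ℝ) (M := A × B)).toLinearMap

variable {A B}

theorem symOp_tprod {n : ℕ} (v : Fin n → A × B) :
    symOp A B (TensorAlgebra.tprod ℝ (A × B) n v) = symMulti A B n v := by
  rw [symOp, LinearMap.comp_apply, AlgHom.toLinearMap_apply,
    TensorAlgebra.toDirectSum_tensorPower_tprod, ← DirectSum.lof_eq_of ℝ, DirectSum.toModule_lof,
    PiTensorProduct.lift.tprod]

theorem symMulti_apply {n : ℕ} (v : Fin n → A × B) :
    symMulti A B n v = (n.factorial : ℝ)⁻¹ • ∑ σ : Equiv.Perm (Fin n), ∑ ε : Fin n → Bool,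
      koszulSign σ ε • TensorAlgebra.tprod ℝ (A × B) n
        (fun i => parityProj A B (ε (σ i)) (v (σ i))) := by
  simp [symMulti]

theorem koszulSign_swap {n : ℕ} (σ : Equiv.Perm (Fin n)) (ε : Fin n → Bool) (k l : Fin n)
    (hkl : (l : ℕ) = k + 1) :
    koszulSign (Equiv.swap k l * σ) (ε ∘ Equiv.swap k l) =
      (if ε k = true ∧ ε l = true then -1 else 1) * koszulSign σ ε := by
  have hne : k ≠ l := fun h => by rw [h] at hkl; omega
  set g : Fin n × Fin n → ℝ := fun p =>
    if ((σ p.1 = k ∧ σ p.2 = l) ∨ (σ p.1 = l ∧ σ p.2 = k)) ∧ ε k = true ∧ ε l = true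
      then -1 else 1 with hg
  have h1 : koszulSign (Equiv.swap k l * σ) (ε ∘ Equiv.swap k l) =
      (∏ p ∈ Finset.univ.filter (fun p : Fin n × Fin n => p.1 < p.2), g p) * koszulSign σ ε := by
    unfold koszulSign
    rw [← Finset.prod_mul_distrib]
    refine Finset.prod_congr rfl fun p hp => ?_
    have hp' : p.1 < p.2 := (Finset.mem_filter.1 hp).2
    have hab : σ p.1 ≠ σ p.2 := fun h => hp'.ne (σ.injective h)
    simp only [hg, Equiv.Perm.mul_apply, Function.comp_apply, Equiv.swap_apply_self]
    generalize σ p.1 = a at *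
    generalize σ p.2 = b at *
    have hlt : (Equiv.swap k l b < Equiv.swap k l a) ↔
        if (a = k ∧ b = l) ∨ (a = l ∧ b = k) then ¬ b < a else b < a := by
      simp only [Equiv.swap_apply_def]
      grind
    simp only [hlt]
    grind
  rw [h1]
  congr 1
  have key : ∀ i j : Fin n, i < j → ((σ i = k ∧ σ j = l) ∨ (σ i = l ∧ σ j = k)) →
      ∏ p ∈ Finset.univ.filter (fun p : Fin n × Fin n => p.1 < p.2), g p =
        if ε k = true ∧ ε l = true then -1 else 1 := by
    intro i j hij h
    rw [Finset.prod_eq_single (i, j)]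
    · simp [hg, h]
    · intro p hp hpne
      have hp' : p.1 < p.2 := (Finset.mem_filter.1 hp).2
      simp only [hg]
      rw [if_neg]
      rintro ⟨h', -⟩
      apply hpne
      rcases h with ⟨ha, hb⟩ | ⟨ha, hb⟩ <;> rcases h' with ⟨ha', hb'⟩ | ⟨ha', hb'⟩
      · exact Prod.ext (σ.injective (ha'.trans ha.symm)) (σ.injective (hb'.trans hb.symm))
      · have e1 : p.1 = j := σ.injective (ha'.trans hb.symm)
        have e2 : p.2 = i := σ.injective (hb'.trans ha.symm)
        rw [e1, e2] at hp'
        exact absurd hp' hij.asymm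
      · have e1 : p.1 = j := σ.injective (ha'.trans hb.symm)
        have e2 : p.2 = i := σ.injective (hb'.trans ha.symm)
        rw [e1, e2] at hp'
        exact absurd hp' hij.asymm
      · exact Prod.ext (σ.injective (ha'.trans ha.symm)) (σ.injective (hb'.trans hb.symm))
    · intro h'
      exact absurd (by simpa using hij) h'
  rcases lt_trichotomy (σ⁻¹ k) (σ⁻¹ l) with h | h | h
  · exact key _ _ h (Or.inl (by simp))
  · exact absurd (σ⁻¹.injective h) hne
  · exact key _ _ h (Or.inr (by simp))

theorem parityProj_parityProj (α β : Bool) (v : A × B) :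
    parityProj A B α (parityProj A B β v) = if α = β then parityProj A B β v else 0 := by
  cases α <;> cases β <;> simp [parityProj]

theorem symMulti_swap {n : ℕ} (v : Fin n → A × B) (k l : Fin n) (hkl : (l : ℕ) = k + 1)
    (α β : Bool) (x y : A × B) (hk : v k = parityProj A B α x) (hl : v l = parityProj A B β y) :
    symMulti A B n (v ∘ Equiv.swap k l) =
      (if α = true ∧ β = true then (-1 : ℝ) else 1) • symMulti A B n v := by
  rw [symMulti_apply, symMulti_apply, smul_comm]
  congr 1
  rw [Finset.smul_sum, ← Equiv.sum_comp (Equiv.mulLeft (Equiv.swap k l)) (fun σ => _ • _)]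
  refine Finset.sum_congr rfl fun σ _ => ?_
  rw [Finset.smul_sum,
    ← Equiv.sum_comp ((Equiv.swap k l).arrowCongr (Equiv.refl Bool)) (fun ε => _ • _ • _)]
  refine Finset.sum_congr rfl fun ε _ => ?_
  have he : ((Equiv.swap k l).arrowCongr (Equiv.refl Bool)) ε = ε ∘ Equiv.swap k l := by
    ext i; simp [Equiv.arrowCongr]
  simp only [he, Equiv.coe_mulLeft, koszulSign_swap σ ε k l hkl, Equiv.Perm.mul_apply,
    Function.comp_apply, Equiv.swap_apply_self, smul_smul]
  by_cases hε : ε k = β ∧ ε l = α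
  · obtain ⟨rfl, rfl⟩ := hε
    congr 1
    by_cases h1 : ε k = true <;> by_cases h2 : ε l = true <;> simp [h1, h2]
  · have h0 : TensorAlgebra.tprod ℝ (A × B) n
        (fun i => parityProj A B (ε (σ i)) (v (Equiv.swap k l (σ i)))) = 0 := by
      rw [not_and_or] at hε
      rcases hε with h | h
      · refine (TensorAlgebra.tprod ℝ (A × B) n).map_coord_zero (σ⁻¹ k) ?_
        simp [hl, parityProj_parityProj, h]
      · refine (TensorAlgebra.tprod ℝ (A × B) n).map_coord_zero (σ⁻¹ l) ?_
        simp [hk, parityProj_parityProj, h]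
    rw [h0, smul_zero, smul_zero]

/-- Exchanging two neighbouring homogeneous letters of a word changes its graded symmetrisation by
the Koszul sign. -/
theorem symOp_swap_words (u w : List (A × B)) (α β : Bool) (x y : A × B) :
    symOp A B ((u.map (TensorAlgebra.ι ℝ)).prod * (TensorAlgebra.ι ℝ (parityProj A B β y) *
        TensorAlgebra.ι ℝ (parityProj A B α x)) * (w.map (TensorAlgebra.ι ℝ)).prod) =
      (if α = true ∧ β = true then (-1 : ℝ) else 1) •
      symOp A B ((u.map (TensorAlgebra.ι ℝ)).prod * (TensorAlgebra.ι ℝ (parityProj A B α x) *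
        TensorAlgebra.ι ℝ (parityProj A B β y)) * (w.map (TensorAlgebra.ι ℝ)).prod) := by
  set L : List (A × B) := u ++ parityProj A B α x :: parityProj A B β y :: w with hL
  have hlen : L.length = u.length + (w.length + 2) := by simp [hL]
  let k : Fin L.length := ⟨u.length, by omega⟩
  let l : Fin L.length := ⟨u.length + 1, by omega⟩
  have e1 : (u.map (TensorAlgebra.ι ℝ)).prod * (TensorAlgebra.ι ℝ (parityProj A B α x) *
        TensorAlgebra.ι ℝ (parityProj A B β y)) * (w.map (TensorAlgebra.ι ℝ)).prod =
      TensorAlgebra.tprod ℝ (A × B) L.length L.get := by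
    rw [TensorAlgebra.tprod_apply]
    have : (List.ofFn fun i => TensorAlgebra.ι ℝ (L.get i)) = L.map (TensorAlgebra.ι ℝ) := by
      rw [← Function.comp_def, ← List.map_ofFn, List.ofFn_get]
    rw [this, hL]
    simp [mul_assoc]
  have e2 : (u.map (TensorAlgebra.ι ℝ)).prod * (TensorAlgebra.ι ℝ (parityProj A B β y) *
        TensorAlgebra.ι ℝ (parityProj A B α x)) * (w.map (TensorAlgebra.ι ℝ)).prod =
      TensorAlgebra.tprod ℝ (A × B) L.length (L.get ∘ Equiv.swap k l) := by
    rw [TensorAlgebra.tprod_apply]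
    have : (List.ofFn fun i => TensorAlgebra.ι ℝ ((L.get ∘ Equiv.swap k l) i)) =
        (u ++ parityProj A B β y :: parityProj A B α x :: w).map (TensorAlgebra.ι ℝ) := by
      rw [← Function.comp_def, ← List.map_ofFn]
      congr 1
      refine List.ext_getElem (by simp [hlen]; omega) fun i h1 h2 => ?_
      simp only [List.getElem_ofFn, Function.comp_apply, List.get_eq_getElem]
      have hi : i < L.length := by simpa using h1
      rcases lt_trichotomy i u.length with h | h | h
      · rw [Equiv.swap_apply_of_ne_of_ne (by simp [k, Fin.ext_iff]; omega)
          (by simp [l, Fin.ext_iff]; omega)]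
        simp [hL, h]
      · subst h
        rw [show (⟨u.length, hi⟩ : Fin L.length) = k from rfl, Equiv.swap_apply_left]
        simp [hL, l]
      · rcases Nat.lt_or_ge (u.length + 1) i with h' | h'
        · rw [Equiv.swap_apply_of_ne_of_ne (by simp [k, Fin.ext_iff]; omega)
            (by simp [l, Fin.ext_iff]; omega)]
          obtain ⟨j, rfl⟩ : ∃ j, i = u.length + (j + 2) := ⟨i - u.length - 2, by omega⟩
          simp [hL]
        · obtain rfl : i = u.length + 1 := by omega
          rw [show (⟨u.length + 1, hi⟩ : Fin L.length) = l from rfl, Equiv.swap_apply_right]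
          simp [hL, k]
    rw [this]
    simp [mul_assoc]
  rw [e1, e2, symOp_tprod, symOp_tprod]
  refine symMulti_swap L.get k l rfl α β x y ?_ ?_
  · simp [hL, k]
  · simp [hL, l]

/-- The words in the letters span the tensor algebra. -/
theorem mem_span_words (a : TensorAlgebra ℝ (A × B)) :
    a ∈ Submodule.span ℝ (Set.range fun u : List (A × B) =>
      (u.map (TensorAlgebra.ι ℝ)).prod) := by
  induction a using TensorAlgebra.induction with
  | algebraMap r =>
    rw [Algebra.algebraMap_eq_smul_one]
    exact Submodule.smul_mem _ _ (Submodule.subset_span ⟨[], by simp⟩)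
  | ι x => exact Submodule.subset_span ⟨[x], by simp⟩
  | mul a b ha hb =>
    have h := Submodule.mul_mem_mul ha hb
    rw [Submodule.span_mul_span] at h
    refine Submodule.span_mono ?_ h
    rintro _ ⟨_, ⟨u, rfl⟩, _, ⟨w, rfl⟩, rfl⟩
    exact ⟨u ++ w, by simp⟩
  | add a b ha hb => exact add_mem ha hb

/-- Graded symmetrisation kills graded commutators of letters, in any context. -/
theorem symOp_swap (a b : TensorAlgebra ℝ (A × B)) (α β : Bool) (x y : A × B) :
    symOp A B (a * (TensorAlgebra.ι ℝ (parityProj A B β y) *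
        TensorAlgebra.ι ℝ (parityProj A B α x)) * b) =
      (if α = true ∧ β = true then (-1 : ℝ) else 1) •
      symOp A B (a * (TensorAlgebra.ι ℝ (parityProj A B α x) *
        TensorAlgebra.ι ℝ (parityProj A B β y)) * b) := by
  induction mem_span_words a using Submodule.span_induction with
  | zero => simp
  | add p q _ _ hp hq => simp only [add_mul, map_add, hp, hq, smul_add]
  | smul r p _ hp => simp only [smul_mul_assoc, map_smul, hp]; rw [smul_comm]
  | mem p hp =>
    obtain ⟨u, rfl⟩ := hp
    induction mem_span_words b using Submodule.span_induction with
    | zero => simp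
    | add p q _ _ hp hq => simp only [mul_add, map_add, hp, hq, smul_add]
    | smul r p _ hp => simp only [mul_smul_comm, map_smul, hp]; rw [smul_comm]
    | mem q hq =>
      obtain ⟨w, rfl⟩ := hq
      exact symOp_swap_words u w α β x y

/-- `z` may be moved past any element inside `symOp`. -/
def SymCentral (z : TensorAlgebra ℝ (A × B)) : Prop :=
  ∀ a b w, symOp A B (a * (w * z) * b) = symOp A B (a * (z * w) * b)

theorem symCentral_of_letters {z : TensorAlgebra ℝ (A × B)}
    (h : ∀ a b (β : Bool) y, symOp A B (a * (TensorAlgebra.ι ℝ (parityProj A B β y) * z) * b) =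
      symOp A B (a * (z * TensorAlgebra.ι ℝ (parityProj A B β y)) * b)) : SymCentral z := by
  intro a b w
  induction w using TensorAlgebra.induction generalizing a b with
  | algebraMap r => rw [Algebra.commutes]
  | ι v =>
    have hv : v = parityProj A B true v + parityProj A B false v := by simp [parityProj]
    rw [hv, map_add]
    simp only [add_mul, mul_add, map_add, h]
  | mul p q hp hq =>
    have e1 := hq (a * p) b
    have e2 := hp a (q * b)
    simp only [mul_assoc] at e1 e2 ⊢
    rw [e1, e2]
  | add p q hp hq => simp only [add_mul, mul_add, map_add, hp, hq]

theorem SymCentral.add {z z' : TensorAlgebra ℝ (A × B)} (h : SymCentral z) (h' : SymCentral z') :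
    SymCentral (z + z') := fun a b w => by
  simp only [add_mul, mul_add, map_add, h a b w, h' a b w]

theorem SymCentral.smul {z : TensorAlgebra ℝ (A × B)} (r : ℝ) (h : SymCentral z) :
    SymCentral (r • z) := fun a b w => by
  simp only [smul_mul_assoc, mul_smul_comm, map_smul, h a b w]

theorem SymCentral.sum {J : Type*} (s : Finset J) {z : J → TensorAlgebra ℝ (A × B)}
    (h : ∀ j ∈ s, SymCentral (z j)) : SymCentral (∑ j ∈ s, z j) := fun a b w => by
  simp only [Finset.mul_sum, Finset.sum_mul, map_sum]
  exact Finset.sum_congr rfl fun j hj => h j hj a b w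

/-- Even letters are central for symmetrisation. -/
theorem symCentral_even (y : B) : SymCentral (TensorAlgebra.ι ℝ ((0, y) : A × B)) := by
  refine symCentral_of_letters fun a b β x => ?_
  have := symOp_swap a b false β (0, y) x
  simpa [parityProj] using this

/-- Products of two odd letters are central for symmetrisation. -/
theorem symCentral_odd_mul_odd (x x' : A) :
    SymCentral (TensorAlgebra.ι ℝ ((x, 0) : A × B) * TensorAlgebra.ι ℝ ((x', 0) : A × B)) := by
  refine symCentral_of_letters fun a b β y => ?_
  have e1 := symOp_swap a (TensorAlgebra.ι ℝ ((x', 0) : A × B) * b) true β (x, 0) y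
  have e2 := symOp_swap (a * TensorAlgebra.ι ℝ ((x, 0) : A × B)) b true β (x', 0) y
  have hp : ∀ z : A, parityProj A B true (z, 0) = (z, 0) := fun z => by simp [parityProj]
  simp only [hp, mul_assoc] at e1 e2 ⊢
  rw [e1, e2, smul_smul]
  cases β <;> simp

/-- A linear map on the tensor algebra that is insensitive to exchanging neighbouring letters
descends to the symmetric algebra. -/
def descend {M N : Type*} [AddCommGroup M] [Module ℝ M] [AddCommGroup N] [Module ℝ N]
    (f : TensorAlgebra ℝ M →ₗ[ℝ] N)
    (hf : ∀ a b x y, f (a * (TensorAlgebra.ι ℝ x * TensorAlgebra.ι ℝ y) * b) =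
      f (a * (TensorAlgebra.ι ℝ y * TensorAlgebra.ι ℝ x) * b)) :
    SymmetricAlgebra ℝ M →ₗ[ℝ] N :=
  (Submodule.liftQ (LinearMap.ker (SymmetricAlgebra.algHom ℝ M).toLinearMap) f (by
    let c : RingCon (TensorAlgebra ℝ M) :=
      { r := fun p q => ∀ a b, f (a * p * b) = f (a * q * b)
        iseqv := ⟨fun _ _ _ => rfl, fun h a b => (h a b).symm,
          fun h h' a b => (h a b).trans (h' a b)⟩
        add' := fun h h' a b => by simp only [mul_add, add_mul, map_add, h a b, h' a b]
        mul' := fun {w x y z} h h' a b => by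
          have e1 := h a (y * b)
          have e2 := h' (a * x) b
          simp only [mul_assoc] at e1 e2 ⊢
          rw [e1, e2] }
    have hle : TensorAlgebra.symRingCon ℝ M ≤ c := by
      refine RingCon.ringConGen_le.2 ?_
      rintro _ _ ⟨x, y⟩
      exact fun a b => hf a b x y
    intro p hp
    have hp' : (TensorAlgebra.symRingCon ℝ M) p 0 := by
      have : (p : SymmetricAlgebra ℝ M) = ((0 : TensorAlgebra ℝ M) : SymmetricAlgebra ℝ M) := by
        simpa using hp
      exact (RingCon.eq _).1 this
    simpa using hle hp' 1 1)) ∘ₗ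
  ((SymmetricAlgebra.algHom ℝ M).toLinearMap.quotKerEquivOfSurjective
    (SymmetricAlgebra.algHom_surjective ℝ M)).symm.toLinearMap

theorem descend_algHom {M N : Type*} [AddCommGroup M] [Module ℝ M] [AddCommGroup N] [Module ℝ N]
    (f : TensorAlgebra ℝ M →ₗ[ℝ] N)
    (hf : ∀ a b x y, f (a * (TensorAlgebra.ι ℝ x * TensorAlgebra.ι ℝ y) * b) =
      f (a * (TensorAlgebra.ι ℝ y * TensorAlgebra.ι ℝ x) * b)) (p : TensorAlgebra ℝ M) :
    descend f hf (SymmetricAlgebra.algHom ℝ M p) = f p := by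
  have h : ((SymmetricAlgebra.algHom ℝ M).toLinearMap.quotKerEquivOfSurjective
      (SymmetricAlgebra.algHom_surjective ℝ M)).symm (SymmetricAlgebra.algHom ℝ M p) =
      Submodule.Quotient.mk p := by
    rw [LinearEquiv.symm_apply_eq]
    rfl
  rw [descend, LinearMap.comp_apply, LinearEquiv.coe_coe, h]
  rfl

end SuperSym

/-! ### Differential forms on manifolds -/

section Forms

variable {F : Type*} [NormedAddCommGroup F] [NormedSpace ℝ F] {H : Type*} [TopologicalSpace H]
  (I : ModelWithCorners ℝ F H) (M : Type*) [TopologicalSpace M] [ChartedSpace H M]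
  (N : Type*) [NormedAddCommGroup N] [NormedSpace ℝ N]
  {F' : Type*} [NormedAddCommGroup F'] [NormedSpace ℝ F'] {H' : Type*} [TopologicalSpace H']
  (I' : ModelWithCorners ℝ F' H') {M' : Type*} [TopologicalSpace M'] [ChartedSpace H' M']

/-- Fields of alternating `q`-forms on the tangent spaces of `M` with values in `N`. The tangent
space `TangentSpace I x` is by definition the model space `F`. Smoothness is imposed separately,
see `IsSmoothForm`. -/
abbrev DForm (_I : ModelWithCorners ℝ F H) (M : Type*) [TopologicalSpace M] [ChartedSpace H M]
    (N : Type*) [NormedAddCommGroup N] [NormedSpace ℝ N] (q : ℕ) : Type _ :=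
  M → F [⋀^Fin q]→L[ℝ] N

variable {M}

/-- The differential `T_x M → T_{f x} M'` of a map of manifolds. -/
def tangentMapAt (f : M → M') (x : M) : F →L[ℝ] F' := mfderiv I I' f x

variable {N}

/-- The expression in the preferred chart at `m` of a form: its pullback under the inverse chart. -/
def chartForm {q : ℕ} (η : DForm I M N q) (m : M) (y : F) : F [⋀^Fin q]→L[ℝ] N :=
  (η ((extChartAt I m).symm y)).compContinuousLinearMap
    (tangentMapAt 𝓘(ℝ, F) I (extChartAt I m).symm y)

/-- A form is smooth if all its chart expressions are smooth. -/
def IsSmoothForm {q : ℕ} (η : DForm I M N q) : Prop :=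
  ∀ m : M, ContDiffOn ℝ ∞ (chartForm I η m) (extChartAt I m).target

/-- The exterior derivative, computed in the preferred chart at each point. -/
def extD {q : ℕ} (η : DForm I M N q) : DForm I M N (q + 1) := fun m =>
  (extDeriv (chartForm I η m) (extChartAt I m m)).compContinuousLinearMap
    (tangentMapAt I 𝓘(ℝ, F) (extChartAt I m) m)

/-- The pullback of forms under a map. -/
def pullbackForm {q : ℕ} (f : M → M') : DForm I' M' N q →ₗ[ℝ] DForm I M N q where
  toFun η := fun x => (η (f x)).compContinuousLinearMap (tangentMapAt I I' f x)
  map_add' _ _ := by ext; simp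
  map_smul' _ _ := by ext; simp

/-- The product `(v₁, …, v_{q+q'}) ↦ α(v₁, …, v_q) β(v_{q+1}, …, v_{q+q'})`. -/
def mulForms {q q' : ℕ} (α : F [⋀^Fin q]→L[ℝ] ℝ) (β : F [⋀^Fin q']→L[ℝ] ℝ) :
    ContinuousMultilinearMap ℝ (fun _ : Fin (q + q') => F) ℝ where
  toMultilinearMap := MultilinearMap.domDomCongr finSumFinEquiv
    ((LinearMap.mul' ℝ ℝ).compMultilinearMap
      (MultilinearMap.domCoprod α.toMultilinearMap β.toMultilinearMap))
  cont := by
    have : Continuous fun v : Fin (q + q') → F =>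
        α (fun i => v (Fin.castAdd q' i)) * β (fun i => v (Fin.natAdd q i)) := by fun_prop
    exact this

theorem mulForms_apply {q q' : ℕ} (α : F [⋀^Fin q]→L[ℝ] ℝ) (β : F [⋀^Fin q']→L[ℝ] ℝ)
    (v : Fin (q + q') → F) : mulForms α β v =
      α (fun i => v (Fin.castAdd q' i)) * β (fun i => v (Fin.natAdd q i)) := by
  rfl

/-- The wedge product, normalised so that `(α ∧ β)(v, w) = α(v) β(w) - α(w) β(v)` for covectors. -/
def wedgeAlt {q q' : ℕ} (α : F [⋀^Fin q]→L[ℝ] ℝ) (β : F [⋀^Fin q']→L[ℝ] ℝ) :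
    F [⋀^Fin (q + q')]→L[ℝ] ℝ :=
  ((q.factorial * q'.factorial : ℕ) : ℝ)⁻¹ •
    ContinuousMultilinearMap.alternatization (mulForms α β)

/-- The wedge product of real forms. -/
def wedgeForm {q q' : ℕ} : DForm I M ℝ q →ₗ[ℝ] DForm I M ℝ q' →ₗ[ℝ] DForm I M ℝ (q + q') :=
  LinearMap.mk₂ ℝ (fun α β x => wedgeAlt (α x) (β x))
    (fun α α' β => by
      ext x v
      simp [wedgeAlt, ContinuousMultilinearMap.alternatization_apply_apply, mulForms_apply,
        add_mul, Finset.sum_add_distrib, mul_add])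
    (fun c α β => by
      ext x v
      simp [wedgeAlt, ContinuousMultilinearMap.alternatization_apply_apply, mulForms_apply,
        Finset.mul_sum, mul_assoc, mul_left_comm, mul_smul_comm])
    (fun α β β' => by
      ext x v
      simp [wedgeAlt, ContinuousMultilinearMap.alternatization_apply_apply, mulForms_apply,
        Finset.sum_add_distrib, mul_add])
    (fun c α β => by
      ext x v
      simp [wedgeAlt, ContinuousMultilinearMap.alternatization_apply_apply, mulForms_apply,
        Finset.mul_sum, mul_assoc, mul_left_comm, mul_smul_comm])

end Forms

/-! ### The Lie group `G`, its Lie algebra and the Weil algebras -/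

section LieGroup

variable (E : Type*) [NormedAddCommGroup E] [NormedSpace ℝ E] [FiniteDimensional ℝ E]
  (G : Type*) [TopologicalSpace G] [ChartedSpace E G] [Group G]

/-- The Lie algebra `𝔤 = T_e G`, with the bracket coming from left-invariant vector fields. -/
abbrev LieAlg : Type _ := GroupLieAlgebra 𝓘(ℝ, E) G

instance : FiniteDimensional ℝ (LieAlg E G) := inferInstanceAs (FiniteDimensional ℝ E)

/-- The dual `𝔤*`. -/
abbrev LieDual : Type _ := Module.Dual ℝ (LieAlg E G)

/-- The symmetric algebra `S 𝔤*`. -/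
abbrev SymDual : Type _ := SymmetricAlgebra ℝ (LieDual E G)

/-- The Weil algebra `W𝔤 = Λ 𝔤* ⊗ S 𝔤*` (as a vector space). -/
abbrev WeilAlg : Type _ := ExteriorAlgebra ℝ (LieDual E G) ⊗[ℝ] SymDual E G

/-- The inclusion `S 𝔤* → W𝔤`, `P ↦ 1 ⊗ P`. -/
def symToWeil : SymDual E G →ₗ[ℝ] WeilAlg E G :=
  TensorProduct.mk ℝ (ExteriorAlgebra ℝ (LieDual E G)) (SymDual E G) 1

/-- The noncommutative Weil algebra: the free algebra on `t(ξ) = (ξ, 0)` (odd) and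
`w(ξ) = d t(ξ) = (0, ξ)` (even), depending linearly on `ξ ∈ 𝔤*`. -/
abbrev NCWeilAlg : Type _ := TensorAlgebra ℝ (LieDual E G × LieDual E G)

variable {E}

/-- The adjoint action `Ad_g` on `𝔤`: the differential at `e` of `h ↦ g h g⁻¹`. -/
def lieAd (g : G) : LieAlg E G →ₗ[ℝ] LieAlg E G :=
  (tangentMapAt 𝓘(ℝ, E) 𝓘(ℝ, E) (fun h : G => g * h * g⁻¹) 1 : E →L[ℝ] E).toLinearMap

/-- The action of `g` on `S 𝔤*` by algebra automorphisms extending `ξ ↦ ξ ∘ Ad_g`. -/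
def coadSym (g : G) : SymDual E G →ₐ[ℝ] SymDual E G :=
  SymmetricAlgebra.lift (SymmetricAlgebra.ι ℝ (LieDual E G) ∘ₗ (lieAd G g).dualMap)

variable (E)

/-- The invariant polynomials `(S 𝔤*)^G`. -/
def invPoly : Submodule ℝ (SymDual E G) where
  carrier := {P | ∀ g : G, coadSym G g P = P}
  add_mem' ha hb g := by rw [map_add, ha g, hb g]
  zero_mem' g := map_zero _
  smul_mem' c _ ha g := by rw [map_smul, ha g]

/-- The letters `t(ξ)` of the noncommutative Weil algebra. -/
def ncT : LieDual E G →ₗ[ℝ] NCWeilAlg E G :=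
  TensorAlgebra.ι ℝ ∘ₗ LinearMap.inl ℝ (LieDual E G) (LieDual E G)

/-- The letters `w(ξ) = d t(ξ)` of the noncommutative Weil algebra. -/
def ncW : LieDual E G →ₗ[ℝ] NCWeilAlg E G :=
  TensorAlgebra.ι ℝ ∘ₗ LinearMap.inr ℝ (LieDual E G) (LieDual E G)

/-- In `W𝔤` the generator `w^a ∈ S 𝔤*` is `d t^a + ½ f^a_{bc} t^b t^c`; this is the lift of that
expression to the noncommutative Weil algebra. It does not depend on the basis `e_b` of `𝔤`. -/
def ncCurv : LieDual E G →ₗ[ℝ] NCWeilAlg E G :=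
  let e := Module.finBasis ℝ (LieAlg E G)
  ncW E G + (1 / 2 : ℝ) • ∑ b, ∑ c,
    (Module.Dual.eval ℝ (LieAlg E G) ⁅e b, e c⁆).smulRight
      (ncT E G (e.coord b) * ncT E G (e.coord c))

theorem symCentral_ncCurv (ξ : LieDual E G) : SuperSym.SymCentral (ncCurv E G ξ) := by
  simp only [ncCurv, LinearMap.add_apply, LinearMap.smul_apply, LinearMap.sum_apply,
    LinearMap.smulRight_apply]
  refine (SuperSym.symCentral_even ξ).add (SuperSym.SymCentral.smul _ ?_)
  exact SuperSym.SymCentral.sum _ fun b _ => SuperSym.SymCentral.sum _ fun c _ =>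
    (SuperSym.symCentral_odd_mul_odd _ _).smul _

/-- The restriction to `S 𝔤* ⊆ W𝔤` of the symmetrisation map from the Weil algebra (the graded
commutative algebra on `t(ξ)` and `d t(ξ)`) to the noncommutative Weil algebra. It sends
`w(ξ₁) ⋯ w(ξ_p)` to the graded symmetrisation of `∏ᵢ (d t(ξᵢ) + ½ ∑ ξᵢ([e_b, e_c]) t^b t^c)`. -/
def weilSym : SymDual E G →ₗ[ℝ] NCWeilAlg E G :=
  SuperSym.descend
    (SuperSym.symOp (LieDual E G) (LieDual E G) ∘ₗ
      (TensorAlgebra.lift ℝ (ncCurv E G)).toLinearMap)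
    (fun a b x y => by
      simpa using symCentral_ncCurv E G y (TensorAlgebra.lift ℝ (ncCurv E G) a)
        (TensorAlgebra.lift ℝ (ncCurv E G) b) (ncCurv E G x))

/-! ### Forms on powers of `G` -/

/-- The model with corners of the manifold `Gⁿ`. -/
abbrev powModel (n : ℕ) : ModelWithCorners ℝ (Fin n → E) (ModelPi fun _ : Fin n => E) :=
  ModelWithCorners.pi fun _ : Fin n => 𝓘(ℝ, E)

/-- Real `q`-forms on the manifold `Gⁿ`. -/
abbrev PowForm (n q : ℕ) : Type _ := DForm (powModel E n) (Fin n → G) ℝ q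

/-- The total space of the double complex `Ω^q(EG_p)`, where `EG_p = G^{p+1}`. -/
abbrev TotEG : Type _ := ⨁ pq : ℕ × ℕ, PowForm E G (pq.1 + 1) pq.2

/-- The total space of the double complex `Ω^q(BG_p)`, where `BG_p = G^p`. -/
abbrev TotBG : Type _ := ⨁ pq : ℕ × ℕ, PowForm E G pq.1 pq.2

variable {E G}

/-- Pullback of forms under a map `Gᵐ → Gⁿ`. -/
def powPullback {m n q : ℕ} (f : (Fin m → G) → (Fin n → G)) :
    PowForm E G n q →ₗ[ℝ] PowForm E G m q :=
  pullbackForm (powModel E m) (powModel E n) f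

variable (E G)

/-- The element of bidegree `(p, q)` of the total space given by a form. -/
def inEG (p q : ℕ) : PowForm E G (p + 1) q →ₗ[ℝ] TotEG E G :=
  DirectSum.lof ℝ (ℕ × ℕ) (fun pq : ℕ × ℕ => PowForm E G (pq.1 + 1) pq.2) (p, q)

/-- The cup product `η ∪ η' = (-1)^{q p'} pr^* η ∧ pr'^* η'` for `η ∈ Ω^q(EG_p)` and
`η' ∈ Ω^{q'}(EG_{p'})`, with `pr (g₀, …, g_{p+p'}) = (g₀, …, g_p)` and
`pr' (g₀, …, g_{p+p'}) = (g_p, …, g_{p+p'})`. -/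
def cupEG (p q p' q' : ℕ) : PowForm E G (p + 1) q →ₗ[ℝ] PowForm E G (p' + 1) q' →ₗ[ℝ]
    PowForm E G (p + p' + 1) (q + q') :=
  ((-1 : ℝ) ^ (q * p')) • (wedgeForm (powModel E (p + p' + 1))).compl₁₂
    (powPullback fun (x : Fin (p + p' + 1) → G) (i : Fin (p + 1)) => x ⟨i, by omega⟩)
    (powPullback fun (x : Fin (p + p' + 1) → G) (i : Fin (p' + 1)) => x ⟨p + i, by omega⟩)

/-- The cup product on the total space, extended bilinearly. -/
def cupTot : TotEG E G →ₗ[ℝ] TotEG E G →ₗ[ℝ] TotEG E G :=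
  DirectSum.toModule ℝ (ℕ × ℕ) _ fun a =>
    (DirectSum.toModule ℝ (ℕ × ℕ) _ fun b =>
      ((cupEG E G a.1 a.2 b.1 b.2).compr₂ (inEG E G (a.1 + b.1) (a.2 + b.2))).flip).flip

/-- The unit of the cup product: the constant function `1` on `EG_0`. -/
def oneEG : TotEG E G :=
  inEG E G 0 0 fun _ => ContinuousAlternatingMap.constOfIsEmpty ℝ (Fin 1 → E) (Fin 0) 1

/-- The simplicial differential `∂ = ∑_i (-1)^i ε̄_i^* : Ω^q(EG_p) → Ω^q(EG_{p+1})`, where `ε̄_i`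
omits the `i`-th entry. -/
def simpD (p q : ℕ) : PowForm E G (p + 1) q →ₗ[ℝ] PowForm E G (p + 2) q :=
  ∑ i : Fin (p + 2), ((-1 : ℝ) ^ (i : ℕ)) •
    powPullback fun (x : Fin (p + 2) → G) (j : Fin (p + 1)) => x (i.succAbove j)

/-- The left-invariant Maurer-Cartan form, a one-form on `G` with values in `𝔤 = E`:
at `g` it is the differential of left translation by `g⁻¹`. -/
def maurerCartan : DForm 𝓘(ℝ, E) G E 1 := fun g =>
  ContinuousAlternatingMap.ofSubsingleton ℝ E E (0 : Fin 1)
    (tangentMapAt 𝓘(ℝ, E) 𝓘(ℝ, E) (fun h : G => g⁻¹ * h) g)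

/-- For `ξ ∈ 𝔤*` and a `𝔤`-valued form `Θ` on `G`, the real form `ξ ∘ Θ` on `EG_0 = G`. -/
def pairForm {q : ℕ} (Θ : DForm 𝓘(ℝ, E) G E q) : LieDual E G →ₗ[ℝ] PowForm E G 1 q where
  toFun ξ := pullbackForm (powModel E 1) 𝓘(ℝ, E) (fun x : Fin 1 → G => x 0)
    (fun g => (LinearMap.toContinuousLinearMap (show E →ₗ[ℝ] ℝ from ξ)).compContinuousAlternatingMap (Θ g))
  map_add' _ _ := by ext; rfl
  map_smul' _ _ := by ext; rfl

/-- The connection `θ : 𝔤* → Ω¹(EG_0)` given by the Maurer-Cartan form. -/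
def thetaEG : LieDual E G →ₗ[ℝ] PowForm E G 1 1 := pairForm E G (maurerCartan E G)

/-- `ξ ↦ d(θ(ξ)) = ξ ∘ dθ`, in `Ω²(EG_0)`. -/
def dThetaEG : LieDual E G →ₗ[ℝ] PowForm E G 1 2 :=
  pairForm E G (extD 𝓘(ℝ, E) (maurerCartan E G))

/-- The characteristic homomorphism on generators: `t(ξ) ↦ θ(ξ)` and `w(ξ) = d t(ξ)` goes to the
total differential `∂ θ(ξ) + d θ(ξ)` of `θ(ξ)`. -/
def charGen : (LieDual E G × LieDual E G) →ₗ[ℝ] TotEG E G :=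
  (inEG E G 0 1 ∘ₗ thetaEG E G).coprod
    (inEG E G 1 1 ∘ₗ simpD E G 0 1 ∘ₗ thetaEG E G + inEG E G 0 2 ∘ₗ dThetaEG E G)

/-- The characteristic homomorphism on words: `v₁ ⋯ vₙ` goes to the cup product of the images of
the letters. -/
def charWord : (n : ℕ) →
    MultilinearMap ℝ (fun _ : Fin n => LieDual E G × LieDual E G) (TotEG E G)
  | 0 => MultilinearMap.constOfIsEmpty ℝ _ (oneEG E G)
  | n + 1 => LinearMap.uncurryLeft
      { toFun := fun v => (cupTot E G (charGen E G v)).compMultilinearMap (charWord n)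
        map_add' := fun _ _ => by ext; simp
        map_smul' := fun _ _ => by ext; simp }

/-- The characteristic homomorphism from the noncommutative Weil algebra to `Ω(EG)`. -/
def charHom : NCWeilAlg E G →ₗ[ℝ] TotEG E G :=
  (DirectSum.toModule ℝ ℕ (TotEG E G) fun n => PiTensorProduct.lift (charWord E G n)) ∘ₗ
    (TensorAlgebra.toDirectSum (R := ℝ) (M := LieDual E G × LieDual E G)).toLinearMap

/-- The pullback `ι^* : Ω(EG) → Ω(BG)` under
`ι (g₁, …, g_p) = (e, g₁⁻¹, (g₁ g₂)⁻¹, …, (g₁ ⋯ g_p)⁻¹)`. -/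
def sectionPullback : TotEG E G →ₗ[ℝ] TotBG E G :=
  DirectSum.toModule ℝ (ℕ × ℕ) _ fun pq =>
    DirectSum.lof ℝ (ℕ × ℕ) (fun pq : ℕ × ℕ => PowForm E G pq.1 pq.2) pq ∘ₗ
      powPullback fun (x : Fin pq.1 → G) (j : Fin (pq.1 + 1)) => (Fin.partialProd x j)⁻¹

/-- The Alekseev-Meinrenken map: symmetrisation, followed by the characteristic homomorphism of the
Maurer-Cartan connection, followed by `ι^*`. -/
def alekseevMeinrenken : SymDual E G →ₗ[ℝ] TotBG E G :=
  sectionPullback E G ∘ₗ charHom E G ∘ₗ weilSym E G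

variable {G}

/-- The action `ζ(g₀, …, g_p)` of `G^{p+1}` on `BG_p`:
`(x₁, …, x_p) ↦ (g₀ x₁ g₁⁻¹, g₁ x₂ g₂⁻¹, …, g_{p-1} x_p g_p⁻¹)`. -/
def zetaAct {p : ℕ} (g : Fin (p + 1) → G) (x : Fin p → G) : Fin p → G :=
  fun j => g j.castSucc * x j * (g j.succ)⁻¹

/-- The action `γ_i(g)` of `G` on `BG_p` through the `i`-th factor of `G^{p+1}`, `0 ≤ i ≤ p`:
for `1 ≤ i ≤ p` it sends `(x₁, …, x_p)` to `(x₁, …, x_i g⁻¹, g x_{i+1}, …, x_p)`. -/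
def gammaAct {p : ℕ} (i : Fin (p + 1)) (g : G) : (Fin p → G) → (Fin p → G) :=
  zetaAct (Pi.mulSingle i g)

variable (G)

/-- The smooth forms on `BG_p` that are invariant under `G^{p+1}`. -/
def IsInvForm {p q : ℕ} (η : PowForm E G p q) : Prop :=
  IsSmoothForm (powModel E p) η ∧ ∀ g : Fin (p + 1) → G, powPullback (zetaAct g) η = η

/-- Membership in `Ω(BG)^{G_{•+1}}`: all components are smooth and invariant. -/
def IsInvTot (α : TotBG E G) : Prop := ∀ pq : ℕ × ℕ, IsInvForm E G (α pq)

variable {G}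

/-- The value at the point `m` of the vector field `x^{i,♯}` on `BG_p` generated by `γ_i`. -/
def genField {p : ℕ} (i : Fin (p + 1)) (x : LieAlg E G) (m : Fin p → G) : Fin p → E :=
  tangentMapAt 𝓘(ℝ, E) (powModel E p) (fun g : G => gammaAct i g m) 1 x

/-- The Lie derivative along `x^{i,♯}`: the derivative at `g = e` in the direction `x ∈ T_e G` of
`g ↦ γ_i(g)^* η`. -/
def lieD {p q : ℕ} (i : Fin (p + 1)) (x : LieAlg E G) (η : PowForm E G p q) : PowForm E G p q :=
  fun m => tangentMapAt 𝓘(ℝ, E) 𝓘(ℝ, (Fin p → E) [⋀^Fin q]→L[ℝ] ℝ)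
    (fun g : G => powPullback (gammaAct i g) η m) 1 x

/-! ### The Van Est map -/

/-- The sign of the inversions of `σ` among the last `r` places. -/
def vanEstSign {q r : ℕ} (σ : Equiv.Perm (Fin (q + r))) : ℝ :=
  ∏ ij ∈ Finset.univ.filter (fun ij : Fin r × Fin r => ij.1 < ij.2),
    if σ (Fin.natAdd q ij.2) < σ (Fin.natAdd q ij.1) then -1 else 1

/-- For `η ∈ Ω^q(BG_p)` with `p = q + r`, the number
`∑_σ ε(σ) (i_{X₁} ⋯ i_{X_q} L_{X_{q+1}} ⋯ L_{X_p} η)(e, …, e)` with `X_j = x_{σ(j)}^{j,♯}`.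
Contracting with `X_q` first and `X_1` last is evaluation on `(X_q, …, X_1)`. -/
def vanEstSum {q r : ℕ} (η : PowForm E G (q + r) q) (x : Fin (q + r) → LieAlg E G) : ℝ :=
  ∑ σ : Equiv.Perm (Fin (q + r)), vanEstSign σ *
    ((List.finRange r).foldr
        (fun j ψ => lieD E (Fin.natAdd q j).succ (x (σ (Fin.natAdd q j))) ψ) η) 1
      (fun k : Fin q =>
        genField E (Fin.castAdd r k.rev).succ (x (σ (Fin.castAdd r k.rev))) 1)

/-- The contraction of the symmetric factor of `W𝔤` with `x`: the derivation of `S 𝔤*` with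
`ξ ↦ ξ(x)`, obtained from the algebra map `ξ ↦ ξ + ξ(x) ε` to the dual numbers over `S 𝔤*`. -/
def iSym (x : LieAlg E G) : WeilAlg E G →ₗ[ℝ] WeilAlg E G :=
  TensorProduct.map LinearMap.id
    ((TrivSqZeroExt.sndHom (SymDual E G) (SymDual E G)).restrictScalars ℝ ∘ₗ
      (SymmetricAlgebra.lift (A := DualNumber (SymDual E G))
        (TrivSqZeroExt.inlAlgHom ℝ (SymDual E G) (SymDual E G) ∘ₗ
            SymmetricAlgebra.ι ℝ (LieDual E G) +
          (Module.Dual.eval ℝ (LieAlg E G) x).smulRight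
            (TrivSqZeroExt.inr (1 : SymDual E G)))).toLinearMap)

/-- The contraction of the exterior factor of `W𝔤` with `x`. -/
def iExt (x : LieAlg E G) : WeilAlg E G →ₗ[ℝ] WeilAlg E G :=
  TensorProduct.map
    (CliffordAlgebra.contractLeft (Q := (0 : QuadraticForm ℝ (LieDual E G)))
      (Module.Dual.eval ℝ (LieAlg E G) x)) LinearMap.id

/-- The component in `ℝ = Λ⁰ 𝔤* ⊗ S⁰ 𝔤*` of an element of `W𝔤`. -/
def weilScalar : WeilAlg E G →ₗ[ℝ] ℝ :=
  LinearMap.mul' ℝ ℝ ∘ₗ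
    TensorProduct.map (ExteriorAlgebra.algebraMapInv (R := ℝ) (M := LieDual E G)).toLinearMap
      (SymmetricAlgebra.algebraMapInv (R := ℝ) (M := LieDual E G)).toLinearMap

/-- `ξ(x₁, …, x_q, x̄_{q+1}, …, x̄_p) = i_Λ(x_p) ⋯ i_Λ(x_{q+1}) i_S(x_q) ⋯ i_S(x₁) ξ`, for `p = q + r`;
only the component of `ξ` in `W^{p,q}𝔤 = Λ^{p-q} 𝔤* ⊗ S^q 𝔤*` contributes. -/
def weilEval {q r : ℕ} (ξ : WeilAlg E G) (x : Fin (q + r) → LieAlg E G) : ℝ :=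
  weilScalar E
    ((List.finRange r).foldl (fun ζ j => iExt E (x (Fin.natAdd q j)) ζ)
      ((List.finRange q).foldl (fun ζ k => iSym E (x (Fin.castAdd r k)) ζ) ξ))

/-- `ξ ∈ W𝔤` is the image of `α ∈ Ω(BG)` under the Van Est map: for all `q ≤ p = q + r`, the
component of `ξ` in `W^{p,q}𝔤` is given by the Van Est formula applied to the component of `α` in
`Ω^q(BG_p)`. (As `W^{p,q}𝔤 = 0` for `q > p`, the other components of `α` go to zero.) -/
def IsVanEst (α : TotBG E G) (ξ : WeilAlg E G) : Prop :=
  ∀ (q r : ℕ) (x : Fin (q + r) → LieAlg E G), weilEval E ξ x = vanEstSum E (α (q + r, q)) x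

open Classical in
/-- The Van Est map: the unique element of `W𝔤` determined by the Van Est formula. -/
def vanEst (α : TotBG E G) : WeilAlg E G :=
  if h : ∃! ξ, IsVanEst E α ξ then h.choose else 0

end LieGroup

end

/-! The proof has three independent parts.

*Invariance.* The forms `θ(ξ)`, `∂θ(ξ)` and `dθ(ξ)` on powers of `G` are invariant under left
translation, and right translation by the diagonal acts on them through the coadjoint action, so the
same holds for their cup products (`charHom_mem_leftInvTot`, `rightTranslate_charHom`).
Symmetrisation is natural, and the curvature elements of the noncommutative Weil algebra are natural
because `Ad_g` preserves the bracket (`symOp_letterMap`, `ncCoad_ncCurv`). Hence the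
characteristic homomorphism sends the symmetrisation of an invariant polynomial to a form on `EG_p`
that is invariant under all left and all diagonal right translations. The map `ι` turns this into
invariance under the action `ζ` of `G^{p+1}` on `BG_p` (`powPullback_zetaAct_section`). This action
is transitive, and smooth in the group element, so invariant forms are smooth
(`isSmoothForm_of_zetaAct_invariant`).

*The Van Est map on invariant forms.* An element of the Weil algebra is determined by its iterated
contractions, by an argument with the Euler operator (`eq_zero_of_iterContr`, `weilAlg_eq_zero`), so
there is at most one solution of the Van Est equations. Lie derivatives of an invariant form vanish,
so only the bidegrees `(q, q)` contribute; there the Van Est formula symmetrises the multilinear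
form `vanEstMulti`, and `polyOfMulti` provides a polynomial with the required iterated derivatives
(`exists_isVanEst`). Invariance under the diagonal action `ζ(h, …, h)`, which fixes the unit of
`BG_q` and maps `x^{i,♯}` to `(Ad_h x)^{i,♯}` there, makes this polynomial invariant.

*The composite.* The letters `t(ξ)` and `w(ξ)` go to elements of bidegrees `(0, 1)`, and `(1, 1)`
and `(0, 2)`. So `AM(P)` has no components of bidegree `(p, q)` with `p > q`, and its components in
bidegrees `(q, q)` only involve the words in the even letters `w(ξ)`, with `w(ξ)` replaced by
`∂θ(ξ)` (`charHom_sub_letterMap_mem`, `exists_charWord_eq`). Under `ι` the vector `x^{i,♯}` at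
the unit becomes the vector with `i`-th entry `x` and all other entries zero
(`tangentMapAt_sectionMap_genField`). On the vectors `x_n^{n,♯}, …, x_1^{1,♯}` the cup product
`∂θ(ξ₁) ∪ ⋯ ∪ ∂θ(ξ_n)` therefore telescopes to `∏ ξᵢ(xᵢ)`: the sign of the cup product cancels
against the reversal of the order of the arguments (`cupEG_simpD_thetaEG_apply`). Summation over all
permutations gives the permanent that is the iterated derivative of `ξ₁ ⋯ ξ_n`
(`symEval_ofFn_prod`). This holds for all polynomials, invariant or not. -/

noncomputable section

set_option linter.unusedSectionVars false

/-! ### Powers of a manifold -/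

section PowerManifold

variable {E : Type*} [NormedAddCommGroup E] [NormedSpace ℝ E]
  {G : Type*} [TopologicalSpace G] [ChartedSpace E G]
  {F : Type*} [NormedAddCommGroup F] [NormedSpace ℝ F] {H : Type*} [TopologicalSpace H]
  {I : ModelWithCorners ℝ F H} {M : Type*} [TopologicalSpace M] [ChartedSpace H M]

instance powModel_boundaryless (n : ℕ) : (powModel E n).Boundaryless where
  range_eq_univ := Set.range_eq_univ.2 fun y => ⟨y, rfl⟩

theorem mem_extChartAt_pow_target {n : ℕ} {x : Fin n → G} {y : Fin n → E} :
    y ∈ (extChartAt (powModel E n) x).target ↔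
      ∀ i, y i ∈ (extChartAt 𝓘(ℝ, E) (x i)).target := by
  simp only [extChartAt, OpenPartialHomeomorph.extend_target, piChartedSpace_chartAt]
  constructor
  · intro h i
    have := h.1
    simp only [Set.mem_preimage, OpenPartialHomeomorph.pi, PartialEquiv.pi] at this
    refine ⟨this i trivial, by simp⟩
  · intro h
    refine ⟨?_, by simp [(powModel E n).range_eq_univ]⟩
    simp only [Set.mem_preimage, OpenPartialHomeomorph.pi, PartialEquiv.pi]
    exact fun i _ => (h i).1

instance powManifold (n : ℕ) (k : ℕ∞ω) [IsManifold 𝓘(ℝ, E) k G] :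
    IsManifold (powModel E n) k (Fin n → G) := by
  refine isManifold_of_contDiffOn _ _ _ ?_
  rintro _ _ ⟨e, he, rfl⟩ ⟨e', he', rfl⟩
  refine contDiffOn_pi.2 fun i => ?_
  have h := ((contDiffGroupoid k 𝓘(ℝ, E)).compatible (he i trivial) (he' i trivial)).1
  have h' : ContDiffOn ℝ k ((e i).symm ≫ₕ e' i) ((e i).symm ≫ₕ e' i).source := by
    simpa [contDiffPregroupoid] using h
  refine h'.comp (f := fun y : Fin n → E => y i) (contDiff_apply ℝ E i).contDiffOn ?_
  rintro y ⟨hy, -⟩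
  simp only [Set.mem_preimage, OpenPartialHomeomorph.trans_source, Set.mem_inter_iff] at hy ⊢
  exact ⟨hy.1 i trivial, hy.2 i trivial⟩

theorem contMDiff_pow_iff {n : ℕ} {k : ℕ∞ω} {f : M → Fin n → G} :
    ContMDiff I (powModel E n) k f ↔ ∀ i, ContMDiff I 𝓘(ℝ, E) k fun x => f x i := by
  have key : ∀ x, ContMDiffAt I (powModel E n) k f x ↔
      ∀ i, ContMDiffAt I 𝓘(ℝ, E) k (fun x => f x i) x := by
    intro x
    simp only [contMDiffAt_iff, continuousAt_pi, forall_and]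
    refine and_congr Iff.rfl ?_
    exact contDiffWithinAt_pi
  exact ⟨fun h i x => (key x).1 (h x) i, fun h x => (key x).2 fun i => h i x⟩

theorem contMDiff_proj {n : ℕ} {k : ℕ∞ω} (i : Fin n) :
    ContMDiff (powModel E n) 𝓘(ℝ, E) k fun x : Fin n → G => x i := by
  intro x
  rw [contMDiffAt_iff]
  refine ⟨(continuous_apply i).continuousAt, ?_⟩
  have h : ContDiffWithinAt ℝ k (fun y : Fin n → E => y i) (Set.range (powModel E n))
    (extChartAt (powModel E n) x x) := (contDiff_apply ℝ E i).contDiffWithinAt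
  refine h.congr_of_eventuallyEq ?_ ?_
  · have := extChartAt_target_mem_nhdsWithin (I := powModel E n) x
    filter_upwards [this] with y hy
    have hy' : y i ∈ (extChartAt 𝓘(ℝ, E) (x i)).target :=
      mem_extChartAt_pow_target.1 hy i
    exact (extChartAt 𝓘(ℝ, E) (x i)).right_inv hy'
  · have hx := mem_extChartAt_target (I := powModel E n) x
    exact (extChartAt 𝓘(ℝ, E) (x i)).right_inv (mem_extChartAt_pow_target.1 hx i)

end PowerManifold

/-! ### Differentials, pullbacks and smooth forms -/

section TangentMap

variable {F : Type*} [NormedAddCommGroup F] [NormedSpace ℝ F] {H : Type*} [TopologicalSpace H]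
  {I : ModelWithCorners ℝ F H} {M : Type*} [TopologicalSpace M] [ChartedSpace H M]
  {F' : Type*} [NormedAddCommGroup F'] [NormedSpace ℝ F'] {H' : Type*} [TopologicalSpace H']
  {I' : ModelWithCorners ℝ F' H'} {M' : Type*} [TopologicalSpace M'] [ChartedSpace H' M']
  {F'' : Type*} [NormedAddCommGroup F''] [NormedSpace ℝ F''] {H'' : Type*} [TopologicalSpace H'']
  {I'' : ModelWithCorners ℝ F'' H''} {M'' : Type*} [TopologicalSpace M''] [ChartedSpace H'' M'']
  {N : Type*} [NormedAddCommGroup N] [NormedSpace ℝ N]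

theorem tangentMapAt_comp {g : M' → M''} {f : M → M'} (x : M)
    (hg : MDifferentiableAt I' I'' g (f x)) (hf : MDifferentiableAt I I' f x) :
    tangentMapAt I I'' (fun y => g (f y)) x =
      (tangentMapAt I' I'' g (f x)).comp (tangentMapAt I I' f x) :=
  mfderiv_comp x hg hf

theorem tangentMapAt_comp_apply {g : M' → M''} {f : M → M'} (x : M)
    (hg : MDifferentiableAt I' I'' g (f x)) (hf : MDifferentiableAt I I' f x) (v : F) :
    tangentMapAt I I'' (fun y => g (f y)) x v =
      tangentMapAt I' I'' g (f x) (tangentMapAt I I' f x v) := by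
  rw [tangentMapAt_comp x hg hf]; rfl

theorem tangentMapAt_id (x : M) :
    tangentMapAt I I (fun y : M => y) x = ContinuousLinearMap.id ℝ F := mfderiv_id

theorem tangentMapAt_const (x : M) (c : M') : tangentMapAt I I' (fun _ : M => c) x = 0 :=
  mfderiv_const

theorem pullbackForm_pullbackForm {q : ℕ} {g : M' → M''} {f : M → M'}
    (hg : MDifferentiable I' I'' g) (hf : MDifferentiable I I' f) (η : DForm I'' M'' N q) :
    pullbackForm I I' f (pullbackForm I' I'' g η) = pullbackForm I I'' (fun x => g (f x)) η := by
  ext x v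
  simp only [pullbackForm, LinearMap.coe_mk, AddHom.coe_mk,
    ContinuousAlternatingMap.compContinuousLinearMap_apply]
  rw [tangentMapAt_comp x (hg _) (hf _)]
  rfl

/-- Pullback of a fixed alternating form is smooth in the linear map: it is the diagonal
restriction of a continuous multilinear map, followed by antisymmetrisation. -/
theorem contDiff_compContinuousLinearMap {q : ℕ} {k : ℕ∞ω} (α : F' [⋀^Fin q]→L[ℝ] N) :
    ContDiff ℝ k fun A : F →L[ℝ] F' => α.compContinuousLinearMap A := by
  let A : ContinuousMultilinearMap ℝ (fun _ : Fin q => F) N →L[ℝ]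
      ContinuousMultilinearMap ℝ (fun _ : Fin q => F) N :=
    (q.factorial : ℝ)⁻¹ • ∑ σ : Equiv.Perm (Fin q), ((Equiv.Perm.sign σ : ℤ) : ℝ) •
      (ContinuousMultilinearMap.domDomCongrₗᵢ ℝ F N σ :
        ContinuousMultilinearMap ℝ (fun _ : Fin q => F) N →L[ℝ]
          ContinuousMultilinearMap ℝ (fun _ : Fin q => F) N)
  have hA : ∀ (m : ContinuousMultilinearMap ℝ (fun _ : Fin q => F) N) (v : Fin q → F),
      A m v = (q.factorial : ℝ)⁻¹ • ContinuousMultilinearMap.alternatization m v := by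
    intro m v
    simp only [A, ContinuousMultilinearMap.alternatization_apply_apply, Units.smul_def]
    simp [← Int.cast_smul_eq_zsmul ℝ]
    rfl
  let B : ContinuousMultilinearMap ℝ (fun _ : Fin q => F) N →L[ℝ] F [⋀^Fin q]→L[ℝ] N :=
    ContinuousAlternatingMap.liftCLM A fun m v i j h hij => by
      rw [hA, (ContinuousMultilinearMap.alternatization m).map_eq_zero_of_eq v h hij, smul_zero]
  have h : (fun A : F →L[ℝ] F' => α.compContinuousLinearMap A) = fun A =>
      B (ContinuousMultilinearMap.compContinuousLinearMapLRight α.toContinuousMultilinearMap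
        fun _ => A) := by
    ext L v
    change _ = A _ v
    rw [hA, ContinuousMultilinearMap.alternatization_apply_apply]
    have : ∀ σ : Equiv.Perm (Fin q), Equiv.Perm.sign σ •
        (ContinuousMultilinearMap.compContinuousLinearMapLRight α.toContinuousMultilinearMap
          fun _ => L) (v ∘ σ) = α fun i => L (v i) := by
      intro σ
      have := α.toAlternatingMap.map_perm (fun i => L (v i)) σ
      change Equiv.Perm.sign σ • α (fun i => L (v (σ i))) = _
      change α (fun i => L (v (σ i))) = _ at this
      rw [this, smul_smul]
      simp
    rw [Finset.sum_congr rfl fun σ _ => this σ]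
    simp [Fintype.card_perm, ← Nat.cast_smul_eq_nsmul ℝ, smul_smul, Nat.factorial_ne_zero]
    rfl
  rw [h]
  exact B.contDiff.comp ((ContinuousMultilinearMap.contDiff _).comp
    (contDiff_pi.2 fun _ => contDiff_id))

/-- A form that is obtained from a single alternating form `α` by transport along a smooth family
of maps `Φ m`, each of which sends `m` to a fixed point `o`, is smooth. -/
theorem isSmoothForm_of_transport [I.Boundaryless] [I'.Boundaryless] [IsManifold I ∞ M]
    [IsManifold I' ∞ M'] {q : ℕ}
    {η : DForm I M N q} {o : M'} {α : F' [⋀^Fin q]→L[ℝ] N} {Φ : M → M → M'}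
    (hΦ : ContMDiff (I.prod I) I' ∞ (Function.uncurry Φ)) (ho : ∀ m, Φ m m = o)
    (hη : ∀ m, η m = α.compContinuousLinearMap (tangentMapAt I I' (Φ m) m)) :
    IsSmoothForm I η := by
  intro m₀ y₀ hy₀
  refine ContDiffAt.contDiffWithinAt ?_
  set φ := extChartAt I m₀
  set Ψ : F → F → F' := fun y z => extChartAt I' o (Φ (φ.symm y) (φ.symm z)) with hΨ
  have htgt : ∀ y ∈ φ.target, φ.target ∈ nhds y := fun y hy => extChartAt_target_mem_nhds' hy
  have hsymm : ∀ y ∈ φ.target, ContMDiffAt 𝓘(ℝ, F) I ∞ φ.symm y := fun y hy =>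
    (contMDiffOn_extChartAt_symm m₀).contMDiffAt (htgt y hy)
  have hΨs : ContDiffAt ℝ ∞ (Function.uncurry Ψ) (y₀, y₀) := by
    rw [← contMDiffAt_iff_contDiffAt]
    have h1 : ContMDiffAt 𝓘(ℝ, F × F) (I.prod I) ∞
        (fun p : F × F => (φ.symm p.1, φ.symm p.2)) (y₀, y₀) :=
      (ContMDiffAt.comp (y₀, y₀) (hsymm y₀ hy₀) contDiffAt_fst.contMDiffAt).prodMk
        (ContMDiffAt.comp (y₀, y₀) (hsymm y₀ hy₀) contDiffAt_snd.contMDiffAt)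
    have h2 : ContMDiffAt I' 𝓘(ℝ, F') ∞ (extChartAt I' o) (Φ (φ.symm y₀) (φ.symm y₀)) := by
      rw [ho]; exact contMDiffAt_extChartAt
    exact ContMDiffAt.comp (y₀, y₀) (g := extChartAt I' o) (I' := I') h2
      (ContMDiffAt.comp (y₀, y₀) (g := Function.uncurry Φ) (I' := I.prod I) hΦ.contMDiffAt h1)
  have hd : ContDiffAt ℝ ∞ (fun y => fderiv ℝ (Ψ y) y) y₀ :=
    ContDiffAt.fderiv (n := ∞) hΨs contDiffAt_id (by simp)
  refine ((contDiff_compContinuousLinearMap α).contDiffAt.comp y₀ hd).congr_of_eventuallyEq ?_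
  filter_upwards [htgt y₀ hy₀] with y hy
  have hs : MDifferentiableAt 𝓘(ℝ, F) I φ.symm y := (hsymm y hy).mdifferentiableAt (by simp)
  have hΦy : MDifferentiableAt I I' (Φ (φ.symm y)) (φ.symm y) := by
    have : ContMDiff I I' ∞ (Φ (φ.symm y)) :=
      hΦ.comp (contMDiff_const.prodMk contMDiff_id)
    exact this.contMDiffAt.mdifferentiableAt (by simp)
  have h2 : MDifferentiableAt I' 𝓘(ℝ, F') (extChartAt I' o) (Φ (φ.symm y) (φ.symm y)) := by
    rw [ho]; exact contMDiffAt_extChartAt.mdifferentiableAt (n := ∞) (by simp)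
  have e1 : fderiv ℝ (Ψ y) y = tangentMapAt 𝓘(ℝ, F) 𝓘(ℝ, F') (Ψ y) y := mfderiv_eq_fderiv.symm
  have e2 : tangentMapAt I' 𝓘(ℝ, F') (extChartAt I' o) (Φ (φ.symm y) (φ.symm y)) =
      ContinuousLinearMap.id ℝ F' := by
    rw [ho]; exact mfderiv_extChartAt_self
  simp only [chartForm, Function.comp_apply, e1]
  rw [tangentMapAt_comp (I' := I') y (f := fun z => Φ (φ.symm y) (φ.symm z)) h2
    (hΦy.comp y hs), e2, tangentMapAt_comp (I' := I) y hΦy hs, hη]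
  rfl

end TangentMap

/-! ### Naturality of the exterior derivative -/

section ExteriorDerivative

variable {F : Type*} [NormedAddCommGroup F] [NormedSpace ℝ F] {H : Type*} [TopologicalSpace H]
  {I : ModelWithCorners ℝ F H} {M : Type*} [TopologicalSpace M] [ChartedSpace H M]
  {F' : Type*} [NormedAddCommGroup F'] [NormedSpace ℝ F'] {H' : Type*} [TopologicalSpace H']
  {I' : ModelWithCorners ℝ F' H'} {M' : Type*} [TopologicalSpace M'] [ChartedSpace H' M']
  {N : Type*} [NormedAddCommGroup N] [NormedSpace ℝ N]
  {N' : Type*} [NormedAddCommGroup N'] [NormedSpace ℝ N']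

theorem IsSmoothForm.differentiableAt_chartForm [I.Boundaryless] {q : ℕ} {η : DForm I M N q}
    (hη : IsSmoothForm I η) (m : M) :
    DifferentiableAt ℝ (chartForm I η m) (extChartAt I m m) :=
  ((hη m).contDiffAt (extChartAt_target_mem_nhds m)).differentiableAt (by simp)

/-- The exterior derivative is natural under smooth maps. -/
theorem extD_pullbackForm [I.Boundaryless] [I'.Boundaryless] [IsManifold I ∞ M]
    [IsManifold I' ∞ M'] {q : ℕ} {f : M → M'} (hf : ContMDiff I I' ∞ f)
    {η : DForm I' M' N q} (hη : IsSmoothForm I' η) :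
    extD I (pullbackForm I I' f η) = pullbackForm I I' f (extD I' η) := by
  funext m
  set φ := extChartAt I m
  set ψ := extChartAt I' (f m)
  set h : F → F' := fun y => ψ (f (φ.symm y)) with hh
  have hφm : φ.symm (φ m) = m := extChartAt_to_inv m
  have hsymm : ∀ y ∈ φ.target, ContMDiffAt 𝓘(ℝ, F) I ∞ φ.symm y := fun y hy =>
    (contMDiffOn_extChartAt_symm m).contMDiffAt (extChartAt_target_mem_nhds' hy)
  have hψ : ∀ x ∈ ψ.source, MDifferentiableAt I' 𝓘(ℝ, F') ψ x := fun x hx =>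
    mdifferentiableAt_extChartAt (by simpa [ψ] using hx)
  have hψs : ∀ y ∈ ψ.target, MDifferentiableAt 𝓘(ℝ, F') I' ψ.symm y := fun y hy =>
    ((contMDiffOn_extChartAt_symm (n := ∞) (f m)).contMDiffAt
      (extChartAt_target_mem_nhds' hy)).mdifferentiableAt (by simp)
  have hfm : MDifferentiable I I' f := hf.mdifferentiable (by simp)
  have hhs : ContDiffAt ℝ ∞ h (φ m) := by
    rw [← contMDiffAt_iff_contDiffAt]
    refine ContMDiffAt.comp (I' := I') (φ m) ?_
      (ContMDiffAt.comp (I' := I) (φ m) hf.contMDiffAt (hsymm _ (mem_extChartAt_target m)))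
    simp only [hφm]
    exact contMDiffAt_extChartAt
  -- a neighbourhood on which all the charts in question are defined
  have hnear : ∀ᶠ y in nhds (φ m), y ∈ φ.target ∧ f (φ.symm y) ∈ ψ.source := by
    refine Filter.Eventually.and (extChartAt_target_mem_nhds m) ?_
    have hc : ContinuousAt (fun y => f (φ.symm y)) (φ m) :=
      hf.continuous.continuousAt.comp (hsymm _ (mem_extChartAt_target m)).continuousAt
    refine hc.eventually_mem ?_
    simp only [hφm]
    exact extChartAt_source_mem_nhds (f m)
  have hfd : ∀ y, fderiv ℝ h y = tangentMapAt 𝓘(ℝ, F) 𝓘(ℝ, F') h y := fun y =>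
    mfderiv_eq_fderiv.symm
  have hchart : chartForm I (pullbackForm I I' f η) m =ᶠ[nhds (φ m)] fun y =>
      (chartForm I' η (f m) (h y)).compContinuousLinearMap (fderiv ℝ h y) := by
    filter_upwards [hnear.eventually_nhds] with y hy'
    have hy := hy'.self_of_nhds
    have hs : MDifferentiableAt 𝓘(ℝ, F) I φ.symm y := (hsymm y hy.1).mdifferentiableAt (by simp)
    have hinv : ψ.symm (h y) = f (φ.symm y) := ψ.left_inv hy.2
    have hhy : MDifferentiableAt 𝓘(ℝ, F) 𝓘(ℝ, F') h y :=
      MDifferentiableAt.comp (I' := I') y (hψ _ hy.2) ((hfm _).comp y hs)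
    have e : tangentMapAt 𝓘(ℝ, F) I' (fun z => ψ.symm (h z)) y =
        tangentMapAt 𝓘(ℝ, F) I' (fun z => f (φ.symm z)) y := by
      refine Filter.EventuallyEq.mfderiv_eq ?_
      filter_upwards [hy'] with z hz using ψ.left_inv hz.2
    rw [tangentMapAt_comp y (hψs _ (ψ.map_source hy.2)) hhy, tangentMapAt_comp y (hfm _) hs] at e
    ext v
    have e' := fun w => DFunLike.congr_fun e w
    simp only [ContinuousLinearMap.comp_apply] at e'
    simp only [chartForm, pullbackForm, LinearMap.coe_mk, AddHom.coe_mk, hfd,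
      ContinuousAlternatingMap.compContinuousLinearMap_apply, Function.comp_def]
    change η (f (φ.symm y)) (fun i => tangentMapAt I I' f (φ.symm y)
      (tangentMapAt 𝓘(ℝ, F) I φ.symm y (v i))) = η (ψ.symm (h y)) (fun i =>
        tangentMapAt 𝓘(ℝ, F') I' ψ.symm (h y) (tangentMapAt 𝓘(ℝ, F) 𝓘(ℝ, F') h y (v i)))
    simp only [hinv, ← e']
  have hpt : h (φ m) = ψ (f m) := by simp only [hh, hφm]
  have hd : DifferentiableAt ℝ (chartForm I' η (f m)) (h (φ m)) := by
    rw [hpt]; exact hη.differentiableAt_chartForm (f m)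
  have hext := extDeriv_pullback hd hhs
    (by simpa using WithTop.coe_le_coe.2 (le_top : (2 : ℕ∞) ≤ ⊤))
  rw [← hchart.extDeriv_eq] at hext
  have hφd : MDifferentiableAt I 𝓘(ℝ, F) φ m :=
    mdifferentiableAt_extChartAt (mem_chart_source H m)
  have e : (fderiv ℝ h (φ m)).comp (tangentMapAt I 𝓘(ℝ, F) φ m) =
      (tangentMapAt I' 𝓘(ℝ, F') ψ (f m)).comp (tangentMapAt I I' f m) := by
    rw [hfd, ← tangentMapAt_comp (g := h) m
      (hhs.contMDiffAt.mdifferentiableAt (by simp)) hφd, ← tangentMapAt_comp m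
      (hψ _ (mem_extChartAt_source (f m))) (hfm m)]
    refine Filter.EventuallyEq.mfderiv_eq ?_
    filter_upwards [extChartAt_source_mem_nhds (I := I) m] with z hz
    simp only [hh]
    rw [φ.left_inv hz]
  have e' := fun w => DFunLike.congr_fun e w
  simp only [ContinuousLinearMap.comp_apply] at e'
  ext v
  simp only [extD, pullbackForm, LinearMap.coe_mk, AddHom.coe_mk,
    ContinuousAlternatingMap.compContinuousLinearMap_apply, Function.comp_def]
  change extDeriv (chartForm I (pullbackForm I I' f η) m) (φ m) _ = _
  rw [hext, ContinuousAlternatingMap.compContinuousLinearMap_apply, hpt]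
  simp only [Function.comp_def]
  change extDeriv (chartForm I' η (f m)) (ψ (f m)) (fun i => fderiv ℝ h (φ m)
    (tangentMapAt I 𝓘(ℝ, F) φ m (v i))) = _
  simp only [e']
  rfl

/-- The exterior derivative of vector-valued forms commutes with linear maps of the
coefficients. -/
theorem extD_compContinuousAlternatingMap [I.Boundaryless] {q : ℕ} {η : DForm I M N q}
    (hη : IsSmoothForm I η) (A : N →L[ℝ] N') :
    extD I (fun m => A.compContinuousAlternatingMap (η m)) =
      fun m => A.compContinuousAlternatingMap (extD I η m) := by
  funext m
  have hd := hη.differentiableAt_chartForm m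
  let L : (F [⋀^Fin q]→L[ℝ] N) →L[ℝ] (F [⋀^Fin q]→L[ℝ] N') :=
    ContinuousLinearMap.compContinuousAlternatingMapCLM ℝ F N N' (Fin q) A
  have hc : chartForm I (fun m => A.compContinuousAlternatingMap (η m)) m =
      fun y => L (chartForm I η m y) := rfl
  have hd' : DifferentiableAt ℝ (fun y => L (chartForm I η m y)) (extChartAt I m m) :=
    L.differentiableAt.comp _ hd
  ext v
  simp only [extD, hc, ContinuousAlternatingMap.compContinuousLinearMap_apply,
    ContinuousLinearMap.compContinuousAlternatingMap_coe, Function.comp_apply]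
  rw [extDeriv_apply hd', extDeriv_apply hd, map_sum]
  refine Finset.sum_congr rfl fun i _ => ?_
  have hev : ∀ w : Fin q → F, DifferentiableAt ℝ (fun y => chartForm I η m y w)
      (extChartAt I m m) := fun w =>
    (ContinuousAlternatingMap.apply ℝ F N w).differentiableAt.comp _ hd
  have := (A.hasFDerivAt.comp _ (hev (i.removeNth
    (tangentMapAt I 𝓘(ℝ, F) (extChartAt I m) m ∘ v))).hasFDerivAt).fderiv
  simp only [map_zsmul]
  congr 1
  exact DFunLike.congr_fun this _

end ExteriorDerivative

/-! ### Smooth maps between powers of the group, and the Maurer-Cartan form -/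

section GroupMaps

variable {E : Type*} [NormedAddCommGroup E] [NormedSpace ℝ E]
  {G : Type*} [TopologicalSpace G] [ChartedSpace E G] [Group G] [LieGroup 𝓘(ℝ, E) ∞ G]

theorem contMDiff_mulLeftPow {n : ℕ} (a : Fin n → G) :
    ContMDiff (powModel E n) (powModel E n) ∞ fun (x : Fin n → G) i => a i * x i :=
  contMDiff_pow_iff.2 fun i => contMDiff_const.mul (contMDiff_proj i)

theorem contMDiff_mulRightPow {n : ℕ} (c : G) :
    ContMDiff (powModel E n) (powModel E n) ∞ fun (x : Fin n → G) i => x i * c :=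
  contMDiff_pow_iff.2 fun i => (contMDiff_proj i).mul contMDiff_const

theorem contMDiff_reindex {m n : ℕ} (s : Fin n → Fin m) :
    ContMDiff (powModel E m) (powModel E n) ∞ fun (x : Fin m → G) i => x (s i) :=
  contMDiff_pow_iff.2 fun i => contMDiff_proj (s i)

theorem contMDiff_partialProd {n : ℕ} (j : Fin (n + 1)) :
    ContMDiff (powModel E n) 𝓘(ℝ, E) ∞ fun x : Fin n → G => Fin.partialProd x j := by
  induction j using Fin.induction with
  | zero => simpa only [Fin.partialProd_zero] using contMDiff_const
  | succ i hi =>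
    simp only [Fin.partialProd_succ]
    exact hi.mul (contMDiff_proj i)

theorem contMDiff_sectionMap (n : ℕ) :
    ContMDiff (powModel E n) (powModel E (n + 1)) ∞
      fun (x : Fin n → G) j => (Fin.partialProd x j)⁻¹ :=
  contMDiff_pow_iff.2 fun j => (contMDiff_partialProd j).inv

theorem contMDiff_zetaAct {p : ℕ} (g : Fin (p + 1) → G) :
    ContMDiff (powModel E p) (powModel E p) ∞ (zetaAct g) :=
  contMDiff_pow_iff.2 fun j => (contMDiff_const.mul (contMDiff_proj j)).mul contMDiff_const

theorem contMDiff_gammaAct_apply {p : ℕ} (i : Fin (p + 1)) (m : Fin p → G) :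
    ContMDiff 𝓘(ℝ, E) (powModel E p) ∞ fun g : G => gammaAct i g m := by
  have h : ∀ k : Fin (p + 1), ContMDiff 𝓘(ℝ, E) 𝓘(ℝ, E) ∞
      fun g : G => (Pi.mulSingle i g : Fin (p + 1) → G) k := by
    intro k
    by_cases hk : k = i
    · subst hk; simpa using! contMDiff_id
    · simpa [Pi.mulSingle_eq_of_ne hk] using contMDiff_const
  exact contMDiff_pow_iff.2 fun j => ((h _).mul contMDiff_const).mul (h _).inv

theorem powPullback_powPullback {l m n q : ℕ} {g : (Fin m → G) → (Fin n → G)}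
    {f : (Fin l → G) → (Fin m → G)} (hg : ContMDiff (powModel E m) (powModel E n) ∞ g)
    (hf : ContMDiff (powModel E l) (powModel E m) ∞ f) (η : PowForm E G n q) :
    powPullback f (powPullback g η) = powPullback (fun x => g (f x)) η :=
  pullbackForm_pullbackForm (hg.mdifferentiable (by simp)) (hf.mdifferentiable (by simp)) η

theorem powPullback_apply {m n q : ℕ} (f : (Fin m → G) → (Fin n → G)) (η : PowForm E G n q)
    (x : Fin m → G) (v : Fin q → Fin m → E) :
    powPullback f η x v = η (f x) fun k => tangentMapAt (powModel E m) (powModel E n) f x (v k) :=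
  rfl

theorem tangentMapAt_proj {n : ℕ} (i : Fin n) (x : Fin n → G) :
    tangentMapAt (powModel E n) 𝓘(ℝ, E) (fun z => z i) x = ContinuousLinearMap.proj i := by
  refine HasMFDerivAt.mfderiv ⟨(continuous_apply i).continuousAt, ?_⟩
  have h : HasFDerivWithinAt (fun y : Fin n → E => y i) (ContinuousLinearMap.proj i)
      (Set.range (powModel E n)) (extChartAt (powModel E n) x x) :=
    (ContinuousLinearMap.proj i : (Fin n → E) →L[ℝ] E).hasFDerivWithinAt
  refine h.congr_of_eventuallyEq ?_ ?_
  · filter_upwards [extChartAt_target_mem_nhdsWithin (I := powModel E n) x] with y hy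
    exact (extChartAt 𝓘(ℝ, E) (x i)).right_inv (mem_extChartAt_pow_target.1 hy i)
  · exact (extChartAt 𝓘(ℝ, E) (x i)).right_inv
      (mem_extChartAt_pow_target.1 (mem_extChartAt_target (I := powModel E n) x) i)

/-- The `i`-th component of the differential of a map to a power of `G`. -/
theorem tangentMapAt_pow_apply {F : Type*} [NormedAddCommGroup F] [NormedSpace ℝ F] {H : Type*}
    [TopologicalSpace H] {I : ModelWithCorners ℝ F H} {M : Type*} [TopologicalSpace M]
    [ChartedSpace H M] {n : ℕ} {f : M → Fin n → G} {x : M}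
    (hf : MDifferentiableAt I (powModel E n) f x) (v : F) (i : Fin n) :
    tangentMapAt I (powModel E n) f x v i = tangentMapAt I 𝓘(ℝ, E) (fun y => f y i) x v := by
  have h : MDifferentiableAt (powModel E n) 𝓘(ℝ, E) (fun z : Fin n → G => z i) (f x) :=
    (contMDiff_proj (k := ∞) i).mdifferentiable (by simp) _
  have := tangentMapAt_comp_apply x h hf v
  rw [this, tangentMapAt_proj]
  rfl

end GroupMaps

section MaurerCartan

variable {E : Type*} [NormedAddCommGroup E] [NormedSpace ℝ E] [FiniteDimensional ℝ E]
  {G : Type*} [TopologicalSpace G] [ChartedSpace E G] [Group G] [LieGroup 𝓘(ℝ, E) ∞ G]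

theorem contMDiff_conj (g : G) :
    ContMDiff 𝓘(ℝ, E) 𝓘(ℝ, E) ∞ fun h : G => g * h * g⁻¹ :=
  (contMDiff_const.mul contMDiff_id).mul contMDiff_const

theorem isSmoothForm_maurerCartan : IsSmoothForm 𝓘(ℝ, E) (maurerCartan E G) :=
  isSmoothForm_of_transport (I' := 𝓘(ℝ, E)) (o := (1 : G)) (Φ := fun g h : G => g⁻¹ * h)
    (α := ContinuousAlternatingMap.ofSubsingleton ℝ E E (0 : Fin 1) (ContinuousLinearMap.id ℝ E))
    (contMDiff_fst.inv.mul contMDiff_snd) (fun g => inv_mul_cancel g) fun _ => rfl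

theorem maurerCartan_apply (g : G) (v : Fin 1 → E) :
    maurerCartan E G g v = tangentMapAt 𝓘(ℝ, E) 𝓘(ℝ, E) (fun h : G => g⁻¹ * h) g (v 0) := rfl

theorem pullbackForm_mulLeft_maurerCartan (a : G) :
    pullbackForm 𝓘(ℝ, E) 𝓘(ℝ, E) (fun g => a * g) (maurerCartan E G) = maurerCartan E G := by
  ext g v
  have h1 : ContMDiff 𝓘(ℝ, E) 𝓘(ℝ, E) ∞ fun h : G => a * h := contMDiff_const.mul contMDiff_id
  have h2 : ContMDiff 𝓘(ℝ, E) 𝓘(ℝ, E) ∞ fun h : G => (a * g)⁻¹ * h :=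
    contMDiff_const.mul contMDiff_id
  have := tangentMapAt_comp_apply g (h2.mdifferentiable (by simp) (a * g))
    (h1.mdifferentiable (by simp) g) (v 0)
  have e : (fun h : G => (a * g)⁻¹ * (a * h)) = fun h => g⁻¹ * h := by funext h; group
  rw [e] at this
  exact this.symm

theorem pullbackForm_mulRight_maurerCartan (c : G) :
    pullbackForm 𝓘(ℝ, E) 𝓘(ℝ, E) (fun g => g * c) (maurerCartan E G) = fun g =>
      (tangentMapAt 𝓘(ℝ, E) 𝓘(ℝ, E) (fun h : G => c⁻¹ * h * c⁻¹⁻¹) 1).compContinuousAlternatingMap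
        (maurerCartan E G g) := by
  ext g v
  have h1 : ContMDiff 𝓘(ℝ, E) 𝓘(ℝ, E) ∞ fun h : G => h * c := contMDiff_id.mul contMDiff_const
  have h2 : ContMDiff 𝓘(ℝ, E) 𝓘(ℝ, E) ∞ fun h : G => (g * c)⁻¹ * h :=
    contMDiff_const.mul contMDiff_id
  have h3 : ContMDiff 𝓘(ℝ, E) 𝓘(ℝ, E) ∞ fun h : G => g⁻¹ * h := contMDiff_const.mul contMDiff_id
  have e1 := tangentMapAt_comp_apply g (h2.mdifferentiable (by simp) (g * c))
    (h1.mdifferentiable (by simp) g) (v 0)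
  have e2 := tangentMapAt_comp_apply g ((contMDiff_conj c⁻¹).mdifferentiable (by simp) (g⁻¹ * g))
    (h3.mdifferentiable (by simp) g) (v 0)
  have e : (fun h : G => (g * c)⁻¹ * (h * c)) = fun h => c⁻¹ * (g⁻¹ * h) * c⁻¹⁻¹ := by
    funext h; group
  rw [e, e2, inv_mul_cancel] at e1
  exact e1.symm

theorem pullbackForm_mulLeft_extD_maurerCartan (a : G) :
    pullbackForm 𝓘(ℝ, E) 𝓘(ℝ, E) (fun g => a * g) (extD 𝓘(ℝ, E) (maurerCartan E G)) =
      extD 𝓘(ℝ, E) (maurerCartan E G) := by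
  rw [← extD_pullbackForm (f := fun g : G => a * g) (contMDiff_const.mul contMDiff_id)
    isSmoothForm_maurerCartan,
    pullbackForm_mulLeft_maurerCartan]

theorem pullbackForm_mulRight_extD_maurerCartan (c : G) :
    pullbackForm 𝓘(ℝ, E) 𝓘(ℝ, E) (fun g => g * c) (extD 𝓘(ℝ, E) (maurerCartan E G)) = fun g =>
      (tangentMapAt 𝓘(ℝ, E) 𝓘(ℝ, E) (fun h : G => c⁻¹ * h * c⁻¹⁻¹) 1).compContinuousAlternatingMap
        (extD 𝓘(ℝ, E) (maurerCartan E G) g) := by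
  rw [← extD_pullbackForm (f := fun g : G => g * c) (contMDiff_id.mul contMDiff_const)
    isSmoothForm_maurerCartan,
    pullbackForm_mulRight_maurerCartan,
    extD_compContinuousAlternatingMap isSmoothForm_maurerCartan]

theorem powPullback_pairForm {q : ℕ} {f : G → G} (hf : ContMDiff 𝓘(ℝ, E) 𝓘(ℝ, E) ∞ f)
    {f' : (Fin 1 → G) → (Fin 1 → G)} (hf' : ContMDiff (powModel E 1) (powModel E 1) ∞ f')
    (h : ∀ x, f' x 0 = f (x 0)) (Θ : DForm 𝓘(ℝ, E) G E q) (ξ : LieDual E G) :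
    powPullback f' (pairForm E G Θ ξ) = pairForm E G (pullbackForm 𝓘(ℝ, E) 𝓘(ℝ, E) f Θ) ξ := by
  have hp : MDifferentiable (powModel E 1) 𝓘(ℝ, E) fun x : Fin 1 → G => x 0 :=
    (contMDiff_proj (k := ∞) 0).mdifferentiable (by simp)
  have e1 := pullbackForm_pullbackForm hp (hf'.mdifferentiable (by simp)) (fun g =>
    (LinearMap.toContinuousLinearMap (show E →ₗ[ℝ] ℝ from ξ)).compContinuousAlternatingMap (Θ g))
  have e2 := pullbackForm_pullbackForm (hf.mdifferentiable (by simp)) hp (fun g =>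
    (LinearMap.toContinuousLinearMap (show E →ₗ[ℝ] ℝ from ξ)).compContinuousAlternatingMap (Θ g))
  simp only [h] at e1
  exact e1.trans e2.symm

theorem pairForm_comp {q : ℕ} (Θ : DForm 𝓘(ℝ, E) G E q) (g : G) (ξ : LieDual E G) :
    pairForm E G (fun x => (tangentMapAt 𝓘(ℝ, E) 𝓘(ℝ, E)
      (fun h : G => g * h * g⁻¹) 1).compContinuousAlternatingMap (Θ x)) ξ =
      pairForm E G Θ ((lieAd G g).dualMap ξ) := rfl

end MaurerCartan

/-! ### The adjoint action -/

section Adjoint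

variable {E : Type*} [NormedAddCommGroup E] [NormedSpace ℝ E] [FiniteDimensional ℝ E]
  {G : Type*} [TopologicalSpace G] [ChartedSpace E G] [Group G] [LieGroup 𝓘(ℝ, E) ∞ G]

theorem natCast_le_infty (n : ℕ) : (n : ℕ∞ω) ≤ ∞ := by exact_mod_cast (le_top : (n : ℕ∞) ≤ ⊤)

theorem mdifferentiable_mulLeft (a : G) :
    MDifferentiable 𝓘(ℝ, E) 𝓘(ℝ, E) fun h : G => a * h :=
  ContMDiff.mdifferentiable (n := ∞) (contMDiff_const.mul contMDiff_id) (by simp)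

theorem mdifferentiable_conj (g : G) :
    MDifferentiable 𝓘(ℝ, E) 𝓘(ℝ, E) fun h : G => g * h * g⁻¹ :=
  (contMDiff_conj g).mdifferentiable (by simp)

theorem tangentMapAt_conj_conj (g h : G) (v : E) :
    tangentMapAt 𝓘(ℝ, E) 𝓘(ℝ, E) (fun k : G => g⁻¹ * k * g) (g * h * g⁻¹)
      (tangentMapAt 𝓘(ℝ, E) 𝓘(ℝ, E) (fun k : G => g * k * g⁻¹) h v) = v := by
  have h1 : MDifferentiable 𝓘(ℝ, E) 𝓘(ℝ, E) fun k : G => g⁻¹ * k * g := by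
    simpa using mdifferentiable_conj (E := E) g⁻¹
  have := tangentMapAt_comp_apply h (h1 (g * h * g⁻¹)) (mdifferentiable_conj g h) v
  rw [← this]
  have e : (fun k : G => g⁻¹ * (g * k * g⁻¹) * g) = fun k => k := by funext k; group
  rw [e, tangentMapAt_id]
  rfl

theorem inverse_tangentMapAt_conj (g h : G) :
    (tangentMapAt 𝓘(ℝ, E) 𝓘(ℝ, E) (fun k : G => g * k * g⁻¹) h).inverse =
      tangentMapAt 𝓘(ℝ, E) 𝓘(ℝ, E) (fun k : G => g⁻¹ * k * g) (g * h * g⁻¹) := by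
  refine ContinuousLinearMap.inverse_eq ?_ ?_
  · ext v
    have := tangentMapAt_conj_conj g⁻¹ (g * h * g⁻¹) v
    simp only [inv_inv] at this
    have e : g⁻¹ * (g * h * g⁻¹) * g = h := by group
    rw [e] at this
    exact this
  · ext v
    exact tangentMapAt_conj_conj g h v

theorem mpullback_conj_mulInvariantVectorField (g : G) (v : LieAlg E G) :
    VectorField.mpullback 𝓘(ℝ, E) 𝓘(ℝ, E) (fun h : G => g * h * g⁻¹)
      (mulInvariantVectorField (lieAd G g v)) = mulInvariantVectorField v := by
  funext h
  let v' : E := v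
  have e1 := tangentMapAt_comp_apply (1 : G) (mdifferentiable_conj (E := E) g (h * 1))
    (mdifferentiable_mulLeft h 1) v'
  have e2 := tangentMapAt_comp_apply (1 : G)
    (mdifferentiable_mulLeft (E := E) (g * h * g⁻¹) (g * 1 * g⁻¹)) (mdifferentiable_conj g 1) v'
  have e : (fun k : G => g * (h * k) * g⁻¹) = fun k => g * h * g⁻¹ * (g * k * g⁻¹) := by
    funext k; group
  have hg : g * 1 * g⁻¹ = 1 := by group
  rw [e, e2, hg, mul_one] at e1
  have e3 := tangentMapAt_conj_conj g h (tangentMapAt 𝓘(ℝ, E) 𝓘(ℝ, E) (fun k : G => h * k) 1 v')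
  rw [← e1, ← inverse_tangentMapAt_conj] at e3
  exact e3

/-- The adjoint action is by automorphisms of the Lie algebra. -/
theorem lieAd_bracket (g : G) (v w : LieAlg E G) :
    lieAd G g ⁅v, w⁆ = ⁅lieAd G g v, lieAd G g w⁆ := by
  have : LieGroup 𝓘(ℝ, E) (minSmoothness ℝ 3) G :=
    LieGroup.of_le (n := ∞) (by simpa using natCast_le_infty 3)
  have : CompleteSpace E := FiniteDimensional.complete ℝ E
  have h := VectorField.mpullback_mlieBracket (n := ∞) (x₀ := (1 : G))
    (mdifferentiableAt_mulInvariantVectorField (lieAd G g v))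
    (mdifferentiableAt_mulInvariantVectorField (lieAd G g w))
    (contMDiff_conj (E := E) g).contMDiffAt
    (by simpa using natCast_le_infty 2)
  rw [mpullback_conj_mulInvariantVectorField, mpullback_conj_mulInvariantVectorField] at h
  have hg : g * 1 * g⁻¹ = 1 := by group
  set B : G → E := fun k => VectorField.mlieBracket 𝓘(ℝ, E)
    (mulInvariantVectorField (lieAd G g v)) (mulInvariantVectorField (lieAd G g w)) k with hB
  have h' : (tangentMapAt 𝓘(ℝ, E) 𝓘(ℝ, E) (fun k : G => g * k * g⁻¹) 1).inverse
      (B (g * 1 * g⁻¹)) = (⁅v, w⁆ : LieAlg E G) := h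
  have e := tangentMapAt_conj_conj (E := E) g⁻¹ (g * 1 * g⁻¹) (B (g * 1 * g⁻¹))
  simp only [inv_inv] at e
  have hg' : g⁻¹ * (g * 1 * g⁻¹) * g = 1 := by group
  rw [hg', ← inverse_tangentMapAt_conj, h', hg] at e
  exact e

end Adjoint

/-! ### The cup product and the characteristic homomorphism -/

section TotalComplex

variable {E : Type*} [NormedAddCommGroup E] [NormedSpace ℝ E] [FiniteDimensional ℝ E]
  {G : Type*} [TopologicalSpace G] [ChartedSpace E G] [Group G] [LieGroup 𝓘(ℝ, E) ∞ G]

theorem inEG_apply_same (p q : ℕ) (η : PowForm E G (p + 1) q) : inEG E G p q η (p, q) = η :=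
  DirectSum.lof_apply (M := fun pq : ℕ × ℕ => PowForm E G (pq.1 + 1) pq.2) ℝ (p, q) η

theorem inEG_apply_of_ne {p q : ℕ} (η : PowForm E G (p + 1) q) {pq : ℕ × ℕ} (h : pq ≠ (p, q)) :
    inEG E G p q η pq = 0 :=
  DirectSum.of_eq_of_ne _ _ _ h

/-- Two elements of the total space of `Ω(EG)` can be compared componentwise. -/
theorem totEG_induction {P : TotEG E G → Prop} (α : TotEG E G) (zero : P 0)
    (add : ∀ β γ, P β → P γ → P (β + γ)) (comp : ∀ p q, P (inEG E G p q (α (p, q)))) : P α := by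
  classical
  rw [← DirectSum.sum_support_of α]
  exact Finset.sum_induction _ P (fun β γ hβ hγ => add β γ hβ hγ) zero fun pq _ => comp pq.1 pq.2

theorem cupTot_inEG (p q p' q' : ℕ) (η : PowForm E G (p + 1) q) (η' : PowForm E G (p' + 1) q') :
    cupTot E G (inEG E G p q η) (inEG E G p' q' η') =
      inEG E G (p + p') (q + q') (cupEG E G p q p' q' η η') := by
  simp only [cupTot, inEG, DirectSum.toModule_lof, LinearMap.flip_apply]
  rfl

/-- The elements of the total space of `Ω(EG)` whose components lie in given subspaces. -/
def gradedSub (S : ∀ pq : ℕ × ℕ, Submodule ℝ (PowForm E G (pq.1 + 1) pq.2)) :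
    Submodule ℝ (TotEG E G) where
  carrier := {α | ∀ pq, α pq ∈ S pq}
  add_mem' ha hb pq := (S pq).add_mem (ha pq) (hb pq)
  zero_mem' pq := (S pq).zero_mem
  smul_mem' c _ ha pq := (S pq).smul_mem c (ha pq)

theorem inEG_mem_gradedSub {S : ∀ pq : ℕ × ℕ, Submodule ℝ (PowForm E G (pq.1 + 1) pq.2)}
    {p q : ℕ} {η : PowForm E G (p + 1) q} (h : η ∈ S (p, q)) : inEG E G p q η ∈ gradedSub S := by
  intro pq
  by_cases hpq : pq = (p, q)
  · subst hpq; rwa [inEG_apply_same]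
  · rw [inEG_apply_of_ne η hpq]; exact (S pq).zero_mem

theorem cupTot_mem_gradedSub
    {S T U : ∀ pq : ℕ × ℕ, Submodule ℝ (PowForm E G (pq.1 + 1) pq.2)}
    (h : ∀ p q p' q' η η', η ∈ S (p, q) → η' ∈ T (p', q') →
      cupEG E G p q p' q' η η' ∈ U (p + p', q + q'))
    {α β : TotEG E G} (hα : α ∈ gradedSub S) (hβ : β ∈ gradedSub T) :
    cupTot E G α β ∈ gradedSub U := by
  refine totEG_induction (P := fun α => cupTot E G α β ∈ gradedSub U) α ?_ ?_ ?_
  · simp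
  · intro a b ha hb; rw [map_add]; exact Submodule.add_mem _ ha hb
  intro p q
  refine totEG_induction (P := fun β => cupTot E G _ β ∈ gradedSub U) β ?_ ?_ ?_
  · simp
  · intro a b ha hb; rw [map_add]; exact Submodule.add_mem _ ha hb
  intro p' q'
  rw [cupTot_inEG]
  exact inEG_mem_gradedSub (h _ _ _ _ _ _ (hα _) (hβ _))

theorem pullbackForm_wedgeForm {F : Type*} [NormedAddCommGroup F] [NormedSpace ℝ F] {H : Type*}
    [TopologicalSpace H] (I : ModelWithCorners ℝ F H) {M : Type*} [TopologicalSpace M]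
    [ChartedSpace H M] {F' : Type*} [NormedAddCommGroup F'] [NormedSpace ℝ F'] {H' : Type*}
    [TopologicalSpace H'] (I' : ModelWithCorners ℝ F' H') {M' : Type*} [TopologicalSpace M']
    [ChartedSpace H' M'] {q q' : ℕ} (f : M → M') (α : DForm I' M' ℝ q) (β : DForm I' M' ℝ q') :
    pullbackForm I I' f (wedgeForm I' α β) =
      wedgeForm I (pullbackForm I I' f α) (pullbackForm I I' f β) := by
  ext x v
  simp only [pullbackForm, wedgeForm, LinearMap.coe_mk, AddHom.coe_mk, LinearMap.mk₂_apply,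
    ContinuousAlternatingMap.compContinuousLinearMap_apply, wedgeAlt,
    ContinuousAlternatingMap.smul_apply, ContinuousMultilinearMap.alternatization_apply_apply,
    mulForms_apply]
  rfl

theorem cupEG_apply (p q p' q' : ℕ) (η : PowForm E G (p + 1) q) (η' : PowForm E G (p' + 1) q') :
    cupEG E G p q p' q' η η' = (-1 : ℝ) ^ (q * p') • wedgeForm (powModel E (p + p' + 1))
      (powPullback (fun (x : Fin (p + p' + 1) → G) (i : Fin (p + 1)) => x ⟨i, by omega⟩) η)
      (powPullback (fun (x : Fin (p + p' + 1) → G) (i : Fin (p' + 1)) => x ⟨p + i, by omega⟩) η') :=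
  rfl

/-- Pullback is compatible with the cup product as soon as it is with the front and back
projections. -/
theorem powPullback_cupEG {p q p' q' : ℕ} {f : (Fin (p + p' + 1) → G) → Fin (p + p' + 1) → G}
    {f₁ : (Fin (p + 1) → G) → Fin (p + 1) → G} {f₂ : (Fin (p' + 1) → G) → Fin (p' + 1) → G}
    (hf : ContMDiff (powModel E (p + p' + 1)) (powModel E (p + p' + 1)) ∞ f)
    (hf₁ : ContMDiff (powModel E (p + 1)) (powModel E (p + 1)) ∞ f₁)
    (hf₂ : ContMDiff (powModel E (p' + 1)) (powModel E (p' + 1)) ∞ f₂)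
    (h₁ : ∀ (x : Fin (p + p' + 1) → G) (i : Fin (p + 1)),
      f x ⟨i, by omega⟩ = f₁ (fun j : Fin (p + 1) => x ⟨j, by omega⟩) i)
    (h₂ : ∀ (x : Fin (p + p' + 1) → G) (i : Fin (p' + 1)),
      f x ⟨p + i, by omega⟩ = f₂ (fun j : Fin (p' + 1) => x ⟨p + j, by omega⟩) i)
    (η : PowForm E G (p + 1) q) (η' : PowForm E G (p' + 1) q') :
    powPullback f (cupEG E G p q p' q' η η') =
      cupEG E G p q p' q' (powPullback f₁ η) (powPullback f₂ η') := by
  rw [cupEG_apply, cupEG_apply, map_smul]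
  congr 1
  rw [powPullback, pullbackForm_wedgeForm]
  change wedgeForm _ (powPullback f _) (powPullback f _) = _
  rw [powPullback_powPullback (contMDiff_reindex fun i : Fin (p + 1) =>
      (⟨i, by omega⟩ : Fin (p + p' + 1))) hf,
    powPullback_powPullback (contMDiff_reindex fun i : Fin (p' + 1) =>
      (⟨p + i, by omega⟩ : Fin (p + p' + 1))) hf,
    powPullback_powPullback hf₁ (contMDiff_reindex fun i : Fin (p + 1) =>
      (⟨i, by omega⟩ : Fin (p + p' + 1))),
    powPullback_powPullback hf₂ (contMDiff_reindex fun i : Fin (p' + 1) =>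
      (⟨p + i, by omega⟩ : Fin (p + p' + 1)))]
  have e₁ : (fun (x : Fin (p + p' + 1) → G) (i : Fin (p + 1)) => f x ⟨i, by omega⟩) =
      fun x => f₁ fun j : Fin (p + 1) => x ⟨j, by omega⟩ := by funext x i; exact h₁ x i
  have e₂ : (fun (x : Fin (p + p' + 1) → G) (i : Fin (p' + 1)) => f x ⟨p + i, by omega⟩) =
      fun x => f₂ fun j : Fin (p' + 1) => x ⟨p + j, by omega⟩ := by funext x i; exact h₂ x i
  rw [e₁, e₂]

theorem charWord_succ (n : ℕ) (v : Fin (n + 1) → LieDual E G × LieDual E G) :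
    charWord E G (n + 1) v = cupTot E G (charGen E G (v 0)) (charWord E G n (Fin.tail v)) := rfl

theorem charHom_tprod {n : ℕ} (v : Fin n → LieDual E G × LieDual E G) :
    charHom E G (TensorAlgebra.tprod ℝ _ n v) = charWord E G n v := by
  rw [charHom, LinearMap.comp_apply, AlgHom.toLinearMap_apply,
    TensorAlgebra.toDirectSum_tensorPower_tprod, ← DirectSum.lof_eq_of ℝ, DirectSum.toModule_lof,
    PiTensorProduct.lift.tprod]

theorem list_prod_eq_tprod (u : List (LieDual E G × LieDual E G)) :
    (u.map (TensorAlgebra.ι ℝ)).prod = TensorAlgebra.tprod ℝ _ u.length u.get := by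
  rw [TensorAlgebra.tprod_apply]
  have : (List.ofFn fun i => TensorAlgebra.ι ℝ (u.get i)) = u.map (TensorAlgebra.ι ℝ) := by
    rw [← Function.comp_def, ← List.map_ofFn, List.ofFn_get]
  rw [this]

theorem charHom_one : charHom E G 1 = oneEG E G :=
  charHom_tprod (E := E) (G := G) (n := 0) Fin.elim0

theorem charHom_ι_mul (v : LieDual E G × LieDual E G) (a : NCWeilAlg E G) :
    charHom E G (TensorAlgebra.ι ℝ v * a) = cupTot E G (charGen E G v) (charHom E G a) := by
  induction SuperSym.mem_span_words a using Submodule.span_induction with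
  | zero => simp
  | add p q _ _ hp hq => rw [mul_add, map_add, hp, hq, map_add, map_add]
  | smul r p _ hp => rw [mul_smul_comm, map_smul, hp, map_smul, map_smul]
  | mem p hp =>
    obtain ⟨u, rfl⟩ := hp
    have h : TensorAlgebra.ι ℝ v * (u.map (TensorAlgebra.ι ℝ)).prod =
        ((v :: u).map (TensorAlgebra.ι ℝ)).prod := by simp
    simp only [h]
    rw [list_prod_eq_tprod, list_prod_eq_tprod, charHom_tprod, charHom_tprod]
    rfl

end TotalComplex

/-- To prove a property of all elements of a tensor algebra that is stable under linear
combinations, it suffices to treat `1` and left multiplication by letters. -/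
theorem TensorAlgebra.left_induction {M : Type*} [AddCommGroup M] [Module ℝ M]
    {P : TensorAlgebra ℝ M → Prop} (one : P 1) (add : ∀ a b, P a → P b → P (a + b))
    (smul : ∀ (r : ℝ) a, P a → P (r • a)) (ι_mul : ∀ v a, P a → P (TensorAlgebra.ι ℝ v * a))
    (a : TensorAlgebra ℝ M) : P a := by
  have key : ∀ x b, P b → P (x * b) := by
    intro x
    induction x using TensorAlgebra.induction with
    | algebraMap r => intro b hb; rw [← Algebra.smul_def]; exact smul r b hb
    | ι v => exact ι_mul v
    | mul x y hx hy => intro b hb; rw [mul_assoc]; exact hx _ (hy _ hb)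
    | add x y hx hy => intro b hb; rw [add_mul]; exact add _ _ (hx b hb) (hy b hb)
  simpa using key a 1 one

/-! ### Left invariance and equivariance of the characteristic homomorphism -/

theorem sum_comm_four {J M : Type*} [Fintype J] [AddCommMonoid M] (F : J → J → J → J → M) :
    ∑ b, ∑ c, ∑ x, ∑ y, F b c x y = ∑ y, ∑ x, ∑ b, ∑ c, F b c x y := by
  have h : ∀ b, ∑ c, ∑ x, ∑ y, F b c x y = ∑ y, ∑ x, ∑ c, F b c x y := by
    intro b
    rw [Finset.sum_comm, Finset.sum_congr rfl fun x _ => Finset.sum_comm, Finset.sum_comm]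
  simp only [h]
  rw [Finset.sum_comm]
  exact Finset.sum_congr rfl fun y _ => Finset.sum_comm

section SymNaturality

variable {A B A' B' : Type*} [AddCommGroup A] [Module ℝ A] [AddCommGroup B] [Module ℝ B]
  [AddCommGroup A'] [Module ℝ A'] [AddCommGroup B'] [Module ℝ B']

/-- The homomorphism of tensor algebras induced by a parity-preserving linear map of the
letters. -/
def letterMap (f : A →ₗ[ℝ] A') (g : B →ₗ[ℝ] B') :
    TensorAlgebra ℝ (A × B) →ₐ[ℝ] TensorAlgebra ℝ (A' × B') :=
  TensorAlgebra.lift ℝ (TensorAlgebra.ι ℝ ∘ₗ f.prodMap g)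

theorem letterMap_ι (f : A →ₗ[ℝ] A') (g : B →ₗ[ℝ] B') (v : A × B) :
    letterMap f g (TensorAlgebra.ι ℝ v) = TensorAlgebra.ι ℝ (f v.1, g v.2) := by
  simp [letterMap]

theorem letterMap_tprod (f : A →ₗ[ℝ] A') (g : B →ₗ[ℝ] B') {n : ℕ} (v : Fin n → A × B) :
    letterMap f g (TensorAlgebra.tprod ℝ _ n v) =
      TensorAlgebra.tprod ℝ _ n fun i => f.prodMap g (v i) := by
  rw [TensorAlgebra.tprod_apply, TensorAlgebra.tprod_apply, map_list_prod, List.map_ofFn]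
  congr 2
  funext i
  exact letterMap_ι f g (v i)

theorem span_tprod_eq_top {M : Type*} [AddCommGroup M] [Module ℝ M] :
    Submodule.span ℝ {a : TensorAlgebra ℝ M | ∃ (n : ℕ) (v : Fin n → M),
      a = TensorAlgebra.tprod ℝ _ n v} = ⊤ := by
  refine eq_top_iff.2 fun a ha => ?_
  clear ha
  induction a using TensorAlgebra.left_induction with
  | one => exact Submodule.subset_span ⟨0, Fin.elim0, by simp [TensorAlgebra.tprod_apply]⟩
  | add a b ha hb => exact add_mem ha hb
  | smul r a ha => exact Submodule.smul_mem _ r ha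
  | ι_mul v a ha =>
    induction ha using Submodule.span_induction with
    | zero => rw [mul_zero]; exact Submodule.zero_mem _
    | add a b _ _ ha hb => rw [mul_add]; exact add_mem ha hb
    | smul r a _ ha => rw [mul_smul_comm]; exact Submodule.smul_mem _ r ha
    | mem a ha =>
      obtain ⟨n, w, rfl⟩ := ha
      exact Submodule.subset_span
        ⟨n + 1, Fin.cons v w, by simp [TensorAlgebra.tprod_apply, List.ofFn_succ]⟩

/-- Graded symmetrisation is natural in the super vector space of letters. -/
theorem symOp_letterMap (f : A →ₗ[ℝ] A') (g : B →ₗ[ℝ] B') (a : TensorAlgebra ℝ (A × B)) :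
    SuperSym.symOp A' B' (letterMap f g a) = letterMap f g (SuperSym.symOp A B a) := by
  have h : SuperSym.symOp A' B' ∘ₗ (letterMap f g).toLinearMap =
      (letterMap f g).toLinearMap ∘ₗ SuperSym.symOp A B := by
    refine LinearMap.ext_on span_tprod_eq_top ?_
    rintro _ ⟨n, v, rfl⟩
    simp only [LinearMap.comp_apply, AlgHom.toLinearMap_apply, letterMap_tprod,
      SuperSym.symOp_tprod, SuperSym.symMulti_apply, map_smul, map_sum]
    refine congrArg _ (Finset.sum_congr rfl fun σ _ => Finset.sum_congr rfl fun ε _ => ?_)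
    congr 2
    funext i
    cases ε (σ i) <;> simp [SuperSym.parityProj]
  exact DFunLike.congr_fun h a

end SymNaturality

section Symmetries

variable {E : Type*} [NormedAddCommGroup E] [NormedSpace ℝ E] [FiniteDimensional ℝ E]
  {G : Type*} [TopologicalSpace G] [ChartedSpace E G] [Group G] [LieGroup 𝓘(ℝ, E) ∞ G]

/-- The forms on `Gⁿ` that are invariant under left translation by all of `Gⁿ`. -/
def leftInvForms (n q : ℕ) : Submodule ℝ (PowForm E G n q) where
  carrier := {η | ∀ a : Fin n → G, powPullback (fun x i => a i * x i) η = η}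
  add_mem' h h' a := by rw [map_add, h, h']
  zero_mem' a := map_zero _
  smul_mem' c _ h a := by rw [map_smul, h]

variable (E G) in
/-- The elements of the total space of `Ω(EG)` all of whose components are left-invariant. -/
def leftInvTot : Submodule ℝ (TotEG E G) := gradedSub fun pq => leftInvForms (pq.1 + 1) pq.2

theorem thetaEG_mem_leftInvForms (ξ : LieDual E G) : thetaEG E G ξ ∈ leftInvForms 1 1 := by
  intro a
  rw [thetaEG, powPullback_pairForm (f := fun g => a 0 * g)
    (contMDiff_const.mul contMDiff_id) (contMDiff_mulLeftPow a) (fun x => rfl),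
    pullbackForm_mulLeft_maurerCartan]

theorem dThetaEG_mem_leftInvForms (ξ : LieDual E G) : dThetaEG E G ξ ∈ leftInvForms 1 2 := by
  intro a
  rw [dThetaEG, powPullback_pairForm (f := fun g => a 0 * g)
    (contMDiff_const.mul contMDiff_id) (contMDiff_mulLeftPow a) (fun x => rfl),
    pullbackForm_mulLeft_extD_maurerCartan]

theorem simpD_apply (p q : ℕ) (η : PowForm E G (p + 1) q) :
    simpD E G p q η = ∑ i : Fin (p + 2), ((-1 : ℝ) ^ (i : ℕ)) •
      powPullback (fun (x : Fin (p + 2) → G) (j : Fin (p + 1)) => x (i.succAbove j)) η := by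
  simp [simpD]

theorem simpD_mem_leftInvForms {p q : ℕ} {η : PowForm E G (p + 1) q}
    (h : η ∈ leftInvForms (p + 1) q) : simpD E G p q η ∈ leftInvForms (p + 2) q := by
  intro a
  rw [simpD_apply, map_sum]
  refine Finset.sum_congr rfl fun i _ => ?_
  rw [map_smul, powPullback_powPullback (contMDiff_reindex _) (contMDiff_mulLeftPow a)]
  conv_rhs => rw [← h fun j => a (i.succAbove j),
    powPullback_powPullback (contMDiff_mulLeftPow _) (contMDiff_reindex _)]

theorem oneEG_mem_leftInvTot : oneEG E G ∈ leftInvTot E G :=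
  inEG_mem_gradedSub fun _ => rfl

theorem charGen_apply (v : LieDual E G × LieDual E G) :
    charGen E G v = inEG E G 0 1 (thetaEG E G v.1) +
      (inEG E G 1 1 (simpD E G 0 1 (thetaEG E G v.2)) + inEG E G 0 2 (dThetaEG E G v.2)) := rfl

theorem charGen_mem_leftInvTot (v : LieDual E G × LieDual E G) :
    charGen E G v ∈ leftInvTot E G := by
  rw [charGen_apply]
  refine add_mem (inEG_mem_gradedSub (thetaEG_mem_leftInvForms _)) (add_mem
    (inEG_mem_gradedSub (simpD_mem_leftInvForms (thetaEG_mem_leftInvForms _)))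
    (inEG_mem_gradedSub (dThetaEG_mem_leftInvForms _)))

/-- The characteristic homomorphism of the Maurer-Cartan connection has values in left-invariant
forms. -/
theorem charHom_mem_leftInvTot (a : NCWeilAlg E G) : charHom E G a ∈ leftInvTot E G := by
  induction a using TensorAlgebra.left_induction with
  | one => rw [charHom_one]; exact oneEG_mem_leftInvTot
  | add a b ha hb => rw [map_add]; exact add_mem ha hb
  | smul r a ha => rw [map_smul]; exact Submodule.smul_mem _ r ha
  | ι_mul v a ha =>
    rw [charHom_ι_mul]
    refine cupTot_mem_gradedSub ?_ (charGen_mem_leftInvTot v) ha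
    intro p q p' q' η η' h h' b
    rw [powPullback_cupEG (f := fun x i => b i * x i) (contMDiff_mulLeftPow b)
      (contMDiff_mulLeftPow fun i : Fin (p + 1) => b ⟨i, by omega⟩)
      (contMDiff_mulLeftPow fun i : Fin (p' + 1) => b ⟨p + i, by omega⟩)
      (fun _ _ => rfl) (fun _ _ => rfl), h, h']

/-- Right translation by the diagonal of `G^{p+1}`, on the total space of `Ω(EG)`. -/
def rightTranslate (c : G) : TotEG E G →ₗ[ℝ] TotEG E G :=
  DirectSum.toModule ℝ (ℕ × ℕ) _ fun pq =>
    inEG E G pq.1 pq.2 ∘ₗ powPullback fun (x : Fin (pq.1 + 1) → G) i => x i * c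

theorem rightTranslate_inEG (c : G) (p q : ℕ) (η : PowForm E G (p + 1) q) :
    rightTranslate c (inEG E G p q η) = inEG E G p q (powPullback (fun x i => x i * c) η) := by
  rw [rightTranslate]
  exact DirectSum.toModule_lof (M := fun pq : ℕ × ℕ => PowForm E G (pq.1 + 1) pq.2) ℝ (p, q) η

theorem rightTranslate_apply (c : G) (α : TotEG E G) (pq : ℕ × ℕ) :
    rightTranslate c α pq = powPullback (fun x i => x i * c) (α pq) := by
  refine totEG_induction (P := fun β => rightTranslate c β pq =
    powPullback (fun x i => x i * c) (β pq)) α ?_ ?_ ?_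
  · rw [map_zero]; exact (map_zero (powPullback fun x i => x i * c)).symm
  · intro a b ha hb
    rw [map_add, DirectSum.add_apply, DirectSum.add_apply, map_add, ha, hb]
  · intro p q
    rw [rightTranslate_inEG]
    by_cases h : pq = (p, q)
    · subst h; rw [inEG_apply_same, inEG_apply_same]
    · rw [inEG_apply_of_ne _ h, inEG_apply_of_ne _ h, map_zero]

theorem rightTranslate_cupTot (c : G) (α β : TotEG E G) :
    rightTranslate c (cupTot E G α β) =
      cupTot E G (rightTranslate c α) (rightTranslate c β) := by
  refine totEG_induction (P := fun α => rightTranslate c (cupTot E G α β) =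
    cupTot E G (rightTranslate c α) (rightTranslate c β)) α ?_ ?_ ?_
  · simp
  · intro a b ha hb; simp only [map_add, LinearMap.add_apply, ha, hb]
  intro p q
  refine totEG_induction (P := fun β => rightTranslate c (cupTot E G _ β) =
    cupTot E G (rightTranslate c _) (rightTranslate c β)) β ?_ ?_ ?_
  · simp
  · intro a b ha hb; simp only [map_add, ha, hb]
  intro p' q'
  rw [cupTot_inEG, rightTranslate_inEG, rightTranslate_inEG, rightTranslate_inEG, cupTot_inEG,
    powPullback_cupEG (contMDiff_mulRightPow c) (contMDiff_mulRightPow c)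
      (contMDiff_mulRightPow c) (fun _ _ => rfl) (fun _ _ => rfl)]

theorem powPullback_mulRight_thetaEG (c : G) (ξ : LieDual E G) :
    powPullback (fun x i => x i * c) (thetaEG E G ξ) =
      thetaEG E G ((lieAd G c⁻¹).dualMap ξ) := by
  rw [thetaEG, powPullback_pairForm (f := fun g => g * c)
    (contMDiff_id.mul contMDiff_const) (contMDiff_mulRightPow c) (fun x => rfl),
    pullbackForm_mulRight_maurerCartan, pairForm_comp]

theorem powPullback_mulRight_dThetaEG (c : G) (ξ : LieDual E G) :
    powPullback (fun x i => x i * c) (dThetaEG E G ξ) =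
      dThetaEG E G ((lieAd G c⁻¹).dualMap ξ) := by
  rw [dThetaEG, powPullback_pairForm (f := fun g => g * c)
    (contMDiff_id.mul contMDiff_const) (contMDiff_mulRightPow c) (fun x => rfl),
    pullbackForm_mulRight_extD_maurerCartan, pairForm_comp]

theorem powPullback_mulRight_simpD (c : G) (p q : ℕ) (η : PowForm E G (p + 1) q) :
    powPullback (fun x i => x i * c) (simpD E G p q η) =
      simpD E G p q (powPullback (fun x i => x i * c) η) := by
  rw [simpD_apply, simpD_apply, map_sum]
  refine Finset.sum_congr rfl fun i _ => ?_
  rw [map_smul, powPullback_powPullback (contMDiff_reindex _) (contMDiff_mulRightPow c),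
    powPullback_powPullback (contMDiff_mulRightPow c) (contMDiff_reindex _)]

/-- The coadjoint action on the letters of the noncommutative Weil algebra. -/
def ncCoad (g : G) : NCWeilAlg E G →ₐ[ℝ] NCWeilAlg E G :=
  letterMap (lieAd G g).dualMap (lieAd G g).dualMap

/-- The characteristic homomorphism intertwines the coadjoint action with right translation. -/
theorem rightTranslate_charHom (c : G) (a : NCWeilAlg E G) :
    rightTranslate c (charHom E G a) = charHom E G (ncCoad c⁻¹ a) := by
  induction a using TensorAlgebra.left_induction with
  | one => rw [map_one (ncCoad c⁻¹), charHom_one, oneEG, rightTranslate_inEG]; rfl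
  | add a b ha hb => simp only [map_add, ha, hb]
  | smul r a ha => simp only [map_smul, ha]
  | ι_mul v a ha =>
    rw [charHom_ι_mul, rightTranslate_cupTot, ha, map_mul, ncCoad, letterMap_ι, charHom_ι_mul]
    congr 2
    rw [charGen_apply, charGen_apply, map_add, map_add, rightTranslate_inEG, rightTranslate_inEG,
      rightTranslate_inEG, powPullback_mulRight_thetaEG, powPullback_mulRight_dThetaEG,
      powPullback_mulRight_simpD, powPullback_mulRight_thetaEG]

/-- The curvature elements are natural under the coadjoint action, as `Ad_g` preserves the
bracket. -/
theorem ncCoad_ncCurv (g : G) (ξ : LieDual E G) :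
    ncCoad g (ncCurv E G ξ) = ncCurv E G ((lieAd G g).dualMap ξ) := by
  have : LieGroup 𝓘(ℝ, E) (minSmoothness ℝ 3) G :=
    LieGroup.of_le (n := ∞) (by simpa using natCast_le_infty 3)
  have : CompleteSpace E := FiniteDimensional.complete ℝ E
  set e := Module.finBasis ℝ (LieAlg E G) with he
  have hW : ncCoad g (ncW E G ξ) = ncW E G ((lieAd G g).dualMap ξ) := by
    simp [ncW, ncCoad, letterMap_ι]
  have hT : ∀ b, ncCoad g (ncT E G (e.coord b)) =
      ∑ d, e.coord b (lieAd G g (e d)) • ncT E G (e.coord d) := by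
    intro b
    have h1 : (lieAd G g).dualMap (e.coord b) =
        ∑ d, e.coord b (lieAd G g (e d)) • e.coord d := by
      refine e.ext fun d => ?_
      simp [Finsupp.single_apply]
    have h2 : ncCoad g (ncT E G (e.coord b)) = ncT E G ((lieAd G g).dualMap (e.coord b)) := by
      simp [ncT, ncCoad, letterMap_ι]
    rw [h2, h1, map_sum]
    simp only [map_smul]
  have hB : ∀ d d', ξ (lieAd G g ⁅e d, e d'⁆) = ∑ b, ∑ c,
      (e.coord b (lieAd G g (e d)) * e.coord c (lieAd G g (e d'))) * ξ ⁅e b, e c⁆ := by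
    intro d d'
    rw [lieAd_bracket]
    have h1 := e.sum_repr (lieAd G g (e d))
    have h2 := e.sum_repr (lieAd G g (e d'))
    conv_lhs => rw [← h1, ← h2]
    simp only [sum_lie, lie_sum, smul_lie, lie_smul, map_sum, map_smul, smul_eq_mul,
      Module.Basis.coord_apply, Finset.mul_sum]
    rw [Finset.sum_comm]
    exact Finset.sum_congr rfl fun b _ => Finset.sum_congr rfl fun c _ => by ring
  simp only [ncCurv, ← he, LinearMap.add_apply, LinearMap.smul_apply, LinearMap.sum_apply,
    LinearMap.smulRight_apply, map_add, map_smul, map_sum, map_mul, hW, hT, Module.Dual.eval_apply,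
    LinearMap.dualMap_apply, hB]
  congr 2
  simp only [Finset.sum_mul, Finset.mul_sum, Finset.smul_sum, Finset.sum_smul, smul_mul_smul_comm,
    smul_smul]
  rw [sum_comm_four]
  exact Finset.sum_congr rfl fun d _ => Finset.sum_congr rfl fun d' _ => Finset.sum_congr rfl
    fun b _ => Finset.sum_congr rfl fun c _ => by rw [mul_comm]

theorem weilSym_algHom (p : TensorAlgebra ℝ (LieDual E G)) :
    weilSym E G (SymmetricAlgebra.algHom ℝ _ p) =
      SuperSym.symOp _ _ (TensorAlgebra.lift ℝ (ncCurv E G) p) := by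
  rw [weilSym, SuperSym.descend_algHom]; rfl

theorem weilSym_coadSym (g : G) (P : SymDual E G) :
    weilSym E G (coadSym G g P) = ncCoad g (weilSym E G P) := by
  obtain ⟨p, rfl⟩ := SymmetricAlgebra.algHom_surjective ℝ _ P
  have e : coadSym G g (SymmetricAlgebra.algHom ℝ _ p) = SymmetricAlgebra.algHom ℝ _
      (TensorAlgebra.lift ℝ (TensorAlgebra.ι ℝ ∘ₗ (lieAd G g).dualMap) p) := by
    have : (coadSym (E := E) G g).comp (SymmetricAlgebra.algHom ℝ _) =
        (SymmetricAlgebra.algHom ℝ _).comp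
        (TensorAlgebra.lift ℝ (TensorAlgebra.ι ℝ ∘ₗ (lieAd G g).dualMap)) := by
      ext ξ : 2
      simp only [AlgHom.toLinearMap_apply, AlgHom.comp_apply, LinearMap.comp_apply,
        TensorAlgebra.lift_ι_apply]
      change coadSym G g (SymmetricAlgebra.ι ℝ _ ξ) =
        SymmetricAlgebra.ι ℝ _ ((lieAd G g).dualMap ξ)
      simp [coadSym]
    exact DFunLike.congr_fun this p
  have e' : TensorAlgebra.lift ℝ (ncCurv E G)
      (TensorAlgebra.lift ℝ (TensorAlgebra.ι ℝ ∘ₗ (lieAd G g).dualMap) p) =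
      ncCoad g (TensorAlgebra.lift ℝ (ncCurv E G) p) := by
    have : (TensorAlgebra.lift ℝ (ncCurv E G)).comp
        (TensorAlgebra.lift ℝ (TensorAlgebra.ι ℝ ∘ₗ (lieAd G g).dualMap)) =
        (ncCoad g).comp (TensorAlgebra.lift ℝ (ncCurv E G)) := by
      ext ξ : 2
      simp [ncCoad_ncCurv]
    exact DFunLike.congr_fun this p
  rw [e, weilSym_algHom, weilSym_algHom, e', ncCoad, symOp_letterMap]

theorem rightTranslate_charHom_weilSym (c : G) {P : SymDual E G} (hP : P ∈ invPoly E G) :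
    rightTranslate c (charHom E G (weilSym E G P)) = charHom E G (weilSym E G P) := by
  rw [rightTranslate_charHom, ← weilSym_coadSym, hP c⁻¹]

end Symmetries

/-! ### Invariance of the image of the Alekseev-Meinrenken map -/

section Invariance

variable {E : Type*} [NormedAddCommGroup E] [NormedSpace ℝ E] [FiniteDimensional ℝ E]
  {G : Type*} [TopologicalSpace G] [ChartedSpace E G] [Group G] [LieGroup 𝓘(ℝ, E) ∞ G]

theorem sectionPullback_apply (α : TotEG E G) (pq : ℕ × ℕ) :
    sectionPullback E G α pq =
      powPullback (fun (x : Fin pq.1 → G) (j : Fin (pq.1 + 1)) => (Fin.partialProd x j)⁻¹)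
        (α pq) := by
  refine totEG_induction (P := fun β => sectionPullback E G β pq =
    powPullback (fun (x : Fin pq.1 → G) (j : Fin (pq.1 + 1)) => (Fin.partialProd x j)⁻¹)
      (β pq)) α ?_ ?_ ?_
  · rw [map_zero]
    exact (map_zero (powPullback fun (x : Fin pq.1 → G) (j : Fin (pq.1 + 1)) =>
      (Fin.partialProd x j)⁻¹)).symm
  · intro a b ha hb
    rw [map_add, DirectSum.add_apply, DirectSum.add_apply, map_add, ha, hb]
  · intro p q
    have h : ∀ η : PowForm E G (p + 1) q, sectionPullback E G (inEG E G p q η) =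
        DirectSum.lof ℝ (ℕ × ℕ) (fun pq : ℕ × ℕ => PowForm E G pq.1 pq.2) (p, q)
          (powPullback (fun (x : Fin p → G) (j : Fin (p + 1)) => (Fin.partialProd x j)⁻¹) η) := by
      intro η
      rw [sectionPullback]
      exact DirectSum.toModule_lof (M := fun pq : ℕ × ℕ => PowForm E G (pq.1 + 1) pq.2) ℝ (p, q) η
    rw [h]
    by_cases hpq : pq = (p, q)
    · subst hpq
      rw [inEG_apply_same]
      exact DirectSum.lof_apply (M := fun pq : ℕ × ℕ => PowForm E G pq.1 pq.2) ℝ (p, q) _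
    · rw [inEG_apply_of_ne _ hpq, map_zero]
      exact DirectSum.of_eq_of_ne _ _ _ hpq

theorem alekseevMeinrenken_apply (P : SymDual E G) (pq : ℕ × ℕ) :
    alekseevMeinrenken E G P pq =
      powPullback (fun (x : Fin pq.1 → G) (j : Fin (pq.1 + 1)) => (Fin.partialProd x j)⁻¹)
        (charHom E G (weilSym E G P) pq) :=
  sectionPullback_apply _ _

theorem partialProd_one {p : ℕ} (j : Fin (p + 1)) : Fin.partialProd (1 : Fin p → G) j = 1 := by
  induction j using Fin.induction with
  | zero => simp
  | succ i hi => rw [Fin.partialProd_succ, hi, Pi.one_apply, mul_one]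

theorem partialProd_zetaAct {p : ℕ} (g : Fin (p + 1) → G) (x : Fin p → G) (j : Fin (p + 1)) :
    Fin.partialProd (zetaAct g x) j = g 0 * Fin.partialProd x j * (g j)⁻¹ := by
  induction j using Fin.induction with
  | zero => simp
  | succ i hi => rw [Fin.partialProd_succ, hi, Fin.partialProd_succ, zetaAct]; group

/-- The pullback under `ι` of a left-invariant form that is also invariant under the right diagonal
action is invariant under `G^{p+1}`. -/
theorem powPullback_zetaAct_section {p q : ℕ} {η : PowForm E G (p + 1) q}
    (hl : η ∈ leftInvForms (p + 1) q) (hr : ∀ c : G, powPullback (fun x i => x i * c) η = η)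
    (g : Fin (p + 1) → G) :
    powPullback (zetaAct g) (powPullback
      (fun (x : Fin p → G) (j : Fin (p + 1)) => (Fin.partialProd x j)⁻¹) η) =
      powPullback (fun (x : Fin p → G) (j : Fin (p + 1)) => (Fin.partialProd x j)⁻¹) η := by
  rw [powPullback_powPullback (contMDiff_sectionMap p) (contMDiff_zetaAct g)]
  conv_rhs => rw [← hl g, ← hr (g 0)⁻¹,
    powPullback_powPullback (contMDiff_mulRightPow _) (contMDiff_mulLeftPow g),
    powPullback_powPullback (g := fun (x : Fin (p + 1) → G) i => g i * x i * (g 0)⁻¹)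
      ((contMDiff_mulRightPow _).comp (contMDiff_mulLeftPow g))
      (contMDiff_sectionMap p)]
  congr 1
  congr 1
  funext x j
  simp only [partialProd_zetaAct]
  group

/-- Invariant forms on `BG_p` are smooth, since `G^{p+1}` acts transitively: the smooth family
`m ↦ (1, x₁, x₁ x₂, …)` moves each point `m = (x₁, …, x_p)` to the base point. -/
theorem isSmoothForm_of_zetaAct_invariant {p q : ℕ} {η : PowForm E G p q}
    (h : ∀ g : Fin (p + 1) → G, powPullback (zetaAct g) η = η) :
    IsSmoothForm (powModel E p) η := by
  have ho : ∀ m : Fin p → G, zetaAct (Fin.partialProd m) m = 1 := by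
    intro m
    funext j
    simp only [zetaAct, Fin.partialProd_succ, Pi.one_apply]
    group
  refine isSmoothForm_of_transport (I' := powModel E p) (o := (1 : Fin p → G)) (α := η 1)
    (Φ := fun m x => zetaAct (Fin.partialProd m) x) ?_ ho fun m => ?_
  · refine contMDiff_pow_iff.2 fun j => ?_
    exact (((contMDiff_partialProd j.castSucc).comp contMDiff_fst).mul
      ((contMDiff_proj j).comp contMDiff_snd)).mul
      ((contMDiff_partialProd j.succ).comp contMDiff_fst).inv
  · conv_lhs => rw [← h (Fin.partialProd m)]
    rw [← ho m]
    rfl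

/-- The Alekseev-Meinrenken map sends invariant polynomials to invariant forms. -/
theorem isInvTot_alekseevMeinrenken {P : SymDual E G} (hP : P ∈ invPoly E G) :
    IsInvTot E G (alekseevMeinrenken E G P) := by
  intro pq
  have h : ∀ g : Fin (pq.1 + 1) → G, powPullback (zetaAct g) (alekseevMeinrenken E G P pq) =
      alekseevMeinrenken E G P pq := by
    intro g
    rw [alekseevMeinrenken_apply]
    refine powPullback_zetaAct_section (charHom_mem_leftInvTot _ pq) (fun c => ?_) g
    rw [← rightTranslate_apply, rightTranslate_charHom_weilSym c hP]
  exact ⟨isSmoothForm_of_zetaAct_invariant h, h⟩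

end Invariance

/-! ### Elements of an algebra are determined by iterated contractions -/

section Contractions

/-- The composition `D xₙ ∘ ⋯ ∘ D x₁` for a list `[x₁, …, xₙ]`. -/
def iterContr {V A : Type*} [AddCommGroup A] [Module ℝ A] (D : V → A →ₗ[ℝ] A) :
    List V → A →ₗ[ℝ] A
  | [] => LinearMap.id
  | x :: l => iterContr D l ∘ₗ D x

theorem foldl_eq_iterContr {V A : Type*} [AddCommGroup A] [Module ℝ A] (D : V → A →ₗ[ℝ] A)
    (l : List V) (a : A) : l.foldl (fun b x => D x b) a = iterContr D l a := by
  induction l generalizing a with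
  | nil => rfl
  | cons x l ih => exact ih _

section Euler

variable {V : Type*} [AddCommGroup V] [Module ℝ V]
  {A : Type*} [Ring A] [Algebra ℝ A]
  (j : Module.Dual ℝ V →ₗ[ℝ] A) (D : V → A →ₗ[ℝ] A) (s : ℝ)

/-- The elements of word length less than `n` in the letters `j ξ`. -/
def wordFiltration : ℕ → Submodule ℝ A
  | 0 => ⊥
  | n + 1 => (1 ⊔ LinearMap.range j) ^ n

theorem wordFiltration_le_succ (n : ℕ) : wordFiltration j n ≤ wordFiltration j (n + 1) := by
  cases n with
  | zero => exact bot_le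
  | succ n => exact pow_le_pow_right' le_sup_left (Nat.le_succ n)

theorem mul_mem_wordFiltration (ξ : Module.Dual ℝ V) {n : ℕ} {a : A}
    (ha : a ∈ wordFiltration j n) : j ξ * a ∈ wordFiltration j (n + 1) := by
  cases n with
  | zero => rw [(Submodule.mem_bot ℝ).1 ha, mul_zero]; exact Submodule.zero_mem _
  | succ n =>
    rw [wordFiltration, pow_succ']
    exact Submodule.mul_mem_mul (Submodule.mem_sup_right ⟨ξ, rfl⟩) ha

variable {j D s}

/-- The (super)derivations `D x` shorten words, and the Euler operator `∑ e^a D_{e_a}` multiplies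
words of length `n` by `n`, up to shorter words. -/
theorem euler_wordFiltration {J : Type*} [Fintype J] (e : Module.Basis J ℝ V)
    (h1 : ∀ x, D x 1 = 0)
    (hD : ∀ x ξ a, D x (j ξ * a) = ξ x • a + s • (j ξ * D x a))
    (hs : s * s = 1) (hj : ∀ ξ η, j ξ * j η = s • (j η * j ξ))
    (n : ℕ) {a : A} (ha : a ∈ wordFiltration j (n + 1)) :
    (∀ x, D x a ∈ wordFiltration j n) ∧
      (n : ℝ) • a - ∑ i, j (e.coord i) * D (e i) a ∈ wordFiltration j n := by
  induction n generalizing a with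
  | zero =>
    obtain ⟨r, rfl⟩ : ∃ r : ℝ, algebraMap ℝ A r = a := by
      simpa [wordFiltration, Submodule.mem_one] using ha
    simp [Algebra.algebraMap_eq_smul_one, h1]
  | succ n ih =>
    change a ∈ (1 ⊔ LinearMap.range j) ^ (n + 1) at ha
    rw [pow_succ'] at ha
    induction ha using Submodule.mul_induction_on' with
    | mem_mul_mem v hv b hb =>
      obtain ⟨hb1, hb2⟩ := ih hb
      rw [Submodule.mem_sup] at hv
      obtain ⟨_, hr, _, ⟨ξ, rfl⟩, rfl⟩ := hv
      obtain ⟨r, rfl⟩ := Submodule.mem_one.1 hr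
      have hr1 : algebraMap ℝ A r * b = r • b := (Algebra.smul_def r b).symm
      simp only [add_mul, hr1, map_add, map_smul, hD]
      refine ⟨fun x => add_mem (Submodule.smul_mem _ _ (wordFiltration_le_succ j n (hb1 x)))
        (add_mem (Submodule.smul_mem _ _ hb) (Submodule.smul_mem _ _
          (mul_mem_wordFiltration j ξ (hb1 x)))), ?_⟩
      have hsum : ∑ i, j (e.coord i) * (r • D (e i) b + (ξ (e i) • b + s • (j ξ * D (e i) b))) =
          r • ∑ i, j (e.coord i) * D (e i) b + j ξ * b +
            j ξ * ∑ i, j (e.coord i) * D (e i) b := by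
        have hξ : j ξ = ∑ i, ξ (e i) • j (e.coord i) := by
          conv_lhs => rw [← e.sum_dual_apply_smul_coord ξ]
          rw [map_sum]
          simp only [map_smul]
        have h3 : ∀ i, j (e.coord i) * (s • (j ξ * D (e i) b)) =
            j ξ * (j (e.coord i) * D (e i) b) := by
          intro i
          rw [mul_smul_comm, ← mul_assoc, hj, smul_mul_assoc, smul_smul, hs, one_smul, mul_assoc]
        simp only [mul_add, h3, Finset.sum_add_distrib, mul_smul_comm, ← Finset.smul_sum,
          ← Finset.mul_sum]
        conv_rhs => rw [hξ]
        simp only [Finset.sum_mul, smul_mul_assoc, Finset.mul_sum, add_assoc]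
        congr 2
        rw [hξ]
        simp only [Finset.sum_mul, smul_mul_assoc]
      rw [hsum]
      have e1 : ((n + 1 : ℕ) : ℝ) • (r • b + j ξ * b) - (r • ∑ i, j (e.coord i) * D (e i) b +
          j ξ * b + j ξ * ∑ i, j (e.coord i) * D (e i) b) =
          r • b + r • ((n : ℝ) • b - ∑ i, j (e.coord i) * D (e i) b) +
            j ξ * ((n : ℝ) • b - ∑ i, j (e.coord i) * D (e i) b) := by
        simp only [Nat.cast_add, Nat.cast_one, add_smul, one_smul, smul_add, smul_sub, mul_sub,
          mul_smul_comm, smul_comm (n : ℝ) r]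
        abel
      rw [e1]
      exact add_mem (add_mem (Submodule.smul_mem _ _ hb) (Submodule.smul_mem _ _
        (wordFiltration_le_succ j n hb2))) (mul_mem_wordFiltration j ξ hb2)
    | add b _ c _ hb hc =>
      refine ⟨fun x => by rw [map_add]; exact add_mem (hb.1 x) (hc.1 x), ?_⟩
      have := add_mem hb.2 hc.2
      simp only [map_add, mul_add, Finset.sum_add_distrib, smul_add]
      convert this using 1
      abel

/-- An element all of whose iterated contractions have vanishing scalar part is zero. -/
theorem eq_zero_of_iterContr [FiniteDimensional ℝ V] (ε : A →ₐ[ℝ] ℝ) (h1 : ∀ x, D x 1 = 0)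
    (hD : ∀ x ξ a, D x (j ξ * a) = ξ x • a + s • (j ξ * D x a))
    (hs : s * s = 1) (hj : ∀ ξ η, j ξ * j η = s • (j η * j ξ))
    (hgen : Algebra.adjoin ℝ (Set.range j) = ⊤)
    (a : A) (h : ∀ l, ε (iterContr D l a) = 0) : a = 0 := by
  have key : ∀ n, ∀ a ∈ wordFiltration j n, (∀ l, ε (iterContr D l a) = 0) → a = 0 := by
    intro n
    induction n with
    | zero => intro a ha _; exact (Submodule.mem_bot ℝ).1 ha
    | succ n ih =>
      intro a ha h
      obtain ⟨h2, h3⟩ := euler_wordFiltration (Module.finBasis ℝ V) h1 hD hs hj n ha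
      have h4 : ∀ x, D x a = 0 := fun x => ih _ (h2 x) fun l => h (x :: l)
      cases n with
      | zero =>
        obtain ⟨r, rfl⟩ : ∃ r : ℝ, algebraMap ℝ A r = a := by
          simpa [wordFiltration, Submodule.mem_one] using ha
        have := h []
        simp only [iterContr, LinearMap.id_apply, AlgHom.commutes] at this
        simp_all
      | succ n =>
        simp only [h4, mul_zero, Finset.sum_const_zero, sub_zero] at h3
        refine ih a ?_ h
        have h5 := Submodule.smul_mem _ ((n + 1 : ℕ) : ℝ)⁻¹ h3
        rwa [smul_smul, inv_mul_cancel₀ (by positivity), one_smul] at h5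
  have hex : ∃ n, a ∈ wordFiltration j n := by
    have ha : a ∈ Algebra.adjoin ℝ (Set.range j) := by rw [hgen]; trivial
    clear h
    have : ∃ n, a ∈ (1 ⊔ LinearMap.range j) ^ n := by
      induction ha using Algebra.adjoin_induction with
      | mem x hx => exact ⟨1, by rw [pow_one]; exact Submodule.mem_sup_right (by simpa using hx)⟩
      | algebraMap r => exact ⟨0, by rw [pow_zero]; exact Submodule.mem_one.2 ⟨r, rfl⟩⟩
      | add x y _ _ hx hy =>
        obtain ⟨m, hm⟩ := hx
        obtain ⟨n, hn⟩ := hy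
        have h1 : (1 : Submodule ℝ A) ≤ 1 ⊔ LinearMap.range j := le_sup_left
        exact ⟨max m n, add_mem (SetLike.le_def.1 (pow_le_pow_right' h1 (le_max_left m n)) hm)
          (SetLike.le_def.1 (pow_le_pow_right' h1 (le_max_right m n)) hn)⟩
      | mul x y _ _ hx hy =>
        obtain ⟨m, hm⟩ := hx
        obtain ⟨n, hn⟩ := hy
        exact ⟨m + n, by rw [pow_add]; exact Submodule.mul_mem_mul hm hn⟩
    obtain ⟨n, hn⟩ := this
    exact ⟨n + 1, hn⟩
  obtain ⟨n, hn⟩ := hex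
  exact key n a hn h

end Euler

end Contractions

/-! ### Contractions of the symmetric and the exterior algebra -/

section SymmetricContraction

variable {V : Type*} [AddCommGroup V] [Module ℝ V]

/-- The derivation of `S V*` with `ξ ↦ ξ(x)`. -/
def symContr (x : V) : SymmetricAlgebra ℝ (Module.Dual ℝ V) →ₗ[ℝ]
    SymmetricAlgebra ℝ (Module.Dual ℝ V) :=
  (TrivSqZeroExt.sndHom (SymmetricAlgebra ℝ (Module.Dual ℝ V))
      (SymmetricAlgebra ℝ (Module.Dual ℝ V))).restrictScalars ℝ ∘ₗ
    (SymmetricAlgebra.lift (A := DualNumber (SymmetricAlgebra ℝ (Module.Dual ℝ V)))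
      (TrivSqZeroExt.inlAlgHom ℝ (SymmetricAlgebra ℝ (Module.Dual ℝ V))
          (SymmetricAlgebra ℝ (Module.Dual ℝ V)) ∘ₗ SymmetricAlgebra.ι ℝ (Module.Dual ℝ V) +
        (Module.Dual.eval ℝ V x).smulRight
          (TrivSqZeroExt.inr (1 : SymmetricAlgebra ℝ (Module.Dual ℝ V))))).toLinearMap

theorem symContr_one (x : V) : symContr x 1 = 0 := by
  simp [symContr]

theorem symContr_ι (x : V) (ξ : Module.Dual ℝ V) :
    symContr x (SymmetricAlgebra.ι ℝ _ ξ) = algebraMap ℝ _ (ξ x) := by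
  simp [symContr, Algebra.algebraMap_eq_smul_one]

theorem symContr_mul (x : V) (a b : SymmetricAlgebra ℝ (Module.Dual ℝ V)) :
    symContr x (a * b) = symContr x a * b + a * symContr x b := by
  set F := SymmetricAlgebra.lift (A := DualNumber (SymmetricAlgebra ℝ (Module.Dual ℝ V)))
      (TrivSqZeroExt.inlAlgHom ℝ (SymmetricAlgebra ℝ (Module.Dual ℝ V))
          (SymmetricAlgebra ℝ (Module.Dual ℝ V)) ∘ₗ SymmetricAlgebra.ι ℝ (Module.Dual ℝ V) +
        (Module.Dual.eval ℝ V x).smulRight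
          (TrivSqZeroExt.inr (1 : SymmetricAlgebra ℝ (Module.Dual ℝ V)))) with hF
  have hfst : ∀ c, (F c).fst = c := by
    have : (TrivSqZeroExt.fstHom ℝ (SymmetricAlgebra ℝ (Module.Dual ℝ V))
        (SymmetricAlgebra ℝ (Module.Dual ℝ V))).comp F = AlgHom.id ℝ _ := by
      refine SymmetricAlgebra.algHom_ext ?_
      ext ξ
      simp [hF]
    exact fun c => DFunLike.congr_fun this c
  change (F (a * b)).snd = (F a).snd * b + a * (F b).snd
  rw [map_mul, DualNumber.snd_mul, hfst, hfst]
  ring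

theorem symContr_ι_mul (x : V) (ξ : Module.Dual ℝ V)
    (a : SymmetricAlgebra ℝ (Module.Dual ℝ V)) :
    symContr x (SymmetricAlgebra.ι ℝ _ ξ * a) =
      ξ x • a + (1 : ℝ) • (SymmetricAlgebra.ι ℝ _ ξ * symContr x a) := by
  rw [symContr_mul, symContr_ι, ← Algebra.smul_def, one_smul]

/-- A polynomial is determined by its iterated derivatives at the origin. -/
theorem symmetricAlgebra_eq_zero [FiniteDimensional ℝ V]
    (a : SymmetricAlgebra ℝ (Module.Dual ℝ V))
    (h : ∀ l : List V, SymmetricAlgebra.algebraMapInv (iterContr symContr l a) = 0) : a = 0 := by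
  refine eq_zero_of_iterContr (j := SymmetricAlgebra.ι ℝ (Module.Dual ℝ V)) (s := 1)
    SymmetricAlgebra.algebraMapInv symContr_one symContr_ι_mul (by norm_num)
    (fun ξ η => by rw [one_smul, mul_comm]) ?_ a h
  refine eq_top_iff.2 fun b hb => ?_
  clear hb
  induction b using SymmetricAlgebra.induction with
  | algebraMap r => exact Subalgebra.algebraMap_mem _ r
  | ι ξ => exact Algebra.subset_adjoin ⟨ξ, rfl⟩
  | mul a b ha hb => exact mul_mem ha hb
  | add a b ha hb => exact add_mem ha hb

/-- The contraction of the exterior algebra with a vector. -/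
def extContr (x : V) : ExteriorAlgebra ℝ (Module.Dual ℝ V) →ₗ[ℝ]
    ExteriorAlgebra ℝ (Module.Dual ℝ V) :=
  CliffordAlgebra.contractLeft (Q := (0 : QuadraticForm ℝ (Module.Dual ℝ V)))
    (Module.Dual.eval ℝ V x)

theorem exteriorAlgebra_eq_zero [FiniteDimensional ℝ V]
    (a : ExteriorAlgebra ℝ (Module.Dual ℝ V))
    (h : ∀ l : List V, ExteriorAlgebra.algebraMapInv (iterContr extContr l a) = 0) : a = 0 := by
  refine eq_zero_of_iterContr (j := ExteriorAlgebra.ι ℝ (M := Module.Dual ℝ V)) (s := -1)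
    ExteriorAlgebra.algebraMapInv (D := extContr) ?_ ?_ (by norm_num) ?_ ?_ a h
  · exact fun x => CliffordAlgebra.contractLeft_one _ (Module.Dual.eval ℝ V x)
  · intro x ξ b
    have := CliffordAlgebra.contractLeft_ι_mul (Q := (0 : QuadraticForm ℝ (Module.Dual ℝ V)))
      (d := Module.Dual.eval ℝ V x) ξ b
    rw [neg_one_smul, ← sub_eq_add_neg]
    exact this
  · intro ξ η
    have := ExteriorAlgebra.ι_add_mul_swap (R := ℝ) ξ η
    rw [neg_one_smul]
    exact eq_neg_of_add_eq_zero_left this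
  · refine eq_top_iff.2 fun b hb => ?_
    clear hb
    induction b using ExteriorAlgebra.induction with
    | algebraMap r => exact Subalgebra.algebraMap_mem _ r
    | ι ξ => exact Algebra.subset_adjoin ⟨ξ, rfl⟩
    | mul a b ha hb => exact mul_mem ha hb
    | add a b ha hb => exact add_mem ha hb

/-- If two families of functionals separate the points of two spaces, their tensor products
separate the points of the tensor product. -/
theorem tensor_eq_zero_of_separating {M N : Type*} [AddCommGroup M] [Module ℝ M] [AddCommGroup N]
    [Module ℝ N] {J K : Type*} (φ : J → M →ₗ[ℝ] ℝ) (ψ : K → N →ₗ[ℝ] ℝ)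
    (hφ : ∀ m, (∀ j, φ j m = 0) → m = 0) (hψ : ∀ n, (∀ k, ψ k n = 0) → n = 0) (t : M ⊗[ℝ] N)
    (h : ∀ j k, LinearMap.mul' ℝ ℝ (TensorProduct.map (φ j) (ψ k) t) = 0) : t = 0 := by
  classical
  have h1 : ∀ (lam : M →ₗ[ℝ] ℝ) (mu : N →ₗ[ℝ] ℝ),
      LinearMap.mul' ℝ ℝ (TensorProduct.map lam mu t) =
        lam (TensorProduct.rid ℝ M (TensorProduct.map LinearMap.id mu t)) := by
    intro lam mu
    have : LinearMap.mul' ℝ ℝ ∘ₗ TensorProduct.map lam mu =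
        lam ∘ₗ (TensorProduct.rid ℝ M).toLinearMap ∘ₗ TensorProduct.map LinearMap.id mu :=
      TensorProduct.ext' fun x y => by simp [mul_comm]
    exact DFunLike.congr_fun this t
  have h2 : ∀ (lam : M →ₗ[ℝ] ℝ) (mu : N →ₗ[ℝ] ℝ),
      LinearMap.mul' ℝ ℝ (TensorProduct.map lam mu t) =
        mu (TensorProduct.lid ℝ N (TensorProduct.map lam LinearMap.id t)) := by
    intro lam mu
    have : LinearMap.mul' ℝ ℝ ∘ₗ TensorProduct.map lam mu =
        mu ∘ₗ (TensorProduct.lid ℝ N).toLinearMap ∘ₗ TensorProduct.map lam LinearMap.id :=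
      TensorProduct.ext' fun x y => by simp
    exact DFunLike.congr_fun this t
  have h3 : ∀ k, TensorProduct.rid ℝ M (TensorProduct.map LinearMap.id (ψ k) t) = 0 :=
    fun k => hφ _ fun j => by rw [← h1, h]
  have h4 : ∀ lam : M →ₗ[ℝ] ℝ,
      TensorProduct.lid ℝ N (TensorProduct.map lam LinearMap.id t) = 0 :=
    fun lam => hψ _ fun k => by rw [← h2, h1, h3, map_zero]
  let b := Module.Basis.ofVectorSpace ℝ M
  have h5 : ∀ i, TensorProduct.equivFinsuppOfBasisLeft (N := N) b t i =
      TensorProduct.lid ℝ N (TensorProduct.map (b.coord i) LinearMap.id t) := by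
    intro i
    have : Finsupp.lapply i ∘ₗ (TensorProduct.equivFinsuppOfBasisLeft (N := N) b).toLinearMap =
        (TensorProduct.lid ℝ N).toLinearMap ∘ₗ TensorProduct.map (b.coord i) LinearMap.id :=
      TensorProduct.ext' fun x y => by simp
    exact DFunLike.congr_fun this t
  refine (TensorProduct.equivFinsuppOfBasisLeft (N := N) b).map_eq_zero_iff.1 ?_
  ext i
  rw [h5, h4]
  rfl

end SymmetricContraction

/-! ### Evaluation of polynomials and of elements of the Weil algebra -/

section SymmetricEvaluation

variable {V : Type*} [AddCommGroup V] [Module ℝ V]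

/-- The value at the origin of the iterated derivative of a polynomial along a list of vectors. -/
def symEval (l : List V) : SymmetricAlgebra ℝ (Module.Dual ℝ V) →ₗ[ℝ] ℝ :=
  SymmetricAlgebra.algebraMapInv.toLinearMap ∘ₗ iterContr symContr l

theorem symEval_nil (a : SymmetricAlgebra ℝ (Module.Dual ℝ V)) :
    symEval [] a = SymmetricAlgebra.algebraMapInv a := rfl

theorem symEval_cons (x : V) (l : List V) (a : SymmetricAlgebra ℝ (Module.Dual ℝ V)) :
    symEval (x :: l) a = symEval l (symContr x a) := rfl

theorem symContr_prod {J : Type*} [DecidableEq J] (x : V) (s : Finset J)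
    (ξ : J → Module.Dual ℝ V) :
    symContr x (∏ i ∈ s, SymmetricAlgebra.ι ℝ _ (ξ i)) =
      ∑ k ∈ s, ξ k x • ∏ i ∈ s.erase k, SymmetricAlgebra.ι ℝ _ (ξ i) := by
  induction s using Finset.induction_on with
  | empty => simpa using symContr_one x
  | insert j s hj ih =>
    rw [Finset.prod_insert hj, symContr_ι_mul, ih, Finset.sum_insert hj, Finset.erase_insert hj,
      one_smul, Finset.mul_sum]
    congr 1
    refine Finset.sum_congr rfl fun k hk => ?_
    have hjk : j ≠ k := fun h => hj (h ▸ hk)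
    rw [Finset.erase_insert_of_ne hjk, Finset.prod_insert (by simp [hj]), mul_smul_comm]

theorem prod_erase_eq_prod_swap {M : Type*} [CommMonoid M] {n : ℕ} (k : Fin (n + 1))
    (f : Fin (n + 1) → M) :
    ∏ i ∈ Finset.univ.erase k, f i = ∏ i : Fin n, f (Equiv.swap 0 k i.succ) := by
  have : Finset.univ.erase k =
      (Finset.univ : Finset (Fin n)).map ((Fin.succEmb n).trans (Equiv.swap 0 k).toEmbedding) := by
    ext i
    simp only [Finset.mem_erase, Finset.mem_univ, and_true, Finset.mem_map, true_and,
      Function.Embedding.trans_apply, Fin.coe_succEmb, Equiv.coe_toEmbedding]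
    constructor
    · intro h
      have h0 : Equiv.swap 0 k i ≠ 0 := by
        intro h'
        apply h
        have := congrArg (Equiv.swap 0 k) h'
        simpa using this
      obtain ⟨j, hj⟩ := Fin.exists_succ_eq.2 h0
      exact ⟨j, by rw [hj, Equiv.swap_apply_self]⟩
    · rintro ⟨j, rfl⟩ h'
      have := congrArg (Equiv.swap 0 k) h'
      simp [Fin.succ_ne_zero] at this
  rw [this, Finset.prod_map]
  rfl

theorem symContr_prod_fin {n : ℕ} (x : V) (ξ : Fin (n + 1) → Module.Dual ℝ V) :
    symContr x (∏ i, SymmetricAlgebra.ι ℝ _ (ξ i)) =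
      ∑ k, ξ k x • ∏ i : Fin n, SymmetricAlgebra.ι ℝ _ (ξ (Equiv.swap 0 k i.succ)) := by
  rw [symContr_prod]
  refine Finset.sum_congr rfl fun k _ => ?_
  rw [prod_erase_eq_prod_swap k]

theorem algebraMapInv_prod_ι {n : ℕ} (ξ : Fin (n + 1) → Module.Dual ℝ V) :
    SymmetricAlgebra.algebraMapInv (∏ i, SymmetricAlgebra.ι ℝ _ (ξ i)) = (0 : ℝ) := by
  rw [map_prod]
  exact Finset.prod_eq_zero (Finset.mem_univ 0) (by simp [SymmetricAlgebra.algebraMapInv])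

/-- The iterated derivative of a product of as many linear forms is a permanent. -/
theorem symEval_ofFn_prod {n : ℕ} (x : Fin n → V) (ξ : Fin n → Module.Dual ℝ V) :
    symEval (List.ofFn x) (∏ i, SymmetricAlgebra.ι ℝ _ (ξ i)) =
      ∑ σ : Equiv.Perm (Fin n), ∏ j, ξ (σ j) (x j) := by
  induction n with
  | zero => simp [symEval_nil]
  | succ n ih =>
    rw [List.ofFn_succ, symEval_cons, symContr_prod_fin, map_sum,
      ← Equiv.sum_comp Equiv.Perm.decomposeFin.symm, Fintype.sum_prod_type]
    refine Finset.sum_congr rfl fun k _ => ?_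
    rw [map_smul, ih, smul_eq_mul, Finset.mul_sum]
    refine Finset.sum_congr rfl fun e _ => ?_
    rw [Fin.prod_univ_succ]
    simp

theorem symEval_prod_of_length_ne {n : ℕ} (l : List V) (ξ : Fin n → Module.Dual ℝ V)
    (h : l.length ≠ n) : symEval l (∏ i, SymmetricAlgebra.ι ℝ _ (ξ i)) = 0 := by
  induction l generalizing n with
  | nil =>
    cases n with
    | zero => exact absurd rfl h
    | succ n => exact algebraMapInv_prod_ι ξ
  | cons x l ih =>
    rw [symEval_cons]
    cases n with
    | zero => rw [Fin.prod_univ_zero, symContr_one, map_zero]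
    | succ n =>
      rw [symContr_prod_fin, map_sum]
      refine Finset.sum_eq_zero fun k _ => ?_
      rw [map_smul, ih _ (by simpa using h), smul_zero]

variable [FiniteDimensional ℝ V]

/-- The polynomial whose iterated derivatives are the values of the symmetrisation
(without normalisation) of a multilinear form. -/
def polyOfMulti {q : ℕ} (g : MultilinearMap ℝ (fun _ : Fin q => V) ℝ) :
    SymmetricAlgebra ℝ (Module.Dual ℝ V) :=
  ∑ a : Fin q → Fin (Module.finrank ℝ V), g (fun i => Module.finBasis ℝ V (a i)) •
    ∏ i, SymmetricAlgebra.ι ℝ _ ((Module.finBasis ℝ V).coord (a i))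

theorem symEval_polyOfMulti {q : ℕ} (g : MultilinearMap ℝ (fun _ : Fin q => V) ℝ)
    (x : Fin q → V) :
    symEval (List.ofFn x) (polyOfMulti g) = ∑ σ : Equiv.Perm (Fin q), g (fun i => x (σ i)) := by
  set e := Module.finBasis ℝ V with he
  have hg : ∀ y : Fin q → V, g y = ∑ a : Fin q → Fin (Module.finrank ℝ V),
      g (fun i => e (a i)) * ∏ i, e.coord (a i) (y i) := by
    intro y
    conv_lhs => rw [show y = fun i => ∑ k, e.coord k (y i) • e k from
      funext fun i => (e.sum_repr (y i)).symm]
    rw [MultilinearMap.map_sum]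
    refine Finset.sum_congr rfl fun a _ => ?_
    rw [MultilinearMap.map_smul_univ, smul_eq_mul, mul_comm]
  rw [polyOfMulti, map_sum]
  simp only [map_smul, symEval_ofFn_prod, smul_eq_mul, Finset.mul_sum]
  rw [Finset.sum_comm, ← Equiv.sum_comp (Equiv.inv (Equiv.Perm (Fin q)))]
  refine Finset.sum_congr rfl fun σ _ => ?_
  rw [hg]
  refine Finset.sum_congr rfl fun a _ => ?_
  rw [← Equiv.prod_comp σ]
  simp [he]

theorem symEval_polyOfMulti_of_length_ne {q : ℕ} (g : MultilinearMap ℝ (fun _ : Fin q => V) ℝ)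
    (l : List V) (h : l.length ≠ q) : symEval l (polyOfMulti g) = 0 := by
  rw [polyOfMulti, map_sum]
  exact Finset.sum_eq_zero fun a _ => by
    rw [map_smul, symEval_prod_of_length_ne l _ h, smul_zero]

end SymmetricEvaluation

section WeilEvaluation

variable {E : Type*} [NormedAddCommGroup E] [NormedSpace ℝ E] [FiniteDimensional ℝ E]
  {G : Type*} [TopologicalSpace G] [ChartedSpace E G] [Group G] [LieGroup 𝓘(ℝ, E) ∞ G]

/-- The counterpart of `symEval` for the exterior algebra. -/
def extEval {V : Type*} [AddCommGroup V] [Module ℝ V] (l : List V) :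
    ExteriorAlgebra ℝ (Module.Dual ℝ V) →ₗ[ℝ] ℝ :=
  ExteriorAlgebra.algebraMapInv.toLinearMap ∘ₗ iterContr extContr l

theorem iSym_eq (x : LieAlg E G) : iSym E x = TensorProduct.map LinearMap.id (symContr x) := rfl

theorem iExt_eq (x : LieAlg E G) : iExt E x = TensorProduct.map (extContr x) LinearMap.id := rfl

theorem iterContr_iSym (l : List (LieAlg E G)) :
    iterContr (iSym E (G := G)) l = TensorProduct.map LinearMap.id (iterContr symContr l) := by
  induction l with
  | nil => exact TensorProduct.map_id.symm
  | cons x l ih =>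
    rw [iterContr, ih, iSym_eq, ← TensorProduct.map_comp]
    rfl

theorem iterContr_iExt (l : List (LieAlg E G)) :
    iterContr (iExt E (G := G)) l = TensorProduct.map (iterContr extContr l) LinearMap.id := by
  induction l with
  | nil => exact TensorProduct.map_id.symm
  | cons x l ih =>
    rw [iterContr, ih, iExt_eq, ← TensorProduct.map_comp]
    rfl

theorem weilEval_eq {q r : ℕ} (ξ : WeilAlg E G) (x : Fin (q + r) → LieAlg E G) :
    weilEval E ξ x = LinearMap.mul' ℝ ℝ (TensorProduct.map
      (extEval (List.ofFn fun j => x (Fin.natAdd q j)))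
      (symEval (List.ofFn fun k => x (Fin.castAdd r k))) ξ) := by
  have h1 : ∀ ζ : WeilAlg E G, (List.finRange r).foldl (fun ζ j => iExt E (x (Fin.natAdd q j)) ζ) ζ
      = iterContr (iExt E) (List.ofFn fun j => x (Fin.natAdd q j)) ζ := by
    intro ζ
    rw [← foldl_eq_iterContr, List.ofFn_eq_map, List.foldl_map]
  have h2 : ∀ ζ : WeilAlg E G, (List.finRange q).foldl (fun ζ k => iSym E (x (Fin.castAdd r k)) ζ) ζ
      = iterContr (iSym E) (List.ofFn fun k => x (Fin.castAdd r k)) ζ := by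
    intro ζ
    rw [← foldl_eq_iterContr, List.ofFn_eq_map, List.foldl_map]
  rw [weilEval, h1, h2, iterContr_iSym, iterContr_iExt, weilScalar]
  have : TensorProduct.map (extEval (List.ofFn fun j => x (Fin.natAdd q j)))
      (symEval (List.ofFn fun k => x (Fin.castAdd r k))) =
      TensorProduct.map ExteriorAlgebra.algebraMapInv.toLinearMap
        SymmetricAlgebra.algebraMapInv.toLinearMap ∘ₗ
      TensorProduct.map (iterContr extContr (List.ofFn fun j => x (Fin.natAdd q j))) LinearMap.id ∘ₗ
      TensorProduct.map LinearMap.id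
        (iterContr symContr (List.ofFn fun k => x (Fin.castAdd r k))) := by
    rw [← TensorProduct.map_comp, ← TensorProduct.map_comp]
    rfl
  rw [this]
  rfl

/-- An element of the Weil algebra is determined by its contractions. -/
theorem weilAlg_eq_zero (ξ : WeilAlg E G)
    (h : ∀ (q r : ℕ) (x : Fin (q + r) → LieAlg E G), weilEval E ξ x = 0) : ξ = 0 := by
  refine tensor_eq_zero_of_separating (extEval (V := LieAlg E G)) (symEval (V := LieAlg E G))
    exteriorAlgebra_eq_zero symmetricAlgebra_eq_zero ξ fun j k => ?_
  have := h k.length j.length (Fin.append k.get j.get)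
  rw [weilEval_eq] at this
  simpa using this

theorem weilEval_sub {q r : ℕ} (ξ ζ : WeilAlg E G) (x : Fin (q + r) → LieAlg E G) :
    weilEval E (ξ - ζ) x = weilEval E ξ x - weilEval E ζ x := by
  simp only [weilEval_eq, map_sub]

theorem IsVanEst.unique {α : TotBG E G} {ξ ζ : WeilAlg E G} (h : IsVanEst E α ξ)
    (h' : IsVanEst E α ζ) : ξ = ζ :=
  sub_eq_zero.1 (weilAlg_eq_zero _ fun q r x => by rw [weilEval_sub, h q r x, h' q r x, sub_self])

theorem IsVanEst.vanEst_eq {α : TotBG E G} {ξ : WeilAlg E G} (h : IsVanEst E α ξ) :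
    vanEst E α = ξ := by
  have hex : ∃! ξ, IsVanEst E α ξ := ⟨ξ, h, fun ζ hζ => hζ.unique h⟩
  rw [vanEst, dif_pos hex]
  exact hex.choose_spec.1.unique h

theorem weilEval_symToWeil {q r : ℕ} (P : SymDual E G) (x : Fin (q + r) → LieAlg E G) :
    weilEval E (symToWeil E G P) x =
      if r = 0 then symEval (List.ofFn fun k => x (Fin.castAdd r k)) P else 0 := by
  rw [weilEval_eq, symToWeil, TensorProduct.mk_apply, TensorProduct.map_tmul,
    LinearMap.mul'_apply]
  cases r with
  | zero =>
    rw [if_pos rfl, List.ofFn_zero]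
    simp [extEval, iterContr]
  | succ r =>
    have : ∀ y : LieAlg E G, extContr y 1 = 0 := fun y => CliffordAlgebra.contractLeft_one _ _
    simp [List.ofFn_succ, extEval, iterContr, this]

theorem symContr_coadSym (g : G) (x : LieAlg E G) (P : SymDual E G) :
    symContr x (coadSym G g P) = coadSym G g (symContr (lieAd G g x) P) := by
  induction P using SymmetricAlgebra.induction with
  | algebraMap r =>
    simp [Algebra.algebraMap_eq_smul_one, symContr_one]
  | ι ξ =>
    have : coadSym G g (SymmetricAlgebra.ι ℝ _ ξ) =
        SymmetricAlgebra.ι ℝ _ ((lieAd G g).dualMap ξ) := by simp [coadSym]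
    rw [this, symContr_ι, symContr_ι, AlgHom.commutes]
    rfl
  | mul a b ha hb => rw [map_mul, symContr_mul, symContr_mul, ha, hb, map_add, map_mul, map_mul]
  | add a b ha hb => simp only [map_add, ha, hb]

theorem algebraMapInv_coadSym (g : G) (P : SymDual E G) :
    SymmetricAlgebra.algebraMapInv (coadSym G g P) = SymmetricAlgebra.algebraMapInv P := by
  have : (SymmetricAlgebra.algebraMapInv (R := ℝ) (M := LieDual E G)).comp (coadSym G g) =
      SymmetricAlgebra.algebraMapInv := by
    refine SymmetricAlgebra.algHom_ext ?_
    ext ξ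
    simp [coadSym, SymmetricAlgebra.algebraMapInv]
  exact DFunLike.congr_fun this P

theorem symEval_coadSym (g : G) (l : List (LieAlg E G)) (P : SymDual E G) :
    symEval l (coadSym G g P) = symEval (l.map (lieAd G g)) P := by
  induction l generalizing P with
  | nil => exact algebraMapInv_coadSym g P
  | cons x l ih => rw [List.map_cons, symEval_cons, symEval_cons, symContr_coadSym, ih]

theorem symDual_ext {P Q : SymDual E G} (h : ∀ l : List (LieAlg E G), symEval l P = symEval l Q) :
    P = Q :=
  sub_eq_zero.1 (symmetricAlgebra_eq_zero _ fun l => by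
    have : symEval l (P - Q) = 0 := by rw [map_sub, h, sub_self]
    exact this)

end WeilEvaluation

/-! ### The Van Est map on invariant cochains -/

section VanEstInvariant

variable {E : Type*} [NormedAddCommGroup E] [NormedSpace ℝ E] [FiniteDimensional ℝ E]
  {G : Type*} [TopologicalSpace G] [ChartedSpace E G] [Group G] [LieGroup 𝓘(ℝ, E) ∞ G]

/-- Lie derivatives along the generating vector fields of an invariant form vanish: they
differentiate a constant function of the group element. -/
theorem lieD_eq_zero_of_invariant {p q : ℕ} (i : Fin (p + 1)) (x : LieAlg E G)
    {η : PowForm E G p q} (h : ∀ g : Fin (p + 1) → G, powPullback (zetaAct g) η = η) :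
    lieD E i x η = 0 := by
  funext m
  have : (fun g : G => powPullback (gammaAct i g) η m) = fun _ => η m :=
    funext fun g => congrFun (h _) m
  rw [lieD, this, tangentMapAt_const]
  rfl

theorem lieD_zero {p q : ℕ} (i : Fin (p + 1)) (x : LieAlg E G) :
    lieD E i x (0 : PowForm E G p q) = 0 :=
  lieD_eq_zero_of_invariant i x fun _ => map_zero _

theorem foldr_lieD_eq_zero {p q : ℕ} {J : Type*} (i : J → Fin (p + 1)) (x : J → LieAlg E G)
    {l : List J} (hl : l ≠ [])
    {η : PowForm E G p q} (h : ∀ g : Fin (p + 1) → G, powPullback (zetaAct g) η = η) :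
    l.foldr (fun j ψ => lieD E (i j) (x j) ψ) η = 0 := by
  induction l with
  | nil => exact absurd rfl hl
  | cons j l ih =>
    rw [List.foldr_cons]
    by_cases hl' : l = []
    · subst hl'
      exact lieD_eq_zero_of_invariant _ _ h
    · rw [ih hl', lieD_zero]

theorem vanEstSum_eq_zero {q r : ℕ} (hr : r ≠ 0) {η : PowForm E G (q + r) q}
    (h : ∀ g : Fin (q + r + 1) → G, powPullback (zetaAct g) η = η)
    (x : Fin (q + r) → LieAlg E G) : vanEstSum E η x = 0 := by
  rw [vanEstSum]
  refine Finset.sum_eq_zero fun σ _ => ?_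
  rw [foldr_lieD_eq_zero (fun j => (Fin.natAdd q j).succ) (fun j => x (σ (Fin.natAdd q j))) _ h]
  · simp
  · simp [hr]

theorem vanEstSum_zero_right {q : ℕ} (η : PowForm E G q q) (x : Fin q → LieAlg E G) :
    vanEstSum E (r := 0) η x = ∑ σ : Equiv.Perm (Fin q),
      η 1 fun k => genField E k.rev.succ (x (σ k.rev)) 1 := by
  rw [vanEstSum]
  refine Finset.sum_congr rfl fun σ _ => ?_
  simp [vanEstSign]

/-- The multilinear form on `𝔤` whose symmetrisation is the Van Est image of `η ∈ Ω^q(BG_q)`. -/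
def vanEstMulti {q : ℕ} (η : PowForm E G q q) :
    MultilinearMap ℝ (fun _ : Fin q => LieAlg E G) ℝ :=
  ((η 1).toMultilinearMap.domDomCongr Fin.revPerm).compLinearMap fun i =>
    (tangentMapAt 𝓘(ℝ, E) (powModel E q) (fun g : G => gammaAct i.succ g (1 : Fin q → G)) 1 :
      E →L[ℝ] (Fin q → E)).toLinearMap

theorem vanEstMulti_apply {q : ℕ} (η : PowForm E G q q) (x : Fin q → LieAlg E G) :
    vanEstMulti η x = η 1 fun k => genField E k.rev.succ (x k.rev) 1 := rfl

/-- The Van Est equations of an invariant cochain have a solution in `S 𝔤*`, with components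
obtained from the multilinear forms `vanEstMulti`. -/
theorem exists_isVanEst {α : TotBG E G} (hα : IsInvTot E G α) :
    ∃ P : SymDual E G, IsVanEst E α (symToWeil E G P) ∧
      ∀ (q : ℕ) (x : Fin q → LieAlg E G), symEval (List.ofFn x) P =
        ∑ σ : Equiv.Perm (Fin q), vanEstMulti (α (q, q)) fun i => x (σ i) := by
  classical
  set s : Finset ℕ := (DFinsupp.support α).image Prod.fst with hs
  have key : ∀ (q : ℕ) (x : Fin q → LieAlg E G),
      symEval (List.ofFn x) (∑ n ∈ s, polyOfMulti (vanEstMulti (α (n, n)))) =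
        ∑ σ : Equiv.Perm (Fin q), vanEstMulti (α (q, q)) fun i => x (σ i) := by
    intro q x
    rw [map_sum]
    by_cases hq : q ∈ s
    · rw [Finset.sum_eq_single q, symEval_polyOfMulti]
      · intro n _ hn
        exact symEval_polyOfMulti_of_length_ne _ _ (by simpa using hn.symm)
      · exact fun h => absurd hq h
    · have h0 : α (q, q) = 0 := by
        by_contra h
        exact hq (Finset.mem_image.2 ⟨(q, q), DFinsupp.mem_support_iff.2 h, rfl⟩)
      rw [Finset.sum_eq_zero, h0, Finset.sum_eq_zero]
      · intro σ _; rfl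
      · intro n hn
        exact symEval_polyOfMulti_of_length_ne _ _ (by
          rw [List.length_ofFn]; rintro rfl; exact hq hn)
  refine ⟨_, ?_, key⟩
  intro q r x
  rw [weilEval_symToWeil]
  cases r with
  | zero =>
    rw [if_pos rfl]
    refine (key q x).trans ?_
    exact (vanEstSum_zero_right (α (q, q)) x).symm
  | succ r =>
    rw [if_neg (Nat.succ_ne_zero r), vanEstSum_eq_zero (Nat.succ_ne_zero r) (hα (q + (r + 1), q)).2]

/-- The diagonal action `ζ(h, …, h)` fixes the unit of `BG_p` and acts on the generating vectors
there by `Ad_h`. -/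
theorem genField_zetaAct_const {p : ℕ} (h : G) (i : Fin (p + 1)) (x : LieAlg E G) :
    tangentMapAt (powModel E p) (powModel E p) (zetaAct fun _ : Fin (p + 1) => h) 1
        (genField E i x 1) =
      genField E i (lieAd G h x) 1 := by
  have e : zetaAct (fun _ => h) ∘ (fun g : G => gammaAct i g (1 : Fin p → G)) =
      (fun g : G => gammaAct i g (1 : Fin p → G)) ∘ fun k : G => h * k * h⁻¹ := by
    funext g j
    have hs : ∀ a : Fin (p + 1), (Pi.mulSingle i (h * g * h⁻¹) : Fin (p + 1) → G) a =
        h * (Pi.mulSingle i g : Fin (p + 1) → G) a * h⁻¹ := by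
      intro a
      by_cases ha : a = i
      · subst ha; simp
      · simp [Pi.mulSingle_eq_of_ne ha]
    simp only [Function.comp_apply, zetaAct, gammaAct, hs, Pi.one_apply]
    group
  have h1 : gammaAct i (1 : G) (1 : Fin p → G) = 1 := by
    funext j
    simp [gammaAct, zetaAct]
  have h2 : h * 1 * h⁻¹ = 1 := by group
  have e1 := tangentMapAt_comp_apply (I := 𝓘(ℝ, E)) (I' := powModel E p) (I'' := powModel E p)
    (1 : G) ((contMDiff_zetaAct (E := E) fun _ : Fin (p + 1) => h).mdifferentiableAt (by simp))
    ((contMDiff_gammaAct_apply (E := E) i (1 : Fin p → G)).mdifferentiableAt (by simp)) x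
  have e2 := tangentMapAt_comp_apply (I := 𝓘(ℝ, E)) (I' := 𝓘(ℝ, E)) (I'' := powModel E p)
    (1 : G) ((contMDiff_gammaAct_apply (E := E) i (1 : Fin p → G)).mdifferentiableAt (by simp))
    ((contMDiff_conj (E := E) h).mdifferentiableAt (by simp)) x
  have e' : (fun g : G => zetaAct (fun _ => h) (gammaAct i g (1 : Fin p → G))) =
      fun k : G => gammaAct i (h * k * h⁻¹) (1 : Fin p → G) := e
  rw [e'] at e1
  rw [e1] at e2
  simp only [h1, h2] at e2
  exact e2

theorem vanEstMulti_lieAd {q : ℕ} {η : PowForm E G q q}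
    (hη : ∀ g : Fin (q + 1) → G, powPullback (zetaAct g) η = η) (h : G)
    (x : Fin q → LieAlg E G) :
    vanEstMulti η (fun i => lieAd G h (x i)) = vanEstMulti η x := by
  rw [vanEstMulti_apply, vanEstMulti_apply]
  have h1 : zetaAct (fun _ : Fin (q + 1) => h) 1 = 1 := by
    funext j
    simp [zetaAct]
  conv_rhs => rw [← hη fun _ => h, powPullback_apply]
  rw [h1]
  congr 1
  funext k
  exact (genField_zetaAct_const h k.rev.succ (x k.rev)).symm

/-- The Van Est map of an invariant cochain is well defined and an invariant polynomial. -/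
theorem existsUnique_isVanEst {α : TotBG E G} (hα : IsInvTot E G α) :
    (∃! ξ, IsVanEst E α ξ) ∧ ∃ Q ∈ invPoly E G, vanEst E α = symToWeil E G Q := by
  obtain ⟨P, hP, hev⟩ := exists_isVanEst hα
  refine ⟨⟨_, hP, fun ζ hζ => hζ.unique hP⟩, P, fun g => ?_, hP.vanEst_eq⟩
  refine symDual_ext fun l => ?_
  rw [symEval_coadSym]
  obtain ⟨n, x, rfl⟩ : ∃ (n : ℕ) (x : Fin n → LieAlg E G), l = List.ofFn x :=
    ⟨l.length, l.get, (List.ofFn_get l).symm⟩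
  rw [List.map_ofFn, hev, hev]
  exact Finset.sum_congr rfl fun σ _ => vanEstMulti_lieAd (hα (n, n)).2 g fun i => x (σ i)

end VanEstInvariant

/-! ### The diagonal part of the characteristic homomorphism -/

section WedgeEvaluation

variable {F : Type*} [NormedAddCommGroup F] [NormedSpace ℝ F]

theorem ContinuousAlternatingMap.apply_comp_perm {n : ℕ} (β : F [⋀^Fin n]→L[ℝ] ℝ) (v : Fin n → F)
    (σ : Equiv.Perm (Fin n)) : β (v ∘ σ) = (Equiv.Perm.sign σ : ℤ) * β v := by
  have := AlternatingMap.map_perm β.toAlternatingMap v σ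
  rw [Units.smul_def, zsmul_eq_mul] at this
  exact this

/-- An antisymmetrised sum reduces to the permutations that fix `0`, as these are the only ones for
which the first factor does not vanish. -/
theorem sum_perm_eq_of_forall_ne_zero {n : ℕ} (α : F → ℝ) (β : F [⋀^Fin n]→L[ℝ] ℝ)
    (u : Fin (n + 1) → F) (h : ∀ k, k ≠ 0 → α (u k) = 0) :
    ∑ σ : Equiv.Perm (Fin (n + 1)), ((Equiv.Perm.sign σ : ℤ) : ℝ) *
      (α (u (σ 0)) * β fun i => u (σ i.succ)) =
      n.factorial * (α (u 0) * β fun i => u i.succ) := by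
  rw [← Equiv.sum_comp Equiv.Perm.decomposeFin.symm, Fintype.sum_prod_type,
    Finset.sum_eq_single 0 _ (by simp)]
  · have h1 : ∀ e : Equiv.Perm (Fin n),
        (((Equiv.Perm.sign (Equiv.Perm.decomposeFin.symm (0, e)) : ℤ) : ℝ) *
          (α (u (Equiv.Perm.decomposeFin.symm (0, e) 0)) *
            β fun i => u (Equiv.Perm.decomposeFin.symm (0, e) i.succ))) =
          α (u 0) * β fun i => u i.succ := by
      intro e
      have h2 : (fun i : Fin n => u (Equiv.Perm.decomposeFin.symm (0, e) i.succ)) =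
          (fun i : Fin n => u i.succ) ∘ e := by
        funext i
        simp
      rw [h2, ContinuousAlternatingMap.apply_comp_perm, Equiv.Perm.decomposeFin.symm_sign,
        Equiv.Perm.decomposeFin_symm_apply_zero, if_pos rfl, one_mul]
      rcases Int.units_eq_one_or (Equiv.Perm.sign e) with h3 | h3 <;> simp [h3]
    rw [Finset.sum_congr rfl fun e _ => h1 e, Finset.sum_const, Finset.card_univ,
      Fintype.card_perm, Fintype.card_fin, nsmul_eq_mul]
  · intro p _ hp
    refine Finset.sum_eq_zero fun e _ => ?_
    rw [Equiv.Perm.decomposeFin_symm_apply_zero, h p hp]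
    simp

/-- The product of a covector with an alternating form, evaluated on vectors of which the covector
only sees the last one. -/
theorem wedgeAlt_one_apply {n : ℕ} (α : F [⋀^Fin 1]→L[ℝ] ℝ) (β : F [⋀^Fin n]→L[ℝ] ℝ)
    (u : Fin (1 + n) → F) (h : ∀ k : Fin (1 + n), (k : ℕ) ≠ n → α (fun _ => u k) = 0) :
    wedgeAlt α β u =
      (-1) ^ n * (α (fun _ => u ⟨n, by omega⟩) * β fun i => u ⟨i, by omega⟩) := by
  -- the cycle `c` moves the last vector to the front, which costs the sign `(-1) ^ n`
  set c : Equiv.Perm (Fin (n + 1)) := (finRotate (n + 1)).symm with hc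
  have hc0 : c 0 = Fin.last n := by rw [hc, Equiv.symm_apply_eq, finRotate_last]
  have hcs : ∀ i : Fin n, c i.succ = i.castSucc := by
    intro i
    rw [hc, Equiv.symm_apply_eq]
    ext
    simp
  have hsc : Equiv.Perm.sign c = (-1) ^ n := by
    rw [hc, Equiv.Perm.sign_symm, sign_finRotate, Nat.add_sub_cancel]
  let f : Fin (1 + n) ≃ Fin (n + 1) := finCongr (Nat.add_comm 1 n)
  let w : Fin (n + 1) → F := fun k => u (f.symm (c k))
  have hw := sum_perm_eq_of_forall_ne_zero (fun v => α fun _ => v) β w (by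
    intro k hk
    refine h _ fun h' => hk ?_
    have h2 : c k = Fin.last n := Fin.ext h'
    rw [← hc0] at h2
    exact c.injective h2)
  rw [wedgeAlt, ContinuousAlternatingMap.smul_apply,
    ContinuousMultilinearMap.alternatization_apply_apply]
  have e1 : ∑ σ : Equiv.Perm (Fin (1 + n)), Equiv.Perm.sign σ • mulForms α β (u ∘ σ) =
      (-1) ^ n * ∑ σ : Equiv.Perm (Fin (n + 1)), ((Equiv.Perm.sign σ : ℤ) : ℝ) *
        (α (fun _ => w (σ 0)) * β fun i => w (σ i.succ)) := by
    rw [← Equiv.sum_comp f.symm.permCongr, ← Equiv.sum_comp (Equiv.mulLeft c), Finset.mul_sum]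
    refine Finset.sum_congr rfl fun σ _ => ?_
    rw [Equiv.Perm.sign_permCongr, Equiv.coe_mulLeft, Equiv.Perm.sign_mul, hsc, mulForms_apply,
      Units.smul_def, zsmul_eq_mul, Units.val_mul, Int.cast_mul, mul_assoc]
    congr 1
    · simp
    congr 2
    · congr 1
      funext i
      rw [Subsingleton.elim i 0]
      rfl
    · congr 1
      funext i
      have : f (Fin.natAdd 1 i) = i.succ := Fin.ext (Nat.add_comm 1 i)
      simp [w, Equiv.permCongr_apply, this]
  rw [e1, hw, Nat.factorial_one, one_mul, smul_eq_mul]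
  have hn : (n.factorial : ℝ) ≠ 0 := by positivity
  simp only [w, hc0, hcs]
  field_simp
  rfl

end WedgeEvaluation

section Diagonal

variable {E : Type*} [NormedAddCommGroup E] [NormedSpace ℝ E] [FiniteDimensional ℝ E]
  {G : Type*} [TopologicalSpace G] [ChartedSpace E G] [Group G] [LieGroup 𝓘(ℝ, E) ∞ G]

variable (E G) in
/-- The part of `Ω(EG)` in bidegrees `(p, q)` with `p ≤ q`. -/
def upperTot : Submodule ℝ (TotEG E G) := gradedSub fun pq => if pq.1 ≤ pq.2 then ⊤ else ⊥

variable (E G) in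
/-- The part of `Ω(EG)` in bidegrees `(p, q)` with `p < q`. -/
def strictUpperTot : Submodule ℝ (TotEG E G) := gradedSub fun pq => if pq.1 < pq.2 then ⊤ else ⊥

theorem apply_eq_zero_of_mem_upperTot {α : TotEG E G} (h : α ∈ upperTot E G) {pq : ℕ × ℕ}
    (hpq : pq.2 < pq.1) : α pq = 0 := by
  have := h pq
  simp only at this
  rwa [if_neg (by omega)] at this

theorem apply_eq_zero_of_mem_strictUpperTot {α : TotEG E G} (h : α ∈ strictUpperTot E G)
    {pq : ℕ × ℕ} (hpq : pq.2 ≤ pq.1) : α pq = 0 := by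
  have := h pq
  simp only at this
  rwa [if_neg (by omega)] at this

theorem inEG_mem_upperTot {p q : ℕ} (h : p ≤ q) (η : PowForm E G (p + 1) q) :
    inEG E G p q η ∈ upperTot E G :=
  inEG_mem_gradedSub (by rw [if_pos h]; trivial)

theorem inEG_mem_strictUpperTot {p q : ℕ} (h : p < q) (η : PowForm E G (p + 1) q) :
    inEG E G p q η ∈ strictUpperTot E G :=
  inEG_mem_gradedSub (by rw [if_pos h]; trivial)

theorem cupTot_mem_upperTot {α β : TotEG E G} (hα : α ∈ upperTot E G) (hβ : β ∈ upperTot E G) :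
    cupTot E G α β ∈ upperTot E G := by
  refine cupTot_mem_gradedSub ?_ hα hβ
  intro p q p' q' η η' h h'
  by_cases h1 : p ≤ q
  · by_cases h2 : p' ≤ q'
    · rw [if_pos (by simp only; omega)]; trivial
    · rw [if_neg h2, Submodule.mem_bot] at h'
      rw [h', map_zero]; exact Submodule.zero_mem _
  · rw [if_neg h1, Submodule.mem_bot] at h
    rw [h, map_zero]; exact Submodule.zero_mem _

theorem cupTot_mem_strictUpperTot_left {α β : TotEG E G} (hα : α ∈ strictUpperTot E G)
    (hβ : β ∈ upperTot E G) : cupTot E G α β ∈ strictUpperTot E G := by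
  refine cupTot_mem_gradedSub ?_ hα hβ
  intro p q p' q' η η' h h'
  by_cases h1 : p < q
  · by_cases h2 : p' ≤ q'
    · rw [if_pos (by simp only; omega)]; trivial
    · rw [if_neg h2, Submodule.mem_bot] at h'
      rw [h', map_zero]; exact Submodule.zero_mem _
  · rw [if_neg h1, Submodule.mem_bot] at h
    rw [h, map_zero]; exact Submodule.zero_mem _

theorem cupTot_mem_strictUpperTot_right {α β : TotEG E G} (hα : α ∈ upperTot E G)
    (hβ : β ∈ strictUpperTot E G) : cupTot E G α β ∈ strictUpperTot E G := by
  refine cupTot_mem_gradedSub ?_ hα hβ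
  intro p q p' q' η η' h h'
  by_cases h1 : p ≤ q
  · by_cases h2 : p' < q'
    · rw [if_pos (by simp only; omega)]; trivial
    · rw [if_neg h2, Submodule.mem_bot] at h'
      rw [h', map_zero]; exact Submodule.zero_mem _
  · rw [if_neg h1, Submodule.mem_bot] at h
    rw [h, map_zero]; exact Submodule.zero_mem _

theorem charGen_mem_upperTot (v : LieDual E G × LieDual E G) : charGen E G v ∈ upperTot E G := by
  rw [charGen_apply]
  exact add_mem (inEG_mem_upperTot (by omega) _)
    (add_mem (inEG_mem_upperTot (by omega) _) (inEG_mem_upperTot (by omega) _))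

theorem charHom_mem_upperTot (a : NCWeilAlg E G) : charHom E G a ∈ upperTot E G := by
  induction a using TensorAlgebra.left_induction with
  | one => rw [charHom_one]; exact inEG_mem_upperTot le_rfl _
  | add a b ha hb => rw [map_add]; exact add_mem ha hb
  | smul r a ha => rw [map_smul]; exact Submodule.smul_mem _ r ha
  | ι_mul v a ha => rw [charHom_ι_mul]; exact cupTot_mem_upperTot (charGen_mem_upperTot v) ha

/-- Near the diagonal `p = q` the odd letters `t(ξ)` do not contribute. -/
theorem charHom_sub_letterMap_mem (a : NCWeilAlg E G) :
    charHom E G a - charHom E G (letterMap 0 LinearMap.id a) ∈ strictUpperTot E G := by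
  induction a using TensorAlgebra.left_induction with
  | one => rw [map_one (letterMap _ _), sub_self]; exact Submodule.zero_mem _
  | add a b ha hb =>
    rw [map_add, map_add, map_add, add_sub_add_comm]; exact add_mem ha hb
  | smul r a ha =>
    rw [map_smul, map_smul, map_smul]
    exact (smul_sub r (charHom E G a) _) ▸ Submodule.smul_mem _ r ha
  | ι_mul v a ha =>
    rw [map_mul (letterMap _ _), letterMap_ι, charHom_ι_mul, charHom_ι_mul]
    have e : cupTot E G (charGen E G v) (charHom E G a) -
        cupTot E G (charGen E G ((0 : LieDual E G →ₗ[ℝ] LieDual E G) v.1,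
          (LinearMap.id : LieDual E G →ₗ[ℝ] LieDual E G) v.2))
          (charHom E G (letterMap 0 LinearMap.id a)) =
        cupTot E G (inEG E G 0 1 (thetaEG E G v.1)) (charHom E G a) +
          cupTot E G (charGen E G (0, v.2))
            (charHom E G a - charHom E G (letterMap 0 LinearMap.id a)) := by
      have : charGen E G v = inEG E G 0 1 (thetaEG E G v.1) + charGen E G (0, v.2) := by
        rw [charGen_apply, charGen_apply]; simp
      rw [this, map_add, LinearMap.add_apply, map_sub]
      simp only [LinearMap.zero_apply, LinearMap.id_apply]
      abel
    rw [e]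
    exact add_mem (cupTot_mem_strictUpperTot_left (inEG_mem_strictUpperTot (by omega) _)
      (charHom_mem_upperTot a)) (cupTot_mem_strictUpperTot_right (charGen_mem_upperTot _) ha)

theorem tangentMapAt_reindex {m n : ℕ} (s : Fin n → Fin m) (x : Fin m → G) (v : Fin m → E) :
    tangentMapAt (powModel E m) (powModel E n) (fun (x : Fin m → G) i => x (s i)) x v =
      fun i => v (s i) := by
  funext i
  rw [tangentMapAt_pow_apply ((contMDiff_reindex s).mdifferentiable (by simp) x),
    tangentMapAt_proj]
  rfl

theorem thetaEG_one_apply (ξ : LieDual E G) (v : Fin 1 → Fin 1 → E) :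
    thetaEG E G ξ 1 v = ξ (v 0 0) := by
  change ξ (maurerCartan E G 1 fun k =>
    tangentMapAt (powModel E 1) 𝓘(ℝ, E) (fun x : Fin 1 → G => x 0) 1 (v k)) = _
  rw [maurerCartan_apply, tangentMapAt_proj]
  simp only [inv_one, one_mul]
  rw [tangentMapAt_id]
  rfl

/-- The form `∂θ(ξ)` at the unit of `G²` is the difference of the two copies of `ξ`. -/
theorem simpD_thetaEG_one_apply (ξ : LieDual E G) (v : Fin 1 → Fin 2 → E) :
    simpD E G 0 1 (thetaEG E G ξ) 1 v = ξ (v 0 1) - ξ (v 0 0) := by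
  have h : ∀ i : Fin 2, powPullback (fun (x : Fin 2 → G) (j : Fin 1) => x (i.succAbove j))
      (thetaEG E G ξ) 1 v = ξ (v 0 (i.succAbove 0)) := by
    intro i
    rw [powPullback_apply]
    simp only [tangentMapAt_reindex]
    exact thetaEG_one_apply ξ _
  rw [simpD_apply, Fin.sum_univ_two]
  have := h 0
  have h1 := h 1
  simp only [Pi.add_apply, Pi.smul_apply, ContinuousAlternatingMap.add_apply,
    ContinuousAlternatingMap.smul_apply, smul_eq_mul, Fin.val_zero, Fin.val_one, pow_zero, pow_one]
  rw [h, h]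
  simp [sub_eq_add_neg]

end Diagonal

/-! ### The composite of the two maps -/

section DiagonalEvaluation

variable {E : Type*} [NormedAddCommGroup E] [NormedSpace ℝ E] [FiniteDimensional ℝ E]
  {G : Type*} [TopologicalSpace G] [ChartedSpace E G] [Group G] [LieGroup 𝓘(ℝ, E) ∞ G]

theorem charWord_mem_upperTot (n : ℕ) (v : Fin n → LieDual E G × LieDual E G) :
    charWord E G n v ∈ upperTot E G := by
  rw [← charHom_tprod]; exact charHom_mem_upperTot _

/-- The value at the unit of the cup product of `∂θ(ξ)` with an `n`-form, on the vectors
`x_n, …, x_0` placed in the entries `n + 1, …, 1`. -/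
theorem cupEG_simpD_thetaEG_apply {n : ℕ} (ξ : LieDual E G) (η : PowForm E G (n + 1) n)
    (x : ℕ → E) :
    cupEG E G 1 1 n n (simpD E G 0 1 (thetaEG E G ξ)) η 1
      (fun k : Fin (1 + n) => Pi.single k.rev.succ (x k.rev)) =
    ξ (x 0) * η 1 (fun k : Fin n => Pi.single k.rev.succ (x (k.rev + 1))) := by
  rw [cupEG_apply]
  change (-1 : ℝ) ^ (1 * n) • wedgeAlt _ _ _ = _
  have h1 : ∀ v : Fin (1 + n + 1) → E, powPullback
      (fun (x : Fin (1 + n + 1) → G) (i : Fin (1 + 1)) => x ⟨i, by omega⟩)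
      (simpD E G 0 1 (thetaEG E G ξ)) 1 (fun _ : Fin 1 => v) =
      ξ (v ⟨1, by omega⟩) - ξ (v 0) := by
    intro v
    rw [powPullback_apply]
    simp only [tangentMapAt_reindex (fun i : Fin (1 + 1) => (⟨i, by omega⟩ : Fin (1 + n + 1)))]
    exact simpD_thetaEG_one_apply ξ _
  rw [wedgeAlt_one_apply]
  · rw [h1, smul_eq_mul, ← mul_assoc, one_mul, ← mul_pow, neg_one_mul, neg_neg, one_pow, one_mul]
    congr 1
    · have h2 : (Fin.rev (⟨n, by omega⟩ : Fin (1 + n))) = ⟨0, by omega⟩ :=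
        Fin.ext (by simp only [Fin.val_rev]; omega)
      have h3 : Fin.succ (⟨0, by omega⟩ : Fin (1 + n)) = ⟨1, by omega⟩ := rfl
      rw [h2, h3, Pi.single_eq_same, Pi.single_eq_of_ne (by simp [Fin.ext_iff])]
      exact (congrArg _ (map_zero ξ)).trans (sub_zero _)
    · rw [powPullback_apply]
      congr 1
      funext k
      rw [tangentMapAt_reindex (fun i : Fin (n + 1) => (⟨1 + i, by omega⟩ : Fin (1 + n + 1)))]
      funext i
      have hk := k.2
      have hv : ((Fin.rev (⟨k, by omega⟩ : Fin (1 + n)) : Fin (1 + n)) : ℕ) = k.rev + 1 := by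
        simp only [Fin.val_rev]; omega
      rw [Pi.single_apply, Pi.single_apply, hv]
      congr 1
      simp only [Fin.ext_iff, Fin.val_succ, hv, eq_iff_iff]
      omega
  · intro k hk
    have h2 : (⟨1, by omega⟩ : Fin (1 + n + 1)) ≠ k.rev.succ := by
      have := k.2
      simp only [ne_eq, Fin.ext_iff, Fin.val_succ, Fin.val_rev]
      omega
    rw [h1, Pi.single_eq_of_ne h2, Pi.single_eq_of_ne (Fin.succ_ne_zero _).symm]
    exact sub_self _

/-- A word in the even letters `w(ξ)` goes, up to bidegrees `p < q`, to a form in bidegree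
`(n, n)`, whose value at the unit is computed by telescoping the forms `∂θ(ξ)`. The degree of the
form is a variable `m = n`, as the cup product lands in degree `1 + n` and not `n + 1`; for the same
reason the arguments are indexed by `ℕ`. -/
theorem exists_charWord_eq {n : ℕ} (ξ : Fin n → LieDual E G) :
    ∃ (m : ℕ) (_ : m = n) (η : PowForm E G (m + 1) m),
      charWord E G n (fun i => (0, ξ i)) - inEG E G m m η ∈ strictUpperTot E G ∧
      ∀ x : ℕ → E,
        η 1 (fun k : Fin m => Pi.single k.rev.succ (x k.rev)) = ∏ i, ξ i (x i) := by
  induction n with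
  | zero =>
    refine ⟨0, rfl, fun _ => ContinuousAlternatingMap.constOfIsEmpty ℝ (Fin 1 → E) (Fin 0) 1,
      ?_, fun x => ?_⟩
    · have : charWord E G 0 (fun i => (0, ξ i)) = oneEG E G := rfl
      rw [this, oneEG, sub_self]
      exact Submodule.zero_mem _
    · simp
  | succ n ih =>
    obtain ⟨m, hm, η, h1, h2⟩ := ih (Fin.tail ξ)
    refine ⟨1 + m, by omega, cupEG E G 1 1 m m (simpD E G 0 1 (thetaEG E G (ξ 0))) η, ?_, ?_⟩
    · rw [charWord_succ, ← cupTot_inEG]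
      change cupTot E G (charGen E G (0, ξ 0)) (charWord E G n fun i => (0, Fin.tail ξ i)) - _ ∈ _
      set w := charWord E G n fun i => (0, Fin.tail ξ i)
      have e : cupTot E G (charGen E G (0, ξ 0)) w - cupTot E G
          (inEG E G 1 1 (simpD E G 0 1 (thetaEG E G (ξ 0)))) (inEG E G m m η) =
          cupTot E G (inEG E G 0 2 (dThetaEG E G (ξ 0))) w + cupTot E G
            (inEG E G 1 1 (simpD E G 0 1 (thetaEG E G (ξ 0)))) (w - inEG E G m m η) := by
        have : charGen E G (0, ξ 0) = inEG E G 0 2 (dThetaEG E G (ξ 0)) +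
            inEG E G 1 1 (simpD E G 0 1 (thetaEG E G (ξ 0))) := by
          rw [charGen_apply, map_zero, map_zero, zero_add, add_comm]
        rw [this, map_add, LinearMap.add_apply, map_sub]
        abel
      rw [e]
      exact add_mem (cupTot_mem_strictUpperTot_left (inEG_mem_strictUpperTot (by omega) _)
        (charWord_mem_upperTot _ _))
        (cupTot_mem_strictUpperTot_right (inEG_mem_upperTot le_rfl _) h1)
    · intro x
      rw [cupEG_simpD_thetaEG_apply, h2 fun i => x (i + 1), Fin.prod_univ_succ]
      rfl

theorem charWord_apply_of_ne {n : ℕ} (ξ : Fin n → LieDual E G) {m : ℕ} (h : m ≠ n) :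
    charWord E G n (fun i => (0, ξ i)) (m, m) = 0 := by
  obtain ⟨_, rfl, η, h1, -⟩ := exists_charWord_eq ξ
  have := apply_eq_zero_of_mem_strictUpperTot h1 (pq := (m, m)) le_rfl
  rw [DirectSum.sub_apply, inEG_apply_of_ne _ (by simpa using h), sub_zero] at this
  exact this

theorem charWord_apply_diag {n : ℕ} (ξ : Fin n → LieDual E G) (x : Fin n → E) :
    charWord E G n (fun i => (0, ξ i)) (n, n) 1
      (fun k : Fin n => Pi.single k.rev.succ (x k.rev)) = ∏ i, ξ i (x i) := by
  obtain ⟨_, rfl, η, h1, h2⟩ := exists_charWord_eq ξ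
  rename_i m
  have := apply_eq_zero_of_mem_strictUpperTot h1 (pq := (m, m)) le_rfl
  rw [DirectSum.sub_apply, inEG_apply_same, sub_eq_zero] at this
  rw [this]
  have h3 := h2 fun i => if h : i < m then x ⟨i, h⟩ else 0
  simp only [Fin.is_lt, dite_true, Fin.eta] at h3
  exact h3

/-- On and below the diagonal, the image of a product of linear forms is the symmetrisation of the
image of the word in the corresponding even letters. -/
theorem charHom_weilSym_algHom_tprod {n : ℕ} (ξ : Fin n → LieDual E G) (m : ℕ) :
    charHom E G (weilSym E G (SymmetricAlgebra.algHom ℝ _ (TensorAlgebra.tprod ℝ _ n ξ))) (m, m) =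
      ((n.factorial : ℝ)⁻¹ • ∑ σ : Equiv.Perm (Fin n),
        charWord E G n (fun i => (0, ξ (σ i)))) (m, m) := by
  have h1 := apply_eq_zero_of_mem_strictUpperTot (charHom_sub_letterMap_mem (E := E) (G := G)
    (weilSym E G (SymmetricAlgebra.algHom ℝ _ (TensorAlgebra.tprod ℝ _ n ξ))))
    (pq := (m, m)) le_rfl
  rw [DirectSum.sub_apply, sub_eq_zero] at h1
  rw [h1, weilSym_algHom, ← symOp_letterMap]
  have h2 : letterMap (0 : LieDual E G →ₗ[ℝ] LieDual E G) LinearMap.id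
      (TensorAlgebra.lift ℝ (ncCurv E G) (TensorAlgebra.tprod ℝ _ n ξ)) =
      TensorAlgebra.tprod ℝ _ n fun i => ((0, ξ i) : LieDual E G × LieDual E G) := by
    rw [TensorAlgebra.tprod_apply, TensorAlgebra.tprod_apply, map_list_prod, map_list_prod,
      List.map_ofFn, List.map_ofFn]
    congr 2
    funext i
    simp [ncCurv, ncW, ncT, letterMap_ι, Prod.mk_zero_zero]
  rw [h2, SuperSym.symOp_tprod, SuperSym.symMulti_apply, map_smul, map_sum]
  congr 2
  refine Finset.sum_congr rfl fun σ _ => ?_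
  -- all letters are even, so only their even parts contribute and there are no Koszul signs
  rw [map_sum, Finset.sum_eq_single (fun _ => false) _ (by simp), map_smul, charHom_tprod]
  · simp [SuperSym.koszulSign, SuperSym.parityProj]
  · intro ε _ hε
    obtain ⟨j, hj⟩ := Function.ne_iff.1 hε
    rw [(TensorAlgebra.tprod ℝ (LieDual E G × LieDual E G) n).map_coord_zero (σ⁻¹ j),
      smul_zero, map_zero]
    have : ε j = true := by simpa using hj
    simp [this, SuperSym.parityProj]

/-- At the unit, `ι` maps the generating vector field `x^{i,♯}` to the vector `x` in the `i`-th
entry. -/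
theorem tangentMapAt_sectionMap_genField {p : ℕ} (i : Fin p) (x : LieAlg E G) :
    tangentMapAt (powModel E p) (powModel E (p + 1))
      (fun (y : Fin p → G) (j : Fin (p + 1)) => (Fin.partialProd y j)⁻¹) 1
      (genField E i.succ x 1) = Pi.single i.succ (show E from x) := by
  have hγ := contMDiff_gammaAct_apply (E := E) i.succ (1 : Fin p → G)
  have h1 : gammaAct i.succ (1 : G) (1 : Fin p → G) = 1 := by
    funext j
    simp [gammaAct, zetaAct]
  have h2 := tangentMapAt_comp_apply (I := 𝓘(ℝ, E)) (I' := powModel E p)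
    (I'' := powModel E (p + 1)) (g := fun (y : Fin p → G) (j : Fin (p + 1)) =>
      (Fin.partialProd y j)⁻¹) (f := fun g : G => gammaAct i.succ g (1 : Fin p → G)) 1
    ((contMDiff_sectionMap p).mdifferentiable (by simp) _) (hγ.mdifferentiable (by simp) _) x
  rw [h1] at h2
  refine h2.symm.trans ?_
  -- `ι ∘ γ_i` maps `g` to the point of `EG_p` with `i`-th entry `g` and all other entries `e`
  have h3 : (fun (g : G) (j : Fin (p + 1)) =>
      (Fin.partialProd (gammaAct i.succ g (1 : Fin p → G)) j)⁻¹) =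
      fun g => (Pi.mulSingle i.succ g : Fin (p + 1) → G) := by
    funext g j
    rw [gammaAct, partialProd_zetaAct]
    rw [partialProd_one, Pi.mulSingle_eq_of_ne (Fin.succ_ne_zero i).symm]
    simp
  have h5 := (contMDiff_sectionMap (E := E) (G := G) p).comp hγ
  change ContMDiff _ _ _ (fun (g : G) (j : Fin (p + 1)) =>
      (Fin.partialProd (gammaAct i.succ g (1 : Fin p → G)) j)⁻¹) at h5
  rw [h3] at h5 ⊢
  funext j
  refine (tangentMapAt_pow_apply (h5.mdifferentiable (by simp) _) (show E from x) j).trans ?_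
  by_cases hj : j = i.succ
  · subst hj
    simp only [Pi.mulSingle_eq_same]
    rw [tangentMapAt_id]
    exact (Pi.single_eq_same (M := fun _ : Fin (p + 1) => E) i.succ (show E from x)).symm
  · simp only [Pi.mulSingle_eq_of_ne hj]
    rw [tangentMapAt_const]
    exact (Pi.single_eq_of_ne (M := fun _ : Fin (p + 1) => E) hj (show E from x)).symm

/-- The symmetrised Van Est form of `AM(P)` is given by the iterated derivatives of `P`. -/
theorem sum_vanEstMulti_alekseevMeinrenken {m : ℕ} (P : SymDual E G) (x : Fin m → LieAlg E G) :
    ∑ τ : Equiv.Perm (Fin m), vanEstMulti (alekseevMeinrenken E G P (m, m)) (fun i => x (τ i)) =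
      symEval (List.ofFn x) P := by
  have h1 : ∀ (P : SymDual E G) (y : Fin m → LieAlg E G),
      vanEstMulti (alekseevMeinrenken E G P (m, m)) y =
        charHom E G (weilSym E G P) (m, m) 1 fun k : Fin m => Pi.single k.rev.succ (y k.rev) := by
    intro P y
    rw [vanEstMulti_apply, alekseevMeinrenken_apply, powPullback_apply]
    have h2 : (fun j : Fin (m + 1) => (Fin.partialProd (1 : Fin m → G) j)⁻¹) = 1 := by
      funext j
      rw [Pi.one_apply, inv_eq_one, partialProd_one]
    simp only [tangentMapAt_sectionMap_genField]
    simp only [h2]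
  simp only [h1]
  obtain ⟨a, rfl⟩ := SymmetricAlgebra.algHom_surjective ℝ _ P
  have ha : a ∈ Submodule.span ℝ {a : TensorAlgebra ℝ (LieDual E G) |
      ∃ (n : ℕ) (v : Fin n → LieDual E G), a = TensorAlgebra.tprod ℝ _ n v} := by
    rw [span_tprod_eq_top]; trivial
  induction ha using Submodule.span_induction with
  | zero => simp
  | add a b _ _ ha hb =>
    simp only [map_add, DirectSum.add_apply, Pi.add_apply, ContinuousAlternatingMap.add_apply,
      Finset.sum_add_distrib, ha, hb]
  | smul r a _ ha =>
    simp only [map_smul, ← ha, Finset.smul_sum]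
    rfl
  | mem a ha =>
    obtain ⟨n, ξ, rfl⟩ := ha
    have e : SymmetricAlgebra.algHom ℝ _ (TensorAlgebra.tprod ℝ _ n ξ) =
        ∏ i, SymmetricAlgebra.ι ℝ _ (ξ i) := by
      rw [TensorAlgebra.tprod_apply, map_list_prod, List.map_ofFn, List.prod_ofFn]
      rfl
    have h3 : ∀ y : Fin m → LieAlg E G, charHom E G (weilSym E G (SymmetricAlgebra.algHom ℝ _
        (TensorAlgebra.tprod ℝ _ n ξ))) (m, m) 1
          (fun k : Fin m => Pi.single k.rev.succ (show E from y k.rev)) =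
        (n.factorial : ℝ)⁻¹ * ∑ σ : Equiv.Perm (Fin n),
          charWord E G n (fun i => (0, ξ (σ i))) (m, m) 1
          (fun k : Fin m => Pi.single k.rev.succ (show E from y k.rev)) := by
      intro y
      rw [charHom_weilSym_algHom_tprod, DirectSum.smul_apply, DirectSum.sum_apply, Pi.smul_apply,
        Finset.sum_apply, ContinuousAlternatingMap.smul_apply, ContinuousAlternatingMap.sum_apply,
        smul_eq_mul]
    rw [e]
    by_cases hmn : m = n
    · subst hmn
      rw [symEval_ofFn_prod]
      have h4 : ∀ τ : Equiv.Perm (Fin m), charHom E G (weilSym E G (SymmetricAlgebra.algHom ℝ _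
          (TensorAlgebra.tprod ℝ _ m ξ))) (m, m) 1
            (fun k : Fin m => Pi.single k.rev.succ (show E from x (τ k.rev))) =
          (m.factorial : ℝ)⁻¹ * ∑ σ : Equiv.Perm (Fin m), ∏ j, ξ (σ j) (x j) := by
        intro τ
        rw [h3 fun i => x (τ i)]
        congr 1
        rw [← Equiv.sum_comp (Equiv.mulRight τ)]
        refine Finset.sum_congr rfl fun σ _ => ?_
        refine (charWord_apply_diag (E := E) _ fun i => x (τ i)).trans ?_
        exact Equiv.prod_comp τ fun j => ξ (σ j) (x j)
      rw [← e]
      refine (Finset.sum_congr rfl fun τ _ => h4 τ).trans ?_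
      rw [Finset.sum_const, Finset.card_univ, Fintype.card_perm, Fintype.card_fin, nsmul_eq_mul,
        ← mul_assoc, mul_inv_cancel₀ (by positivity), one_mul]
    · rw [symEval_prod_of_length_ne _ _ (by simpa using hmn), ← e]
      refine Finset.sum_eq_zero fun τ _ => ?_
      refine (h3 fun i => x (τ i)).trans ?_
      simp [charWord_apply_of_ne _ hmn]

/-- The Van Est map is a left inverse of the Alekseev-Meinrenken map on all polynomials. -/
theorem vanEst_alekseevMeinrenken (P : SymDual E G) :
    vanEst E (alekseevMeinrenken E G P) = symToWeil E G P := by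
  refine IsVanEst.vanEst_eq ?_
  intro q r x
  rw [weilEval_symToWeil]
  cases r with
  | zero =>
    rw [if_pos rfl]
    refine ((vanEstSum_zero_right _ x).trans ?_).symm
    exact sum_vanEstMulti_alekseevMeinrenken P x
  | succ r =>
    have h : alekseevMeinrenken E G P (q + (r + 1), q) = 0 := by
      rw [alekseevMeinrenken_apply, apply_eq_zero_of_mem_upperTot (charHom_mem_upperTot _)
        (by simp only; omega), map_zero]
    rw [if_neg (Nat.succ_ne_zero r), h,
      vanEstSum_eq_zero (Nat.succ_ne_zero r) fun _ => map_zero _]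

end DiagonalEvaluation

end

theorem theorem3p7 (E : Type*) [NormedAddCommGroup E] [NormedSpace ℝ E] [FiniteDimensional ℝ E]
    (G : Type*) [TopologicalSpace G] [ChartedSpace E G] [Group G] [LieGroup 𝓘(ℝ, E) ∞ G]
    [SimplyConnectedSpace G] :
    -- the Alekseev-Meinrenken map sends `(S 𝔤*)^G` to `Ω(BG)^{G_{•+1}}`
    (∀ P ∈ invPoly E G, IsInvTot E G (alekseevMeinrenken E G P)) ∧
    -- the Van Est map is well defined on `Ω(BG)^{G_{•+1}}` and takes values in `(S 𝔤*)^G`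
    (∀ α : TotBG E G, IsInvTot E G α →
      (∃! ξ, IsVanEst E α ξ) ∧ ∃ Q ∈ invPoly E G, vanEst E α = symToWeil E G Q) ∧
    -- the composite `VE ∘ AM` is the identity of `(S 𝔤*)^G`
    (∀ P ∈ invPoly E G, vanEst E (alekseevMeinrenken E G P) = symToWeil E G P) ∧
    -- on monomials in the coordinates of any basis
    (∀ (n : ℕ) (e : Module.Basis (Fin n) ℝ (LieAlg E G)) (p : ℕ) (a : Fin p → Fin n),
      vanEst E (alekseevMeinrenken E G
          (∏ i, SymmetricAlgebra.ι ℝ (LieDual E G) (e.coord (a i)))) =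
        symToWeil E G (∏ i, SymmetricAlgebra.ι ℝ (LieDual E G) (e.coord (a i)))) := by
  exact ⟨fun _ hP => isInvTot_alekseevMeinrenken hP, fun _ hα => existsUnique_isVanEst hα,
    fun P _ => vanEst_alekseevMeinrenken P, fun _ _ _ _ => vanEst_alekseevMeinrenken _⟩
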